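/- **Setting.** Let $S^1\subset\mathbb C$ be the unit circle and give $C^\infty(S^1)$ its Fréchet topology (norms $\|f\|_{C^N}=\sum_{j=0}^N\|\tfrac{d^j f}{d\theta^j}\|_\infty$). Let $\mathrm{M\ddot ob}=\mathrm{PSU}(1,1)$ be the group of transformations $z\mapsto\frac{az+b}{\bar bz+\bar a}$, $|a|^2-|b|^2=1$, of $S^1$. For $\gamma\in\mathrm{M\ddot ob}$ and $d\in\mathbb Z_{\ge0}$ put $X_\gamma(e^{i\theta})=-i\frac{d}{d\theta}\log\gamma(e^{i\theta})$ and $(\beta_d(\gamma)f)(z)=X_\gamma(\gamma^{-1}(z))^{d-1}f(\gamma^{-1}(z))$. Let $\mathcal D$ be a complex vector space, $\mathcal F$ a set of linear maps $\varphi:C^\infty(S^1)\to\mathcal L(\mathcal D)$ (linear operators on $\mathcal D$). The $\mathcal F$-strong topology on $\mathcal D$ is the finest locally convex vector topology for which all expressions $\varphi_1(f_1)\cdots\varphi_k(f_k)\Phi$ ($\varphi_j\in\mathcal F$, $\Phi\in\mathcal D$, $k\ge0$) are jointly continuous in $(f_1,\dots,f_k)$. $\mathcal F$ acts regularly if the linear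 functionals $\lambda$ on $\mathcal D$ for which all $(f_1,\dots,f_k)\mapsto\lambda(\varphi_1(f_1)\cdots\varphi_k(f_k)\Phi)$ are jointly continuous separate the points of $\mathcal D$. Let $\operatorname{End}(\mathcal D)$ be the $\mathcal F$-strongly continuous linear operators on $\mathcal D$. A *(not necessarily unitary) Wightman CFT* $(\mathcal F,\mathcal D,U,\Omega)$ on $S^1$ consists of such a regularly acting $\mathcal F$, a representation $U:\mathrm{M\ddot ob}\to\operatorname{End}(\mathcal D)$ and a vector $0\ne\Omega\in\mathcal D$ such that: (W1) each $\varphi\in\mathcal F$ has a conformal dimension $d_\varphi\in\mathbb Z_{\ge0}$ with $U(\gamma)\varphi(f)U(\gamma)^{-1}=\varphi(\beta_{d_\varphi}(\gamma)f)$ for all $\gamma$, $f$; (W2) $\varphi(f)$ and $\psi(g)$ commute for $\varphi,\psi\in\mathcal F$ whenever $f,g$ have disjoint supports; (W3) if $d\in\mathbb Z$, $d<0$, and $U(r_\theta)\Phi=e^{id\theta}\Phi$ for all rotations $r_\theta$, then $\Phi=0$; (W4) $U(\gamma)\Omega=\Omega$ for all $\gamma$, and $\mathcal D$ is algebraically spanned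 by the vectors $\varphi_1(f_1)\cdots\varphi_k(f_k)\Omega$. It is *involutive* if it is equipped with a nondegenerate Hermitian form $\langle\cdot,\cdot\rangle$ on $\mathcal D$ (linear in the first variable), jointly $\mathcal F$-strongly continuous, and an antilinear PCT involution $\theta$ ($\theta^2=1$, $\theta\Omega=\Omega$), antiunitary in the sense $\langle\theta\Phi,\theta\Psi\rangle=\overline{\langle\Phi,\Psi\rangle}$, such that $\langle U(\gamma)\Phi,U(\gamma)\Psi\rangle=\langle\Phi,\Psi\rangle$ for all $\gamma$, and such that for every $\varphi\in\mathcal F$, with $\varphi^\dagger(f)=(-1)^{d_\varphi}\theta\varphi(\bar f\circ z^{-1})\theta$, one has $\langle\varphi(f)\Phi,\Psi\rangle=\langle\Phi,\varphi^\dagger(\bar f)\Psi\rangle$ and $(-1)^{d_\varphi}\varphi^\dagger\in\mathcal F$. In an involutive theory let $\operatorname{End}_*(\mathcal D)$ be the set of $x\in\operatorname{End}(\mathcal D)$ for which there is a (necessarily unique) $x^*\in\operatorname{End}(\mathcal D)$ with $\langle x\Phi,\Psi\rangle=\langle\Phi,x^*\Psi\rangle$ for all $\Phi,\Psi$. Let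 $I_\pm=\{z\in S^1:\pm\operatorname{Im}z>0\}$, and let $\mathcal P(I_\pm)$ be the unital algebra of operators on $\mathcal D$ generated by all $\varphi(f)$ with $\varphi\in\mathcal F$ and $\operatorname{supp}f\subset I_\pm$. Let $V_t=U(v_t)$ with $v_t(z)=\frac{\cosh(t/2)z-\sinh(t/2)}{-\sinh(t/2)z+\cosh(t/2)}$, $t\in\mathbb R$. For $\tau\in\mathbb C$ let $\mathbb S_\tau$ be the closed strip bounded by $\mathbb R$ and $\mathbb R+\tau$. The partially defined operator $V_\tau$ on $\mathcal D$ has as its domain $D(V_\tau)$ the set of $\Phi\in\mathcal D$ for which there is a (necessarily unique) $\Psi\in\mathcal D$ such that for every $\Phi'\in\mathcal D$ there is a function $G_{\Phi'}:\mathbb S_\tau\to\mathbb C$, continuous on $\mathbb S_\tau$ and holomorphic in its interior, with $G_{\Phi'}(t)=\langle V_t\Phi,\Phi'\rangle$ and $G_{\Phi'}(\tau+t)=\langle V_t\Psi,\Phi'\rangle$ for all $t\in\mathbb R$; and $V_\tau\Phi=\Psi$. **Theorem (non-unitary Bisognano–Wichmann property).** Let $(\mathcal F,\mathcal D,U,\Omega)$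 be an involutive Wightman CFT on $S^1$ with PCT involution $\theta$. Then $\mathcal P(I_\pm)\subset\operatorname{End}_*(\mathcal D)$, and: (i) $\mathcal P(I_+)\Omega\subset D(V_{i\pi})$, and $V_{i\pi}x\Omega=\theta x^*\Omega$ for all $x\in\mathcal P(I_+)$; (ii) $\mathcal P(I_-)\Omega\subset D(V_{-i\pi})$, and $V_{-i\pi}x\Omega=\theta x^*\Omega$ for all $x\in\mathcal P(I_-)$. -/

import Mathlib

open scoped Manifold ContDiff ComplexConjugate

noncomputable section

namespace MobiusCFT

/-! ## Smooth functions on the circle -/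

/-- The complex vector space of smooth complex-valued functions on the unit circle. -/
def smoothSubmodule : Submodule ℂ (Circle → ℂ) where
  carrier := {f | ContMDiff (𝓡 1) 𝓘(ℝ, ℂ) ∞ f}
  add_mem' := fun hf hg => ContMDiff.add hf hg
  zero_mem' := contMDiff_const
  smul_mem' := fun c _ hf => (contDiff_const_smul (𝕜 := ℝ) c).contMDiff.comp hf

/-- `C^∞(S¹)`, as a type of its own (so that it carries only the Fréchet topology below). -/
def CInf : Type := smoothSubmodule

instance : AddCommGroup CInf := inferInstanceAs (AddCommGroup smoothSubmodule)
instance : Module ℂ CInf := inferInstanceAs (Module ℂ smoothSubmodule)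

instance : FunLike CInf Circle ℂ where
  coe f := f.1
  coe_injective _ _ h := Subtype.ext h

theorem CInf.contMDiff (f : CInf) : ContMDiff (𝓡 1) 𝓘(ℝ, ℂ) ∞ f := f.2

/-- Build an element of `C^∞(S¹)` from a function and a proof of smoothness. -/
def CInf.mk (f : Circle → ℂ) (hf : ContMDiff (𝓡 1) 𝓘(ℝ, ℂ) ∞ f) : CInf := ⟨f, hf⟩

@[simp] theorem CInf.mk_apply (f : Circle → ℂ) (hf) (z : Circle) : CInf.mk f hf z = f z := rfl
@[simp] theorem CInf.add_apply (f g : CInf) (z : Circle) : (f + g) z = f z + g z := rfl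
@[simp] theorem CInf.smul_apply (c : ℂ) (f : CInf) (z : Circle) : (c • f) z = c * f z := rfl
@[ext] theorem CInf.ext {f g : CInf} (h : ∀ z, f z = g z) : f = g := DFunLike.ext _ _ h

/-- `f` as a function of the angle: `θ ↦ f(e^{iθ})`. -/
def CInf.angular (f : CInf) (θ : ℝ) : ℂ := f (Circle.exp θ)

theorem CInf.contDiff_angular (f : CInf) : ContDiff ℝ ∞ f.angular :=
  (f.contMDiff.comp contMDiff_circleExp).contDiff

theorem CInf.bddAbove_deriv (f : CInf) (j : ℕ) :
    BddAbove (Set.range fun θ : ℝ => ‖iteratedDeriv j f.angular θ‖) := by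
  have hper : Function.Periodic (iteratedDeriv j f.angular) (2 * Real.pi) := by
    have h : (fun θ : ℝ => f.angular (θ + 2 * Real.pi)) = f.angular := by
      funext θ
      simp [CInf.angular, Circle.periodic_exp θ]
    intro θ
    have h2 := congrFun (iteratedDeriv_comp_add_const j f.angular (2 * Real.pi)) θ
    rw [h] at h2
    exact h2.symm
  have hc : Continuous (iteratedDeriv j f.angular) :=
    f.contDiff_angular.continuous_iteratedDeriv j (by exact_mod_cast le_top)
  obtain ⟨C, hC⟩ := (hper.isBounded_of_continuous (by positivity) hc).exists_norm_le
  exact ⟨C, by rintro _ ⟨θ, rfl⟩; exact hC _ ⟨θ, rfl⟩⟩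

/-- The seminorm `f ↦ ‖f^{(j)}‖_∞`, the derivative being `d/dθ`. -/
def derivSeminorm (j : ℕ) : Seminorm ℂ CInf :=
  Seminorm.of (fun f => ⨆ θ : ℝ, ‖iteratedDeriv j f.angular θ‖)
    (fun f g => by
      refine ciSup_le fun θ => ?_
      have h : iteratedDeriv j (f + g).angular θ
          = iteratedDeriv j f.angular θ + iteratedDeriv j g.angular θ :=
        iteratedDeriv_fun_add (f.contDiff_angular.contDiffAt.of_le (by exact_mod_cast le_top))
          (g.contDiff_angular.contDiffAt.of_le (by exact_mod_cast le_top))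
      rw [h]
      exact (norm_add_le _ _).trans
        (add_le_add (le_ciSup (f.bddAbove_deriv j) θ) (le_ciSup (g.bddAbove_deriv j) θ)))
    (fun c f => by
      have h : ∀ θ, iteratedDeriv j (c • f).angular θ = c * iteratedDeriv j f.angular θ :=
        fun θ => iteratedDeriv_const_mul_field c f.angular
      simp only [h, norm_mul]
      exact (Real.mul_iSup_of_nonneg (norm_nonneg c) _).symm)

/-- The `C^N` norm `∑_{j ≤ N} ‖f^{(j)}‖_∞`. -/
def cNorm : SeminormFamily ℂ CInf ℕ := fun N => ∑ j ∈ Finset.range (N + 1), derivSeminorm j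

/-- The Fréchet topology of `C^∞(S¹)`, defined by the `C^N` norms. -/
instance : TopologicalSpace CInf := cNorm.moduleFilterBasis.topology

/-- Complex conjugation `f ↦ f̄` (pointwise). -/
def CInf.conj (f : CInf) : CInf :=
  CInf.mk (fun z => conj (f z)) (Complex.conjCLE.contDiff.contMDiff.comp f.contMDiff)

/-- `f ↦ f ∘ z⁻¹`. -/
def CInf.reflect (f : CInf) : CInf :=
  CInf.mk (fun z => f z⁻¹) (f.contMDiff.comp (contMDiff_inv (𝓡 1) ∞))

@[simp] theorem CInf.conj_apply (f : CInf) (z : Circle) : f.conj z = conj (f z) := rfl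
@[simp] theorem CInf.reflect_apply (f : CInf) (z : Circle) : f.reflect z = f z⁻¹ := rfl

/-! ## The Möbius group `PSU(1,1)` acting on the circle -/

/-- The matrix `(a, b; b̄, ā)` lies in `SU(1,1)`. -/
def IsSU (a b : ℂ) : Prop := ‖a‖ ^ 2 - ‖b‖ ^ 2 = 1

theorem IsSU.inv {a b : ℂ} (h : IsSU a b) : IsSU (conj a) (-b) := by
  simpa [IsSU] using h

theorem IsSU.mul_conj {a b : ℂ} (h : IsSU a b) : a * conj a - b * conj b = 1 := by
  rw [Complex.mul_conj, Complex.mul_conj, Complex.normSq_eq_norm_sq, Complex.normSq_eq_norm_sq]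
  exact_mod_cast h

theorem IsSU.denom_ne {a b : ℂ} (h : IsSU a b) {z : ℂ} (hz : ‖z‖ = 1) :
    conj b * z + conj a ≠ 0 := by
  intro h0
  have h1 : ‖conj b * z‖ = ‖conj a‖ := by
    rw [eq_neg_of_add_eq_zero_left h0, norm_neg]
  rw [norm_mul, hz, mul_one, RCLike.norm_conj, RCLike.norm_conj] at h1
  have h2 : ‖a‖ ^ 2 - ‖b‖ ^ 2 = 1 := h
  rw [h1, sub_self] at h2
  exact zero_ne_one h2

/-- The Möbius transformation `z ↦ (a z + b) / (b̄ z + ā)` on the circle. -/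
def mobFun (a b : ℂ) (h : IsSU a b) (z : Circle) : Circle :=
  ⟨(a * z + b) / (conj b * z + conj a), by
    have hz : (z : ℂ) * conj (z : ℂ) = 1 := by
      rw [Complex.mul_conj, Circle.normSq_coe]; simp
    have hd := h.denom_ne z.norm_coe
    have he : conj b * (z : ℂ) + conj a = z * conj (a * z + b) := by
      simp only [map_add, map_mul]
      linear_combination (-conj a) * hz
    change _ ∈ Metric.sphere (0 : ℂ) 1
    rw [mem_sphere_zero_iff_norm, norm_div, div_eq_one_iff_eq (norm_ne_zero_iff.2 hd), he, norm_mul, RCLike.norm_conj,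
      z.norm_coe, one_mul]⟩

theorem coe_mobFun {a b : ℂ} (h : IsSU a b) (z : Circle) :
    (mobFun a b h z : ℂ) = (a * z + b) / (conj b * z + conj a) := rfl

theorem mobFun_inv {a b : ℂ} (h : IsSU a b) (h' : IsSU (conj a) (-b)) (z : Circle) :
    mobFun (conj a) (-b) h' (mobFun a b h z) = z := by
  apply Circle.ext
  have hd := h.denom_ne z.norm_coe
  have hd2 := h'.denom_ne (mobFun a b h z).norm_coe
  rw [coe_mobFun, div_eq_iff hd2, coe_mobFun]
  have hq := div_mul_cancel₀ (a * (z : ℂ) + b) hd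
  simp only [map_neg, Complex.conj_conj]
  linear_combination hq

/-- The Möbius transformation as a bijection of the circle. -/
def mobPerm (a b : ℂ) (h : IsSU a b) : Equiv.Perm Circle where
  toFun := mobFun a b h
  invFun := mobFun (conj a) (-b) h.inv
  left_inv := mobFun_inv h h.inv
  right_inv z := by
    have h1 : IsSU (conj (conj a)) (-(-b)) := by simpa using h
    have := mobFun_inv h.inv h1 z
    simpa using this

@[simp] theorem mobPerm_apply {a b : ℂ} (h : IsSU a b) (z : Circle) :
    mobPerm a b h z = mobFun a b h z := rfl

/-- The Möbius group `Möb = PSU(1,1)`, as the group of transformations of the circle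
`z ↦ (a z + b) / (b̄ z + ā)` with `|a|² - |b|² = 1`. -/
def Mob : Subgroup (Equiv.Perm Circle) where
  carrier := {γ | ∃ (a b : ℂ) (h : IsSU a b), γ = mobPerm a b h}
  one_mem' := ⟨1, 0, by simp [IsSU], by
    refine Equiv.ext fun z => Circle.ext ?_
    have h1 : IsSU 1 0 := by simp [IsSU]
    change (z : ℂ) = mobFun 1 0 h1 z
    rw [coe_mobFun]
    simp⟩
  mul_mem' := by
    rintro _ _ ⟨a, b, h, rfl⟩ ⟨c, d, k, rfl⟩
    have hm : IsSU (a * c + b * conj d) (a * d + b * conj c) := by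
      have e : ∀ x y : ℂ, IsSU x y ↔ x * conj x - y * conj y = 1 := fun x y =>
        ⟨IsSU.mul_conj, fun hh => by
          rw [Complex.mul_conj, Complex.mul_conj, Complex.normSq_eq_norm_sq,
            Complex.normSq_eq_norm_sq] at hh
          exact_mod_cast hh⟩
      rw [e] at h k ⊢
      simp only [map_add, map_mul, Complex.conj_conj]
      linear_combination (c * conj c - d * conj d) * h + k
    refine ⟨_, _, hm, ?_⟩
    refine Equiv.ext fun z => Circle.ext ?_
    have hd := k.denom_ne z.norm_coe
    have hd2 := h.denom_ne (mobFun c d k z).norm_coe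
    have hd3 := hm.denom_ne z.norm_coe
    rw [Equiv.Perm.mul_apply, mobPerm_apply, mobPerm_apply, mobPerm_apply, coe_mobFun h,
      coe_mobFun hm, div_eq_div_iff hd2 hd3, coe_mobFun]
    have hq := div_mul_cancel₀ (c * (z : ℂ) + d) hd
    simp only [map_add, map_mul, Complex.conj_conj]
    linear_combination (a * conj a - b * conj b) * hq
  inv_mem' := by
    rintro _ ⟨a, b, h, rfl⟩
    exact ⟨_, _, h.inv, Equiv.ext fun _ => rfl⟩

/-- The element of `Möb` given by `a, b` with `|a|² - |b|² = 1`. -/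
def mob (a b : ℂ) (h : IsSU a b) : Mob := ⟨mobPerm a b h, a, b, h, rfl⟩

@[simp] theorem coe_mob_apply {a b : ℂ} (h : IsSU a b) (z : Circle) :
    ((mob a b h : Mob) : Equiv.Perm Circle) z = mobFun a b h z := rfl

theorem isSU_v (t : ℝ) : IsSU (Real.cosh (t / 2) : ℝ) (-Real.sinh (t / 2) : ℝ) := by
  rw [IsSU, Complex.norm_real, Complex.norm_real, Real.norm_eq_abs, Real.norm_eq_abs, sq_abs,
    sq_abs, neg_sq, Real.cosh_sq_sub_sinh_sq]

theorem isSU_rot (θ : ℝ) : IsSU (Circle.exp (θ / 2)) 0 := by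
  rw [IsSU, Circle.norm_coe]
  norm_num

/-- The one-parameter group
`v_t(z) = (cosh(t/2) z - sinh(t/2)) / (- sinh(t/2) z + cosh(t/2))`. -/
def v (t : ℝ) : Mob :=
  mob (Real.cosh (t / 2) : ℝ) (-Real.sinh (t / 2) : ℝ) (isSU_v t)

theorem coe_v_apply (t : ℝ) (z : Circle) :
    (((v t : Mob) : Equiv.Perm Circle) z : ℂ) =
      (Real.cosh (t / 2) * z - Real.sinh (t / 2)) /
        (-Real.sinh (t / 2) * z + Real.cosh (t / 2)) := by
  rw [v, coe_mob_apply, coe_mobFun, Complex.conj_ofReal, Complex.conj_ofReal]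
  push_cast
  ring

/-- The rotation `r_θ(z) = e^{iθ} z`. -/
def rot (θ : ℝ) : Mob :=
  mob (Circle.exp (θ / 2)) 0 (isSU_rot θ)

theorem rot_apply (θ : ℝ) (z : Circle) :
    ((rot θ : Mob) : Equiv.Perm Circle) z = Circle.exp θ * z := by
  apply Circle.ext
  have h : (Circle.exp θ : ℂ) = Circle.exp (θ / 2) * Circle.exp (θ / 2) := by
    rw [← Circle.coe_mul, ← Circle.exp_add, add_halves]
  have h2 : conj (Circle.exp (θ / 2) : ℂ) * (Circle.exp (θ / 2) : ℂ) = 1 := by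
    rw [mul_comm, Complex.mul_conj, Circle.normSq_coe]; simp
  have h3 : conj (Circle.exp (θ / 2) : ℂ) ≠ 0 := left_ne_zero_of_mul_eq_one h2
  rw [rot, coe_mob_apply, coe_mobFun, Circle.coe_mul, h]
  simp only [map_zero, zero_mul, zero_add, add_zero]
  rw [div_eq_iff h3]
  linear_combination (-(Circle.exp (θ / 2) : ℂ) * z) * h2

/-- `X_γ(e^{iθ}) = -i (d/dθ) log γ(e^{iθ})`, the logarithmic derivative of `γ` along the circle. -/
def X (γ : Mob) (z : Circle) : ℂ :=
  -Complex.I * logDeriv (fun θ : ℝ => ((γ : Equiv.Perm Circle) (z * Circle.exp θ) : ℂ)) 0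

theorem X_mob {a b : ℂ} (h : IsSU a b) (z : Circle) :
    X (mob a b h) z = 1 / ((conj b * z + conj a) * conj (conj b * z + conj a)) := by
  have hz : (z : ℂ) * conj (z : ℂ) = 1 := by
    rw [Complex.mul_conj, Circle.normSq_coe]; simp
  have hd := h.denom_ne z.norm_coe
  have hdc : conj (conj b * (z : ℂ) + conj a) ≠ 0 := (map_ne_zero _).2 hd
  have hn : a * (z : ℂ) + b ≠ 0 := by
    have he : a * (z : ℂ) + b = z * conj (conj b * (z : ℂ) + conj a) := by
      simp only [map_add, map_mul, Complex.conj_conj]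
      linear_combination (-b) * hz
    rw [he]
    exact mul_ne_zero z.coe_ne_zero hdc
  have hf : (fun θ : ℝ => (((mob a b h : Mob) : Equiv.Perm Circle) (z * Circle.exp θ) : ℂ)) =
      fun θ : ℝ => (a * (z * Complex.exp (θ * Complex.I)) + b) /
        (conj b * (z * Complex.exp (θ * Complex.I)) + conj a) := by
    funext θ
    change (mobFun a b h _ : ℂ) = _
    rw [coe_mobFun, Circle.coe_mul, Circle.coe_exp]
  have he : HasDerivAt (fun θ : ℝ => (z : ℂ) * Complex.exp (θ * Complex.I))
      (z * Complex.I) 0 := by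
    have h1 : HasDerivAt (fun w : ℂ => (z : ℂ) * Complex.exp (w * Complex.I))
        (z * (Complex.exp ((0 : ℝ) * Complex.I) * (1 * Complex.I))) ((0 : ℝ) : ℂ) :=
      (((hasDerivAt_id _).mul_const _).cexp).const_mul _
    simpa using h1.comp_ofReal
  have hq := ((he.const_mul a).add_const b).div ((he.const_mul (conj b)).add_const (conj a))
    (by simpa using hd)
  rw [X, hf, logDeriv_apply]
  rw [show (fun θ : ℝ => (a * (z * Complex.exp (θ * Complex.I)) + b) /
        (conj b * (z * Complex.exp (θ * Complex.I)) + conj a)) =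
      (fun θ : ℝ => (a * (z * Complex.exp (θ * Complex.I)) + b)) /
        (fun θ : ℝ => (conj b * (z * Complex.exp (θ * Complex.I)) + conj a)) from rfl]
  rw [hq.deriv]
  have hab := h.mul_conj
  have hconj : conj (conj b * (z : ℂ) + conj a) = conj (z : ℂ) * (a * z + b) := by
    simp only [map_add, map_mul, Complex.conj_conj]
    linear_combination (-a) * hz
  have hzc : conj (z : ℂ) ≠ 0 := right_ne_zero_of_mul_eq_one hz
  rw [hconj]
  simp only [Complex.ofReal_zero, zero_mul, Complex.exp_zero, mul_one]
  have hI := Complex.I_mul_I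
  have hk : a * (z * Complex.I) * (conj b * z + conj a) - (a * z + b) * (conj b * (z * Complex.I))
      = z * Complex.I := by linear_combination (z * Complex.I) * hab
  rw [hk]
  generalize conj b * (z : ℂ) + conj a = D at *
  generalize a * (z : ℂ) + b = N at *
  change -Complex.I * (z * Complex.I / D ^ 2 / (N / D)) = _
  have h2 : D ^ 2 * (N / D) = D * N := by field_simp
  have h3 : D * (conj (z : ℂ) * N) ≠ 0 := mul_ne_zero hd (mul_ne_zero hzc hn)
  rw [div_div, h2, ← mul_div_assoc, div_eq_div_iff (mul_ne_zero hd hn) h3]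
  linear_combination (-D * N * z * conj (z : ℂ)) * hI + D * N * hz

theorem contMDiff_of_contDiffAt {F : ℂ → ℂ} (hF : ∀ z : ℂ, ‖z‖ = 1 → ContDiffAt ℝ ∞ F z) :
    ContMDiff (𝓡 1) 𝓘(ℝ, ℂ) ∞ fun z : Circle => F z := fun z =>
  have := Fact.mk Complex.finrank_real_complex
  (hF z z.norm_coe).contMDiffAt.comp z (contMDiff_coe_sphere z)

theorem contMDiff_mobFun {a b : ℂ} (h : IsSU a b) :
    ContMDiff (𝓡 1) (𝓡 1) ∞ (mobFun a b h) := by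
  have := Fact.mk Complex.finrank_real_complex
  refine ContMDiff.codRestrict_sphere
    (contMDiff_of_contDiffAt (F := fun z => (a * z + b) / (conj b * z + conj a)) fun z hz => ?_) _
  simp only [div_eq_mul_inv]
  exact ((contDiffAt_const.mul contDiffAt_id).add contDiffAt_const).mul
    (((contDiffAt_const.mul contDiffAt_id).add contDiffAt_const).inv (h.denom_ne hz))

theorem contMDiff_mob (γ : Mob) : ContMDiff (𝓡 1) (𝓡 1) ∞ (γ : Equiv.Perm Circle) := by
  obtain ⟨_, a, b, h, rfl⟩ := γ
  exact contMDiff_mobFun h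

theorem contMDiff_X_zpow (γ : Mob) (n : ℤ) :
    ContMDiff (𝓡 1) 𝓘(ℝ, ℂ) ∞ fun z => X γ z ^ n := by
  obtain ⟨_, a, b, h, rfl⟩ := γ
  have hX : (fun z => X ⟨_, a, b, h, rfl⟩ z ^ n) = fun z : Circle =>
      ((conj b * (z : ℂ) + conj a) * conj (conj b * (z : ℂ) + conj a)) ^ (-n) := by
    funext z
    have := X_mob h z
    rw [mob] at this
    rw [this, one_div, inv_zpow, zpow_neg]
  rw [hX]
  refine contMDiff_of_contDiffAt
    (F := fun z => ((conj b * z + conj a) * conj (conj b * z + conj a)) ^ (-n)) fun z hz => ?_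
  have hd := h.denom_ne hz
  have h1 : ContDiffAt ℝ ∞ (fun z : ℂ => conj b * z + conj a) z :=
    (contDiffAt_const.mul contDiffAt_id).add contDiffAt_const
  have h2 : ContDiffAt ℝ ∞ (fun z : ℂ => conj (conj b * z + conj a)) z :=
    Complex.conjCLE.contDiff.contDiffAt.comp z h1
  have h3 := h1.mul h2
  have h4 := mul_ne_zero hd ((map_ne_zero (starRingEnd ℂ)).2 hd)
  rcases (-n) with m | m
  · simpa only [Int.ofNat_eq_natCast, zpow_natCast] using h3.pow m
  · simp only [zpow_negSucc]
    exact (h3.pow (m + 1)).inv (pow_ne_zero _ h4)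
/-- `(β_d(γ) f)(z) = X_γ(γ⁻¹ z)^{d-1} f(γ⁻¹ z)`. -/
def beta (d : ℕ) (γ : Mob) (f : CInf) : CInf :=
  CInf.mk (fun z => X γ (((γ⁻¹ : Mob) : Equiv.Perm Circle) z) ^ ((d : ℤ) - 1) *
      f (((γ⁻¹ : Mob) : Equiv.Perm Circle) z))
    ((contDiff_mul (𝕜 := ℝ) (𝔸 := ℂ)).contMDiff.comp
      (((contMDiff_X_zpow γ _).comp (contMDiff_mob γ⁻¹)).prodMk_space
        (f.contMDiff.comp (contMDiff_mob γ⁻¹))))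

/-! ## Families of operator-valued distributions -/

/-- Operator-valued distributions `φ : C^∞(S¹) → L(D)`; their continuity is the regularity
condition `ActsRegularly` below. -/
abbrev OVD (D : Type*) [AddCommGroup D] [Module ℂ D] := CInf →ₗ[ℂ] Module.End ℂ D

section Family

variable {D : Type*} [AddCommGroup D] [Module ℂ D]

/-- The product `φ₁(f₁) ⋯ φ_k(f_k)` (the identity if `k = 0`). -/
def smear {k : ℕ} (φ : Fin k → OVD D) (f : Fin k → CInf) : Module.End ℂ D :=
  (List.ofFn fun i => φ i (f i)).prod

/-- The linear functional `l` on `D` is compatible with `F`: all the multilinear maps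
`(f₁, …, f_k) ↦ l(φ₁(f₁) ⋯ φ_k(f_k) Φ)` are jointly continuous. -/
def IsCompatible (F : Set (OVD D)) (l : D →ₗ[ℂ] ℂ) : Prop :=
  ∀ (k : ℕ) (φ : Fin k → OVD D), (∀ i, φ i ∈ F) → ∀ Φ : D,
    Continuous fun f : Fin k → CInf => l (smear φ f Φ)

/-- `F` acts regularly on `D`: the compatible functionals separate points. -/
def ActsRegularly (F : Set (OVD D)) : Prop :=
  ∀ Φ : D, Φ ≠ 0 → ∃ l : D →ₗ[ℂ] ℂ, IsCompatible F l ∧ l Φ ≠ 0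

/-- The locally convex vector topologies on `D` for which all expressions
`φ₁(f₁) ⋯ φ_k(f_k) Φ` are jointly continuous in the functions `f_j`. -/
def admissibleTopologies (F : Set (OVD D)) : Set (TopologicalSpace D) :=
  {t | @IsTopologicalAddGroup D t _ ∧ @ContinuousSMul ℂ D _ _ t ∧
    @LocallyConvexSpace ℝ D _ _ _ _ t ∧
    ∀ (k : ℕ) (φ : Fin k → OVD D), (∀ i, φ i ∈ F) → ∀ Φ : D,
      @Continuous (Fin k → CInf) D _ t fun f => smear φ f Φ}

/-- The `F`-strong topology, the finest admissible topology
(in the order of `TopologicalSpace D`, finer means smaller). -/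
@[reducible]
def strongTopology (F : Set (OVD D)) : TopologicalSpace D := sInf (admissibleTopologies F)

theorem strongTopology_isLeast (F : Set (OVD D)) :
    IsLeast (admissibleTopologies F) (strongTopology F) := by
  refine ⟨⟨topologicalAddGroup_sInf fun t ht => ht.1, continuousSMul_sInf fun t ht => ht.2.1,
    LocallyConvexSpace.sInf fun t ht => ht.2.2.1, fun k φ hφ Φ => ?_⟩, fun t ht => sInf_le ht⟩
  exact continuous_sInf_rng.2 fun t ht => ht.2.2.2 k φ hφ Φ

/-- `F`-strong continuity of a linear operator on `D`. -/
def IsStrongCont (F : Set (OVD D)) (x : Module.End ℂ D) : Prop :=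
  @Continuous D D (strongTopology F) (strongTopology F) x

/-- `φ` is Möbius-covariant with conformal dimension `d` under `U`. -/
def IsCovariant (U : Mob →* Module.End ℂ D) (φ : OVD D) (d : ℕ) : Prop :=
  ∀ (γ : Mob) (f : CInf), U γ * φ f * U γ⁻¹ = φ (beta d γ f)

/-- `Φ` has conformal dimension `d`: `U(r_θ) Φ = e^{idθ} Φ`. -/
def HasConformalDim (U : Mob →* Module.End ℂ D) (Φ : D) (d : ℤ) : Prop :=
  ∀ θ : ℝ, U (rot θ) Φ = Complex.exp (Complex.I * d * θ) • Φ

/-- `φ†(f) = (-1)^d θ φ(f̄ ∘ z⁻¹) θ`. -/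
def dagger (θ : D →ₗ⋆[ℂ] D) (d : ℕ) (φ : OVD D) : OVD D where
  toFun f :=
    { toFun := fun Φ => (-1 : ℂ) ^ d • θ (φ f.conj.reflect (θ Φ))
      map_add' := by simp
      map_smul' := fun c Φ => by simp [smul_comm c] }
  map_add' f g := by
    have h : (f + g).conj.reflect = f.conj.reflect + g.conj.reflect := by
      ext z; simp
    ext Φ
    simp [h]
  map_smul' c f := by
    have h : (c • f).conj.reflect = conj c • f.conj.reflect := by
      ext z; simp
    ext Φ
    simp [h, smul_comm c]

end Family

/-! ## Wightman conformal field theories -/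

/-- A (not necessarily unitary) Möbius-covariant Wightman CFT `(F, D, U, Ω)` on the circle. -/
structure WightmanCFT (D : Type*) [AddCommGroup D] [Module ℂ D] where
  F : Set (OVD D)
  U : Mob →* Module.End ℂ D
  Ω : D
  vacuum_ne_zero : Ω ≠ 0
  regular : ActsRegularly F
  /-- The representation is by `F`-strongly continuous operators. -/
  U_cont : ∀ γ, IsStrongCont F (U γ)
  /-- Möbius covariance. -/
  covariant : ∀ φ ∈ F, ∃ d : ℕ, IsCovariant U φ d
  /-- Locality. -/
  locality : ∀ φ ∈ F, ∀ ψ ∈ F, ∀ f g : CInf,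
    Disjoint (tsupport f) (tsupport g) → Commute (φ f) (ψ g)
  /-- Spectrum condition. -/
  spectrum : ∀ (d : ℤ) (Φ : D), d < 0 → HasConformalDim U Φ d → Φ = 0
  /-- Invariance of the vacuum. -/
  vacuum_invariant : ∀ γ, U γ Ω = Ω
  /-- The domain is algebraically spanned by the vectors `φ₁(f₁) ⋯ φ_k(f_k) Ω`. -/
  vacuum_cyclic : Submodule.span ℂ
    {Φ : D | ∃ (k : ℕ) (φ : Fin k → OVD D) (f : Fin k → CInf),
      (∀ i, φ i ∈ F) ∧ Φ = smear φ f Ω} = ⊤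

/-- An involutive Wightman CFT: a Wightman CFT with an invariant nondegenerate Hermitian form
(linear in the first variable) and an antiunitary PCT involution `θ`. -/
structure InvolutiveWightmanCFT (D : Type*) [AddCommGroup D] [Module ℂ D]
    extends WightmanCFT D where
  form : D →ₗ[ℂ] D →ₗ⋆[ℂ] ℂ
  θ : D →ₗ⋆[ℂ] D
  form_hermitian : ∀ Φ Ψ, form Φ Ψ = conj (form Ψ Φ)
  form_nondegenerate : ∀ Φ, (∀ Ψ, form Φ Ψ = 0) → Φ = 0
  /-- The form is jointly `F`-strongly continuous. -/
  form_cont : @Continuous (D × D) ℂ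
    (@instTopologicalSpaceProd D D (strongTopology F) (strongTopology F)) _
    fun p => form p.1 p.2
  /-- Möbius invariance of the form. -/
  form_U : ∀ γ Φ Ψ, form (U γ Φ) (U γ Ψ) = form Φ Ψ
  θ_involutive : ∀ Φ, θ (θ Φ) = Φ
  θ_vacuum : θ Ω = Ω
  θ_antiunitary : ∀ Φ Ψ, form (θ Φ) (θ Ψ) = conj (form Φ Ψ)
  /-- Invariance of the form under the fields: `⟨φ(f)Φ, Ψ⟩ = ⟨Φ, φ†(f̄)Ψ⟩`. -/
  form_field : ∀ φ ∈ F, ∀ d, IsCovariant U φ d → ∀ f Φ Ψ,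
    form (φ f Φ) Ψ = form Φ (dagger θ d φ f.conj Ψ)
  /-- `(-1)^d φ†` is again a field of the theory. -/
  dagger_mem : ∀ φ ∈ F, ∀ d, IsCovariant U φ d → (-1 : ℂ) ^ d • dagger θ d φ ∈ F

/-! ## Polynomial algebras, adjoints, and the continuation of `V_t` -/

/-- The upper semicircle `I₊`. -/
def upperArc : Set Circle := {z | 0 < (z : ℂ).im}

/-- The lower semicircle `I₋`. -/
def lowerArc : Set Circle := {z | (z : ℂ).im < 0}

/-- The closed strip bounded by the lines `ℝ` and `ℝ + τ`. -/
def strip (τ : ℂ) : Set ℂ := {z | z.im ∈ Set.uIcc 0 τ.im}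

theorem interior_strip (τ : ℂ) :
    interior (strip τ) = Complex.im ⁻¹' Set.Ioo (min 0 τ.im) (max 0 τ.im) := by
  change interior (Complex.im ⁻¹' Set.uIcc 0 τ.im) = _
  rw [Complex.interior_preimage_im, Set.uIcc, interior_Icc]

/-- A function on the strip that vanishes on `ℝ` vanishes near `ℝ` inside the strip. -/
theorem strip_zero_near {c : ℝ} {G : ℂ → ℂ}
    (hc : ContinuousOn G (Complex.im ⁻¹' Set.Icc 0 c))
    (hd : DifferentiableOn ℂ G (Complex.im ⁻¹' Set.Ioo 0 c))
    (h0 : ∀ t : ℝ, G t = 0) {w : ℂ} (hw : 0 < w.im) (hw2 : 2 * w.im ≤ c) : G w = 0 := by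
  set y := w.im with hy
  let S : Set ℂ := Set.Ioo (w.re - y) (w.re + y) ×ℂ Set.Ioo 0 (2 * y)
  let R : ℂ → ℂ → ℂ := fun q z => w + q * (z - w)
  let H : ℂ → ℂ := fun z => G (R 1 z) * G (R Complex.I z) * (G (R (-1) z) * G (R (-Complex.I) z))
  have hcl : closure S = Set.Icc (w.re - y) (w.re + y) ×ℂ Set.Icc 0 (2 * y) := by
    rw [Complex.closure_reProdIm, closure_Ioo (by linarith), closure_Ioo (by linarith)]
  have hSo : IsOpen S := isOpen_Ioo.reProdIm isOpen_Ioo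
  have key : ∀ q : ℂ, (q = 1 ∨ q = Complex.I ∨ q = -1 ∨ q = -Complex.I) →
      DiffContOnCl ℂ (fun z => G (R q z)) S := by
    intro q hq
    constructor
    · refine hd.comp (by fun_prop) ?_
      intro z hz
      obtain ⟨⟨h1, h2⟩, h3, h4⟩ := Complex.mem_reProdIm.1 hz
      rcases hq with rfl | rfl | rfl | rfl <;>
        simp only [R, Set.mem_preimage, Set.mem_Ioo, Complex.add_im, Complex.mul_im, Complex.sub_im,
          Complex.sub_re, Complex.one_re, Complex.one_im, Complex.I_re, Complex.I_im,
          Complex.neg_re, Complex.neg_im, ← hy] <;> constructor <;> linarith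
    · rw [hcl]
      refine hc.comp (by fun_prop) ?_
      intro z hz
      obtain ⟨⟨h1, h2⟩, h3, h4⟩ := Complex.mem_reProdIm.1 hz
      rcases hq with rfl | rfl | rfl | rfl <;>
        simp only [R, Set.mem_preimage, Set.mem_Icc, Complex.add_im, Complex.mul_im, Complex.sub_im,
          Complex.sub_re, Complex.one_re, Complex.one_im, Complex.I_re, Complex.I_im,
          Complex.neg_re, Complex.neg_im, ← hy] <;> constructor <;> linarith
  have hreal : ∀ z : ℂ, z.im = 0 → G z = 0 := fun z hz => by
    rw [show z = (z.re : ℂ) from Complex.ext rfl (by simpa using hz)]; exact h0 _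
  have hH : DiffContOnCl ℂ H S := by
    have k1 := key 1 (by simp)
    have k2 := key Complex.I (by simp)
    have k3 := key (-1) (by simp)
    have k4 := key (-Complex.I) (by simp)
    exact ⟨(k1.1.mul k2.1).mul (k3.1.mul k4.1), (k1.2.mul k2.2).mul (k3.2.mul k4.2)⟩
  have hfr : Set.EqOn H (fun _ => 0) (frontier S) := by
    intro z hz
    rw [frontier, hSo.interior_eq, hcl] at hz
    obtain ⟨hz1, hz2⟩ := hz
    obtain ⟨⟨h1, h2⟩, h3, h4⟩ := Complex.mem_reProdIm.1 hz1
    have hcase : z.re = w.re - y ∨ z.re = w.re + y ∨ z.im = 0 ∨ z.im = 2 * y := by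
      by_contra! hcon
      obtain ⟨a1, a2, a3, a4⟩ := hcon
      exact hz2 (Complex.mem_reProdIm.2 ⟨⟨lt_of_le_of_ne h1 a1.symm, lt_of_le_of_ne h2 a2⟩,
        lt_of_le_of_ne h3 a3.symm, lt_of_le_of_ne h4 a4⟩)
    have hcase2 : (R 1 z).im = 0 ∨ (R Complex.I z).im = 0 ∨ (R (-1) z).im = 0 ∨
        (R (-Complex.I) z).im = 0 := by
      simp only [R, Complex.add_im, Complex.mul_im, Complex.sub_im,
          Complex.sub_re, Complex.one_re, Complex.one_im, Complex.I_re, Complex.I_im,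
          Complex.neg_re, Complex.neg_im, ← hy]
      rcases hcase with h | h | h | h <;> rw [h]
      · right; left; ring
      · right; right; right; ring
      · left; ring
      · right; right; left; ring
    change _ * _ * (_ * _) = (0 : ℂ)
    rcases hcase2 with h | h | h | h <;> rw [hreal _ h] <;> ring
  have hb : Bornology.IsBounded S :=
    (Metric.isBounded_Ioo _ _).reProdIm (Metric.isBounded_Ioo _ _)
  have hwS : w ∈ S := Complex.mem_reProdIm.2
    ⟨⟨by linarith, by linarith⟩, by rw [← hy]; exact hw, by rw [← hy]; linarith⟩
  have hfin : H w = 0 := Complex.eqOn_of_eqOn_frontier hb hH diffContOnCl_const hfr hwS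
  simp only [H, R, sub_self, mul_zero, add_zero, mul_self_eq_zero] at hfin
  simpa using hfin

/-- Uniqueness of continuations: a function which is continuous on the strip, holomorphic in the
interior and zero on `ℝ` is zero. -/
theorem strip_zero {τ : ℂ} {G : ℂ → ℂ} (hc : ContinuousOn G (strip τ))
    (hd : DifferentiableOn ℂ G (interior (strip τ))) (h0 : ∀ t : ℝ, G t = 0) :
    ∀ z ∈ strip τ, G z = 0 := by
  have main : ∀ (c : ℝ) (G : ℂ → ℂ), 0 ≤ c → ContinuousOn G (Complex.im ⁻¹' Set.Icc 0 c) →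
      DifferentiableOn ℂ G (Complex.im ⁻¹' Set.Ioo 0 c) → (∀ t : ℝ, G t = 0) →
      ∀ z : ℂ, z.im ∈ Set.Icc 0 c → G z = 0 := by
    intro c G hc0 hc hd h0 z hz
    rcases hc0.eq_or_lt with rfl | hcpos
    · rw [show z = (z.re : ℂ) from Complex.ext rfl (by simpa using le_antisymm hz.2 hz.1)]
      exact h0 _
    have hop : IsOpen (Complex.im ⁻¹' Set.Ioo 0 c) := isOpen_Ioo.preimage Complex.continuous_im
    have hmem : ((c / 4 : ℝ) : ℂ) * Complex.I ∈ Complex.im ⁻¹' Set.Ioo 0 c := by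
      simp only [Set.mem_preimage, Complex.im_ofReal_mul, Complex.I_im,
        Set.mem_Ioo]
      constructor <;> linarith
    have hev : G =ᶠ[nhds (((c / 4 : ℝ) : ℂ) * Complex.I)] 0 := by
      have : Complex.im ⁻¹' Set.Ioo 0 (c / 2) ∈ nhds (((c / 4 : ℝ) : ℂ) * Complex.I) := by
        refine (isOpen_Ioo.preimage Complex.continuous_im).mem_nhds ?_
        simp only [Set.mem_preimage, Complex.im_ofReal_mul, Complex.I_im, Set.mem_Ioo]
        constructor <;> linarith
      filter_upwards [this] with w hw
      exact strip_zero_near hc hd h0 hw.1 (by have := hw.2; linarith)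
    have hpre : IsPreconnected (Complex.im ⁻¹' Set.Ioo 0 c) :=
      ((convex_Ioo (0 : ℝ) c).linear_preimage Complex.imLm).isPreconnected
    have hin := (hd.analyticOnNhd hop).eqOn_zero_of_preconnected_of_eventuallyEq_zero hpre hmem hev
    have hcl : Complex.im ⁻¹' Set.Icc 0 c ⊆ closure (Complex.im ⁻¹' Set.Ioo 0 c) := by
      rw [Complex.closure_preimage_im, closure_Ioo hcpos.ne]
    exact hin.of_subset_closure hc continuousOn_const
      (Set.preimage_mono Set.Ioo_subset_Icc_self) hcl hz
  rw [interior_strip] at hd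
  change ContinuousOn G (Complex.im ⁻¹' Set.uIcc 0 τ.im) at hc
  intro z hz
  change z.im ∈ Set.uIcc 0 τ.im at hz
  rcases le_total 0 τ.im with h | h
  · rw [Set.uIcc_of_le h] at hc hz
    rw [min_eq_left h, max_eq_right h] at hd
    exact main τ.im G h hc hd h0 z hz
  · rw [Set.uIcc_of_ge h] at hc hz
    rw [min_eq_right h, max_eq_left h] at hd
    have := main (-τ.im) (fun w => G (-w)) (by linarith)
      (hc.comp continuous_neg.continuousOn fun w hw => by
        simp only [Set.mem_preimage, Set.mem_Icc, Complex.neg_im] at hw ⊢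
        constructor <;> linarith [hw.1, hw.2])
      (hd.comp differentiable_neg.differentiableOn fun w hw => by
        simp only [Set.mem_preimage, Set.mem_Ioo, Complex.neg_im] at hw ⊢
        constructor <;> linarith [hw.1, hw.2])
      (fun t => by have := h0 (-t); push_cast at this; exact this) (-z)
      (by rw [Complex.neg_im]; constructor <;> linarith [hz.1, hz.2])
    simpa using this

/-- `P(I)`: the unital algebra generated by the operators `φ(f)` with `φ ∈ F`, `supp f ⊆ I`. -/
def WightmanCFT.polyAlg {D : Type*} [AddCommGroup D] [Module ℂ D] (T : WightmanCFT D)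
    (I : Set Circle) : Subalgebra ℂ (Module.End ℂ D) :=
  Algebra.adjoin ℂ {x | ∃ φ ∈ T.F, ∃ f : CInf, tsupport f ⊆ I ∧ x = φ f}

namespace InvolutiveWightmanCFT

variable {D : Type*} [AddCommGroup D] [Module ℂ D] (T : InvolutiveWightmanCFT D)

/-- `y` is the adjoint `x*` of `x`: `⟨xΦ, Ψ⟩ = ⟨Φ, yΨ⟩`. -/
def IsAdjoint (x y : Module.End ℂ D) : Prop := ∀ Φ Ψ, T.form (x Φ) Ψ = T.form Φ (y Ψ)

theorem IsAdjoint.unique {x y z : Module.End ℂ D} (hy : T.IsAdjoint x y)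
    (hz : T.IsAdjoint x z) : y = z := by
  ext Ψ
  refine sub_eq_zero.1 (T.form_nondegenerate _ fun Φ => ?_)
  rw [T.form_hermitian, map_sub, ← hy Φ Ψ, ← hz Φ Ψ, sub_self, map_zero]

/-- `End_*(D)`: the continuous operators on `D` with a (continuous) adjoint. -/
def EndStar : Set (Module.End ℂ D) :=
  {x | IsStrongCont T.F x ∧ ∃ y, IsStrongCont T.F y ∧ T.IsAdjoint x y}

/-- The adjoint `x*` of `x ∈ End_*(D)`. -/
def adj (x : T.EndStar) : Module.End ℂ D := x.2.2.choose

theorem isAdjoint_adj (x : T.EndStar) : T.IsAdjoint x (T.adj x) := x.2.2.choose_spec.2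

/-- The graph of `V_τ`: pairs `(Φ, Ψ)` such that for all `Φ'` the function `t ↦ ⟨V_t Φ, Φ'⟩`
extends to a function `G` continuous on the closed strip and holomorphic in its interior, with
`G(τ + t) = ⟨V_t Ψ, Φ'⟩`. -/
def graphV (τ : ℂ) : Submodule ℂ (D × D) where
  carrier := {p | ∀ Φ' : D, ∃ G : ℂ → ℂ, ContinuousOn G (strip τ) ∧
    DifferentiableOn ℂ G (interior (strip τ)) ∧
    (∀ t : ℝ, G t = T.form (T.U (v t) p.1) Φ') ∧
    (∀ t : ℝ, G (τ + t) = T.form (T.U (v t) p.2) Φ')}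
  add_mem' := by
    intro p q hp hq Φ'
    obtain ⟨G, h1, h2, h3, h4⟩ := hp Φ'
    obtain ⟨K, k1, k2, k3, k4⟩ := hq Φ'
    exact ⟨fun z => G z + K z, h1.add k1, h2.add k2, fun t => by simp [h3, k3],
      fun t => by simp [h4, k4]⟩
  zero_mem' := fun Φ' => ⟨fun _ => 0, continuousOn_const, differentiableOn_const _,
    fun t => by simp, fun t => by simp⟩
  smul_mem' := by
    intro c p hp Φ'
    obtain ⟨G, h1, h2, h3, h4⟩ := hp Φ'
    exact ⟨fun z => c * G z, continuousOn_const.mul h1, h2.const_mul c,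
      fun t => by simp [h3], fun t => by simp [h4]⟩

theorem v_zero : v 0 = 1 := by
  apply Subtype.ext
  refine Equiv.ext fun z => Circle.ext ?_
  rw [coe_v_apply]
  simp

/-- `V_τ Φ` is uniquely determined by `Φ`. -/
theorem graphV_singleValued (τ : ℂ) :
    ∀ p ∈ T.graphV τ, p.1 = 0 → p.2 = 0 := by
  intro p hp h0
  refine T.form_nondegenerate _ fun Φ' => ?_
  obtain ⟨G, h1, h2, h3, h4⟩ := hp Φ'
  have h5 := strip_zero h1 h2 (fun t => by rw [h3, h0]; simp) τ
    (show τ.im ∈ Set.uIcc 0 τ.im from Set.right_mem_uIcc)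
  have h6 := h4 0
  rw [Complex.ofReal_zero, add_zero, h5, v_zero] at h6
  simpa using h6.symm

/-- The analytically continued operator `V_τ`, a partially defined operator on `D`. -/
def V (τ : ℂ) : D →ₗ.[ℂ] D := (T.graphV τ).toLinearPMap

theorem mem_graph_V (τ : ℂ) (Φ Ψ : D) : (Φ, Ψ) ∈ (T.V τ).graph ↔ (Φ, Ψ) ∈ T.graphV τ := by
  rw [V, Submodule.toLinearPMap_graph_eq _ (T.graphV_singleValued τ)]

end InvolutiveWightmanCFT

end MobiusCFT

end

/-! The statement is linear in x, so it concerns products of fields smeared in the upper semicircle.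
`ReflectedWord` pairs such a product x with y = θ x* θ, which is the product in reverse order of the
fields (-1)^d φ(f ∘ z⁻¹), smeared in the lower semicircle. What has to be shown
(`ReflectedWord.stripPair`) is that t ↦ ⟨V_t xΩ, Φ'⟩ continues to the strip 0 ≤ Im ≤ π with upper
boundary value ⟨V_t yΩ, Φ'⟩.

One field. Invariance of the vacuum, covariance and the spectrum condition give φ(zⁿ)Ω = 0 for n ≥ 1
- d (`WightmanCFT.mode_vacuum_eq_zero`). So only the Fourier coefficients of β_d(v_t)f with n =
-(k+d), k ≥ 0, contribute. In the parameter u with tan(angle/2) = e^u the flow on the upper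
semicircle is translation, and the coefficient is the integral of a fixed compactly supported
function against z(u+t)^{k+d} cosh(u+t)^{-d}, where z(ζ) = (1 + i e^ζ)/(1 - i e^ζ). For 0 ≤ Im ζ ≤ π
this kernel is holomorphic and bounded by 1. At u + iπ the point z turns into z⁻¹ and cosh into
-cosh, which is the reflection with the sign (-1)^d. Summing the Fourier series gives
`stripPair_of_annihilates`.

Several fields, by induction on the length. For φ(f)x put M₀(s,t) = ⟨φ(β(v_s)f) V_t xΩ, Φ'⟩. Move
the field to Φ' and continue in t by induction: x becomes y, which gives M₁. Since V_t y V_t⁻¹ is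
localized in the lower semicircle, it commutes with φ(β(v_s)f). Move it to Φ' and continue in s by
the one-field case, which gives M₂. The claim is about the diagonal s = t.

Two successive continuations give one along the diagonal by `StripPair.diag`: average M₀ over
Gaussians centred at (τ,τ), which is entire in τ. At τ = t + iπ, Fubini and two contour shifts turn
the average of M₀ into that of M₂ at t. As the Gaussians shrink, Phragmén–Lindelöf carries
convergence from the boundary lines to the strip. All of this needs growth at most A exp(A t²),
uniformly on the strip. It holds because every C^N norm of β(v_t)f grows at most like this
(`AngularFamily`) and the correlation functions are continuous multilinear functionals of the test
functions.

The lower semicircle follows by applying the result to θ x* θ and shifting the strip by iπ. -/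

noncomputable section
namespace MobiusCFT
open MeasureTheory Filter Topology

/-! ## Boundary values of holomorphic functions on the strip `0 ≤ Im z ≤ π` -/

/-- The integral of a locally dominated family of holomorphic functions is holomorphic. -/
theorem differentiableOn_integral_of_dominated {α : Type*} [MeasurableSpace α] {μ : Measure α}
    {U : Set ℂ} (hU : IsOpen U) {F : ℂ → α → ℂ}
    (hm : ∀ z ∈ U, AEStronglyMeasurable (F z) μ) (hd : ∀ a, DifferentiableOn ℂ (fun z => F z a) U)
    (hb : ∀ z₀ ∈ U, ∃ r > 0, ∃ bound : α → ℝ, Integrable bound μ ∧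
      ∀ z ∈ Metric.ball z₀ r, ∀ a, ‖F z a‖ ≤ bound a) :
    DifferentiableOn ℂ (fun z => ∫ a, F z a ∂μ) U := by
  intro z₀ hz₀
  obtain ⟨r, hr, bound, hbi, hbd⟩ := hb z₀ hz₀
  obtain ⟨ρ, hρ, hρU⟩ := Metric.isOpen_iff.1 hU z₀ hz₀
  -- With 2q below both radii, every circle of radius q about a point of the q-ball stays where the
  -- family is holomorphic and dominated.
  obtain ⟨q, hq0, hq1, hq2⟩ : ∃ q > 0, 2 * q < r ∧ 2 * q < ρ :=
    ⟨min r ρ / 4, by positivity, by have := min_le_left r ρ; have := lt_min hr hρ; linarith,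
      by have := min_le_right r ρ; have := lt_min hr hρ; linarith⟩
  have hball : ∀ x ∈ Metric.ball z₀ q, Metric.closedBall x q ⊆ Metric.ball z₀ (2 * q) := by
    intro x hx y hy
    have h1 := dist_triangle y x z₀
    rw [Metric.mem_ball] at hx ⊢
    rw [Metric.mem_closedBall] at hy
    linarith
  have hsub1 : Metric.ball z₀ (2 * q) ⊆ Metric.ball z₀ r := Metric.ball_subset_ball hq1.le
  have hsub2 : Metric.ball z₀ (2 * q) ⊆ U := (Metric.ball_subset_ball hq2.le).trans hρU
  have hsub3 : Metric.ball z₀ q ⊆ Metric.ball z₀ (2 * q) := Metric.ball_subset_ball (by linarith)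
  have hdiff : ∀ a, ∀ x ∈ Metric.ball z₀ (2 * q),
      HasDerivAt (fun z => F z a) (deriv (fun z => F z a) x) x := fun a x hx =>
    ((hd a).differentiableAt (hU.mem_nhds (hsub2 hx))).hasDerivAt
  have hz0q : z₀ ∈ Metric.ball z₀ (2 * q) := Metric.mem_ball_self (by linarith)
  -- The derivative is measurable as a pointwise limit of difference quotients along a sequence
  -- tending to 0.
  have hmeas : AEStronglyMeasurable (fun a => deriv (fun z => F z a) z₀) μ := by
    let u : ℕ → ℂ := fun n => ((q / (n + 1) : ℝ) : ℂ)
    have hu0 : ∀ n, u n ≠ 0 := fun n => by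
      simp only [u, ne_eq, Complex.ofReal_eq_zero]; positivity
    have hut : Tendsto u atTop (𝓝 0) := by
      have h := tendsto_const_div_atTop_nhds_zero_nat q
      have h2 := (tendsto_add_atTop_iff_nat 1).2 h
      have h3 := (Complex.continuous_ofReal.tendsto 0).comp h2
      simpa [u, Function.comp_def] using h3
    have hub : ∀ n, z₀ + u n ∈ Metric.ball z₀ (2 * q) := fun n => by
      rw [Metric.mem_ball, dist_eq_norm, add_sub_cancel_left, Complex.norm_real, Real.norm_eq_abs,
        abs_of_pos (by positivity)]
      refine (div_le_self hq0.le (by linarith [n.cast_nonneg (α := ℝ)])).trans_lt (by linarith)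
    refine aestronglyMeasurable_of_tendsto_ae atTop
      (f := fun n a => (u n)⁻¹ • (F (z₀ + u n) a - F z₀ a)) (fun n => ?_) ?_
    · exact ((hm _ (hsub2 (hub n))).sub (hm _ hz₀)).const_smul ((u n)⁻¹)
    · refine Eventually.of_forall fun a => ?_
      have h := hasDerivAt_iff_tendsto_slope_zero.1 (hdiff a z₀ hz0q)
      exact h.comp (tendsto_nhdsWithin_iff.2 ⟨hut, Eventually.of_forall hu0⟩)
  -- Cauchy's estimate on circles of radius q bounds the derivative by `bound a / q`, so domination
  -- of the functions alone suffices.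
  have hmain := hasDerivAt_integral_of_dominated_loc_of_deriv_le (μ := μ) (F := F)
    (F' := fun z a => deriv (fun z => F z a) z) (bound := fun a => bound a / q) (x₀ := z₀)
    (Metric.ball_mem_nhds z₀ hq0)
    (by filter_upwards [hU.mem_nhds hz₀] with x hx using hm x hx)
    (hbi.mono' (hm z₀ hz₀) (Eventually.of_forall fun a => hbd z₀ (Metric.mem_ball_self hr) a))
    hmeas
    (Eventually.of_forall fun a x hx => by
      refine Complex.norm_deriv_le_of_forall_mem_sphere_norm_le hq0 ?_ fun z hz =>
        hbd z (hsub1 (hball x hx (Metric.sphere_subset_closedBall hz))) a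
      refine DifferentiableOn.diffContOnCl ?_
      refine (hd a).mono ((Metric.closure_ball_subset_closedBall).trans ?_)
      exact (hball x hx).trans hsub2)
    (hbi.div_const q) (Eventually.of_forall fun a x hx => hdiff a x (hsub3 hx))
  exact hmain.2.differentiableAt.differentiableWithinAt

/-- The closed strip `0 ≤ Im z ≤ π`. -/
def closedStrip : Set ℂ := Complex.im ⁻¹' Set.Icc 0 Real.pi

/-- The open strip `0 < Im z < π`. -/
def openStrip : Set ℂ := Complex.im ⁻¹' Set.Ioo 0 Real.pi

theorem isOpen_openStrip : IsOpen openStrip := isOpen_Ioo.preimage Complex.continuous_im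

theorem openStrip_subset_closedStrip : openStrip ⊆ closedStrip :=
  Set.preimage_mono Set.Ioo_subset_Icc_self

theorem closure_openStrip : closure openStrip = closedStrip := by
  rw [openStrip, Complex.closure_preimage_im, closure_Ioo Real.pi_pos.ne, closedStrip]

theorem ofReal_mem_closedStrip (t : ℝ) : (t : ℂ) ∈ closedStrip := by
  simp [closedStrip, Real.pi_pos.le]

theorem add_pi_mem_closedStrip (t : ℝ) : (t + Real.pi * Complex.I : ℂ) ∈ closedStrip := by
  simp [closedStrip, Real.pi_pos.le]

/-- Phragmén–Lindelöf on the strip for functions of Gaussian growth. -/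
theorem norm_le_of_strip {f : ℂ → ℂ} {A C : ℝ} (hc : ContinuousOn f closedStrip)
    (hd : DifferentiableOn ℂ f openStrip)
    (hA : ∀ z ∈ closedStrip, ‖f z‖ ≤ A * Real.exp (A * z.re ^ 2))
    (h0 : ∀ t : ℝ, ‖f t‖ ≤ C) (h1 : ∀ t : ℝ, ‖f (t + Real.pi * Complex.I)‖ ≤ C)
    {z : ℂ} (hz : z ∈ closedStrip) : ‖f z‖ ≤ C := by
  have hA0 : 0 ≤ A := by
    have h := (norm_nonneg _).trans (hA _ (ofReal_mem_closedStrip 0))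
    simpa using h
  refine PhragmenLindelof.horizontal_strip (a := 0) (b := Real.pi)
    ⟨hd, by rw [← openStrip, closure_openStrip]; exact hc⟩ ?_ ?_ ?_ hz.1 hz.2
  -- A strip of width π admits growth exp(B exp(c|Re z|)) for any c < 1. Here c = 1/2 and x² ≤ 8
  -- exp(|x|/2), so Gaussian growth is far below the threshold.
  · refine ⟨1 / 2, by rw [sub_zero, div_self Real.pi_pos.ne']; norm_num, 8 * A, ?_⟩
    refine Asymptotics.IsBigO.of_bound A ?_
    refine eventually_inf_principal.2 (Eventually.of_forall fun w hw => ?_)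
    refine (hA w (openStrip_subset_closedStrip hw)).trans ?_
    rw [Real.norm_eq_abs, abs_of_pos (Real.exp_pos _)]
    refine mul_le_mul_of_nonneg_left (Real.exp_le_exp.2 ?_) hA0
    have h := Real.quadratic_le_exp_of_nonneg (x := 1 / 2 * |w.re|) (by positivity)
    have h2 : w.re ^ 2 ≤ 8 * Real.exp (1 / 2 * |w.re|) := by
      rw [← sq_abs]
      nlinarith [abs_nonneg w.re]
    nlinarith
  · intro w hw
    rw [show w = (w.re : ℂ) from Complex.ext rfl (by simpa using hw)]
    exact h0 _
  · intro w hw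
    rw [show w = (w.re + Real.pi * Complex.I : ℂ) from Complex.ext (by simp) (by simpa using hw)]
    exact h1 _

/-- `g` and `h` are the boundary values on `ℝ` and on `ℝ + iπ` of a continuous function on the closed
strip which is holomorphic in the interior and of Gaussian growth. -/
def StripPair (g h : ℝ → ℂ) : Prop :=
  ∃ G : ℂ → ℂ, ContinuousOn G closedStrip ∧ DifferentiableOn ℂ G openStrip ∧
    (∃ A : ℝ, ∀ z ∈ closedStrip, ‖G z‖ ≤ A * Real.exp (A * z.re ^ 2)) ∧
    (∀ t : ℝ, G t = g t) ∧ ∀ t : ℝ, G (t + Real.pi * Complex.I) = h t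

theorem norm_exp_neg_mul_sq (B : ℝ) (z : ℂ) :
    ‖Complex.exp (-B * z ^ 2)‖ = Real.exp (-B * z.re ^ 2 + B * z.im ^ 2) := by
  rw [Complex.norm_exp]
  congr 1
  simp [pow_two]
  ring

/-- Locally uniform convergence becomes uniformly Cauchy on the whole line once weighted: on [-T, T]
by compactness, and outside because the weight exceeds the common growth by a factor exp(-t²). -/
theorem tendstoUniformly_gaussian_weight {g : ℝ → ℂ} {gn : ℕ → ℝ → ℂ} {A : ℝ} (hA : 0 ≤ A)
    (hb : ∀ n t, ‖gn n t‖ ≤ A * Real.exp (A * t ^ 2)) (hg : TendstoLocallyUniformly gn g atTop)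
    {ε : ℝ} (hε : 0 < ε) :
    ∃ N, ∀ m ≥ N, ∀ n ≥ N, ∀ t : ℝ,
      ‖gn m t - gn n t‖ * Real.exp (-(A + 1) * t ^ 2) ≤ ε := by
  obtain ⟨T, hT0, hT⟩ : ∃ T : ℝ, 0 < T ∧ 2 * A * Real.exp (-T ^ 2) ≤ ε := by
    have h : Tendsto (fun T : ℝ => 2 * A * Real.exp (-T ^ 2)) atTop (𝓝 (2 * A * 0)) :=
      (Real.tendsto_exp_neg_atTop_nhds_zero.comp (tendsto_pow_atTop two_ne_zero)).const_mul _
    rw [mul_zero] at h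
    obtain ⟨T, h1, h2⟩ := ((h.eventually (ge_mem_nhds hε)).and (eventually_gt_atTop 0)).exists
    exact ⟨T, h2, h1⟩
  have hu := (tendstoLocallyUniformlyOn_iff_tendstoUniformlyOn_of_compact
    (isCompact_Icc (a := -T) (b := T))).1 hg.tendstoLocallyUniformlyOn
  have hu2 := Metric.tendstoUniformlyOn_iff.1 hu (ε / 2) (by positivity)
  obtain ⟨N, hN⟩ := eventually_atTop.1 hu2
  refine ⟨N, fun m hm n hn t => ?_⟩
  by_cases ht : t ∈ Set.Icc (-T) T
  · have h1 := hN m hm t ht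
    have h2 := hN n hn t ht
    have h3 : ‖gn m t - gn n t‖ ≤ ε := by
      rw [← dist_eq_norm]
      have := dist_triangle_left (gn m t) (gn n t) (g t)
      linarith
    have h4 : Real.exp (-(A + 1) * t ^ 2) ≤ 1 := Real.exp_le_one_iff.2 (by nlinarith [sq_nonneg t])
    calc _ ≤ ε * 1 := mul_le_mul h3 h4 (Real.exp_pos _).le hε.le
      _ = ε := mul_one _
  · have hTt : T ^ 2 ≤ t ^ 2 := by
      rw [Set.mem_Icc, ← abs_le] at ht
      push Not at ht
      rw [← sq_abs t]
      exact pow_le_pow_left₀ hT0.le ht.le 2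
    have h3 : ‖gn m t - gn n t‖ ≤ 2 * A * Real.exp (A * t ^ 2) := by
      have := norm_sub_le (gn m t) (gn n t)
      have := hb m t
      have := hb n t
      linarith
    calc _ ≤ 2 * A * Real.exp (A * t ^ 2) * Real.exp (-(A + 1) * t ^ 2) :=
          mul_le_mul_of_nonneg_right h3 (Real.exp_pos _).le
      _ = 2 * A * Real.exp (-t ^ 2) := by
          rw [mul_assoc, ← Real.exp_add]; ring_nf
      _ ≤ 2 * A * Real.exp (-T ^ 2) := by gcongr
      _ ≤ ε := hT

/-- Pairs of boundary values are stable under locally uniform limits with a uniform Gaussian bound. -/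
theorem StripPair.of_tendsto {g h : ℝ → ℂ} {gn hn : ℕ → ℝ → ℂ} {A : ℝ}
    (hp : ∀ n, StripPair (gn n) (hn n))
    (hgb : ∀ n t, ‖gn n t‖ ≤ A * Real.exp (A * t ^ 2))
    (hhb : ∀ n t, ‖hn n t‖ ≤ A * Real.exp (A * t ^ 2))
    (hg : TendstoLocallyUniformly gn g atTop) (hh : TendstoLocallyUniformly hn h atTop) :
    StripPair g h := by
  have hA : 0 ≤ A := by simpa using (norm_nonneg _).trans (hgb 0 0)
  set B := A + 1 with hB
  choose G hGc hGd hGA hG0 hG1 using hp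
  choose a ha using hGA
  have ha0 : ∀ n, 0 ≤ a n := fun n => by
    have h := (norm_nonneg _).trans (ha n _ (ofReal_mem_closedStrip 0))
    simpa using h
  -- On the strip Im z is bounded, so |w| decays like exp(-B x²). It beats the uniform growth of the
  -- boundary values, and it has no zeros, so it can be divided out at the end.
  set w : ℂ → ℂ := fun z => Complex.exp (-B * z ^ 2) with hw
  have hwd : Differentiable ℂ w := by fun_prop
  have hw0 : ∀ z, w z ≠ 0 := fun z => Complex.exp_ne_zero _
  have hwle : ∀ z ∈ closedStrip, ‖w z‖ ≤ Real.exp (B * Real.pi ^ 2) * Real.exp (-B * z.re ^ 2) := by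
    intro z hz
    rw [hw, norm_exp_neg_mul_sq, ← Real.exp_add, Real.exp_le_exp]
    have h1 : z.im ^ 2 ≤ Real.pi ^ 2 := pow_le_pow_left₀ hz.1 hz.2 2
    nlinarith
  set K := Real.exp (B * Real.pi ^ 2) with hK
  have hK0 : 0 < K := Real.exp_pos _
  have hK1 : 1 ≤ K := Real.one_le_exp (by positivity)
  set H : ℕ → ℂ → ℂ := fun n z => G n z * w z with hH
  have hHc : ∀ n, ContinuousOn (H n) closedStrip := fun n => (hGc n).mul hwd.continuous.continuousOn
  have hHd : ∀ n, DifferentiableOn ℂ (H n) openStrip := fun n => (hGd n).mul hwd.differentiableOn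
  have hHA : ∀ n, ∀ z ∈ closedStrip, ‖H n z‖ ≤ a n * K * Real.exp (a n * z.re ^ 2) := by
    intro n z hz
    rw [hH, norm_mul]
    have h1 := ha n z hz
    have h2 := hwle z hz
    have h3 : Real.exp (-B * z.re ^ 2) ≤ 1 := Real.exp_le_one_iff.2 (by nlinarith [sq_nonneg z.re])
    calc _ ≤ (a n * Real.exp (a n * z.re ^ 2)) * (K * 1) := by
          refine mul_le_mul h1 (h2.trans (by gcongr)) (norm_nonneg _) ?_
          have := ha0 n; positivity
      _ = _ := by ring
  -- The growth constants a n inside the strip are not uniform in n. Phragmén–Lindelöf needs them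
  -- only qualitatively: the resulting bound depends on the boundary values alone.
  have hbd : ∀ (f : ℂ → ℂ) (a' C : ℝ), ContinuousOn f closedStrip → DifferentiableOn ℂ f openStrip →
      0 ≤ a' → (∀ z ∈ closedStrip, ‖f z‖ ≤ a' * K * Real.exp (a' * z.re ^ 2)) →
      (∀ t : ℝ, ‖f t‖ ≤ C) → (∀ t : ℝ, ‖f (t + Real.pi * Complex.I)‖ ≤ C) →
      ∀ z ∈ closedStrip, ‖f z‖ ≤ C := by
    intro f a' C hfc hfd ha' hfA h0 h1 z hz
    refine norm_le_of_strip (A := a' * K) hfc hfd (fun z hz => (hfA z hz).trans ?_) h0 h1 hz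
    gcongr
    nlinarith
  have hw0' : ∀ t : ℝ, ‖w t‖ ≤ K * Real.exp (-B * t ^ 2) := fun t => by
    simpa using hwle t (ofReal_mem_closedStrip t)
  have hw1' : ∀ t : ℝ, ‖w (t + Real.pi * Complex.I)‖ ≤ K * Real.exp (-B * t ^ 2) := fun t => by
    simpa using hwle _ (add_pi_mem_closedStrip t)
  -- Smallness of H m - H n on both boundary lines passes to the whole strip.
  have hcau : UniformCauchySeqOn H atTop closedStrip := by
    rw [Metric.uniformCauchySeqOn_iff]
    intro ε hε
    obtain ⟨N0, hN0⟩ := tendstoUniformly_gaussian_weight hA hgb hg (ε := ε / (2 * K)) (by positivity)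
    obtain ⟨N1, hN1⟩ := tendstoUniformly_gaussian_weight hA hhb hh (ε := ε / (2 * K)) (by positivity)
    refine ⟨max N0 N1, fun m hm n hn' z hz => ?_⟩
    rw [dist_eq_norm]
    refine (hbd (fun z => H m z - H n z) (a m + a n) (ε / 2) ((hHc m).sub (hHc n))
      ((hHd m).sub (hHd n)) (add_nonneg (ha0 m) (ha0 n)) ?_ ?_ ?_ z hz).trans_lt (by linarith)
    · intro z hz
      have hm0 := ha0 m
      have hn0 := ha0 n
      refine (norm_sub_le _ _).trans ((add_le_add (hHA m z hz) (hHA n z hz)).trans ?_)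
      have e1 : Real.exp (a m * z.re ^ 2) ≤ Real.exp ((a m + a n) * z.re ^ 2) :=
        Real.exp_le_exp.2 (by nlinarith [sq_nonneg z.re])
      have e2 : Real.exp (a n * z.re ^ 2) ≤ Real.exp ((a m + a n) * z.re ^ 2) :=
        Real.exp_le_exp.2 (by nlinarith [sq_nonneg z.re])
      rw [add_mul, add_mul]
      gcongr
    · intro t
      have h1 := hN0 m (le_of_max_le_left hm) n (le_of_max_le_left hn') t
      calc ‖H m t - H n t‖ = ‖gn m t - gn n t‖ * ‖w t‖ := by
            rw [hH]; simp only [hG0]; rw [← sub_mul, norm_mul]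
        _ ≤ ‖gn m t - gn n t‖ * (K * Real.exp (-B * t ^ 2)) := by gcongr; exact hw0' t
        _ = K * (‖gn m t - gn n t‖ * Real.exp (-(A + 1) * t ^ 2)) := by rw [hB]; ring
        _ ≤ K * (ε / (2 * K)) := by gcongr
        _ = ε / 2 := by field_simp
    · intro t
      have h1 := hN1 m (le_of_max_le_right hm) n (le_of_max_le_right hn') t
      calc ‖H m (t + Real.pi * Complex.I) - H n (t + Real.pi * Complex.I)‖
          = ‖hn m t - hn n t‖ * ‖w (t + Real.pi * Complex.I)‖ := by
            rw [hH]; simp only [hG1]; rw [← sub_mul, norm_mul]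
        _ ≤ ‖hn m t - hn n t‖ * (K * Real.exp (-B * t ^ 2)) := by gcongr; exact hw1' t
        _ = K * (‖hn m t - hn n t‖ * Real.exp (-(A + 1) * t ^ 2)) := by rw [hB]; ring
        _ ≤ K * (ε / (2 * K)) := by gcongr
        _ = ε / 2 := by field_simp
  have hpt : ∀ z ∈ closedStrip, ∃ l, Tendsto (fun n => H n z) atTop (𝓝 l) := fun z hz =>
    cauchySeq_tendsto_of_complete (hcau.cauchySeq hz)
  choose! L hL using hpt
  have hunif : TendstoUniformlyOn H L atTop closedStrip := hcau.tendstoUniformlyOn_of_tendsto hL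
  have hLc : ContinuousOn L closedStrip := hunif.continuousOn (Frequently.of_forall hHc)
  have hLd : DifferentiableOn ℂ L openStrip :=
    (hunif.mono openStrip_subset_closedStrip).tendstoLocallyUniformlyOn.differentiableOn
      (Eventually.of_forall hHd) isOpen_openStrip
  have hbound : ∀ n, ∀ z ∈ closedStrip, ‖H n z‖ ≤ K * A := by
    intro n
    refine hbd _ _ _ (hHc n) (hHd n) (ha0 n) (hHA n) (fun t => ?_) fun t => ?_
    · rw [hH]
      simp only [hG0, norm_mul]
      calc _ ≤ (A * Real.exp (A * t ^ 2)) * (K * Real.exp (-B * t ^ 2)) :=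
            mul_le_mul (hgb n t) (hw0' t) (norm_nonneg _) (by positivity)
        _ = K * A * (Real.exp (A * t ^ 2) * Real.exp (-B * t ^ 2)) := by ring
        _ ≤ K * A * 1 := by
            rw [← Real.exp_add]
            gcongr
            exact Real.exp_le_one_iff.2 (by rw [hB]; nlinarith [sq_nonneg t])
        _ = K * A := mul_one _
    · rw [hH]
      simp only [hG1, norm_mul]
      calc _ ≤ (A * Real.exp (A * t ^ 2)) * (K * Real.exp (-B * t ^ 2)) :=
            mul_le_mul (hhb n t) (hw1' t) (norm_nonneg _) (by positivity)
        _ = K * A * (Real.exp (A * t ^ 2) * Real.exp (-B * t ^ 2)) := by ring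
        _ ≤ K * A * 1 := by
            rw [← Real.exp_add]
            gcongr
            exact Real.exp_le_one_iff.2 (by rw [hB]; nlinarith [sq_nonneg t])
        _ = K * A := mul_one _
  refine ⟨fun z => L z * (w z)⁻¹, hLc.mul (hwd.continuous.inv₀ hw0).continuousOn,
    hLd.mul (hwd.inv hw0).differentiableOn, ⟨K * A + B, fun z hz => ?_⟩, fun t => ?_, fun t => ?_⟩
  · have h1 : ‖L z‖ ≤ K * A := le_of_tendsto (hL z hz).norm (Eventually.of_forall fun n => hbound n z hz)
    have h2 : ‖(w z)⁻¹‖ ≤ Real.exp (B * z.re ^ 2) := by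
      rw [hw, ← Complex.exp_neg, neg_mul, neg_neg, Complex.norm_exp, Real.exp_le_exp]
      simp [pow_two]
      nlinarith [mul_self_nonneg z.im]
    rw [norm_mul]
    refine mul_le_mul (h1.trans (by linarith)) (h2.trans (Real.exp_le_exp.2 ?_)) (norm_nonneg _)
      (by positivity)
    nlinarith [sq_nonneg z.re, mul_nonneg hK0.le hA]
  · have h1 := hL t (ofReal_mem_closedStrip t)
    have h2 : Tendsto (fun n => H n t) atTop (𝓝 (g t * w t)) := by
      rw [hH]; simp only [hG0]
      exact (hg.tendstoLocallyUniformlyOn.tendsto_at (Set.mem_univ t)).mul_const _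
    have h3 := tendsto_nhds_unique h1 h2
    simp only [h3, mul_inv_cancel_right₀ (hw0 _)]
  · have h1 := hL _ (add_pi_mem_closedStrip t)
    have h2 : Tendsto (fun n => H n (t + Real.pi * Complex.I)) atTop
        (𝓝 (h t * w (t + Real.pi * Complex.I))) := by
      rw [hH]; simp only [hG1]
      exact (hh.tendstoLocallyUniformlyOn.tendsto_at (Set.mem_univ t)).mul_const _
    have h3 := tendsto_nhds_unique h1 h2
    simp only [h3, mul_inv_cancel_right₀ (hw0 _)]

end MobiusCFT
end

/-! ### Contour shifts against Gaussian kernels. -/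

noncomputable section
namespace MobiusCFT
open MeasureTheory Filter Topology

theorem integrable_exp_neg_sq : Integrable fun x : ℝ => Real.exp (-x ^ 2) := by
  simpa using integrable_exp_neg_mul_sq one_pos

/-- Shift of the contour of integration from `ℝ` to `ℝ + iπ`. -/
theorem integral_eq_integral_add_pi {f : ℂ → ℂ} {C : ℝ} (hc : ContinuousOn f closedStrip)
    (hd : DifferentiableOn ℂ f openStrip)
    (hb : ∀ z ∈ closedStrip, ‖f z‖ ≤ C * Real.exp (-z.re ^ 2)) :
    ∫ x : ℝ, f x = ∫ x : ℝ, f (x + Real.pi * Complex.I) := by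
  have hint : ∀ y ∈ Set.Icc 0 Real.pi, Integrable fun x : ℝ => f (x + y * Complex.I) := by
    intro y hy
    refine (integrable_exp_neg_sq.const_mul C).mono' ?_ (Eventually.of_forall fun x => ?_)
    · refine (hc.comp_continuous (by fun_prop) fun x => ?_).aestronglyMeasurable
      simpa [closedStrip] using hy
    · simpa using hb (x + y * Complex.I) (by simpa [closedStrip] using hy)
  have h0 := hint 0 ⟨le_rfl, Real.pi_pos.le⟩
  have h1 := hint Real.pi ⟨Real.pi_pos.le, le_rfl⟩
  simp only [Complex.ofReal_zero, zero_mul, add_zero] at h0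
  have t0 := intervalIntegral_tendsto_integral h0 tendsto_neg_atTop_atBot tendsto_id
  have t1 := intervalIntegral_tendsto_integral h1 tendsto_neg_atTop_atBot tendsto_id
  -- The signs s = 1 and s = -1 are the two vertical sides of the rectangle, whose contributions
  -- vanish as R → ∞.
  have hside : ∀ s : ℝ, s ^ 2 = 1 → Tendsto (fun R : ℝ =>
      ∫ y in (0 : ℝ)..Real.pi, f ((s * R : ℝ) + y * Complex.I)) atTop (𝓝 0) := by
    intro s hs
    have hz : Tendsto (fun R : ℝ => C * Real.exp (-R ^ 2) * Real.pi) atTop (𝓝 (C * 0 * Real.pi)) :=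
      ((Real.tendsto_exp_neg_atTop_nhds_zero.comp
        (tendsto_pow_atTop two_ne_zero)).const_mul C).mul_const _
    rw [mul_zero, zero_mul] at hz
    refine squeeze_zero_norm (fun R => ?_) hz
    have h := intervalIntegral.norm_integral_le_of_norm_le_const (a := 0) (b := Real.pi)
      (f := fun y : ℝ => f ((s * R : ℝ) + y * Complex.I)) (C := C * Real.exp (-R ^ 2)) ?_
    · simpa [abs_of_pos Real.pi_pos] using h
    · intro y hy
      rw [Set.uIoc_of_le Real.pi_pos.le] at hy
      have h2 := hb ((s * R : ℝ) + y * Complex.I) (by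
        simpa [closedStrip] using ⟨hy.1.le, hy.2⟩)
      simpa [mul_pow, hs] using h2
  have hrect : ∀ R : ℝ, (∫ x in (-R)..R, f x) - (∫ x in (-R)..R, f (x + Real.pi * Complex.I)) =
      -(Complex.I • ∫ y in (0 : ℝ)..Real.pi, f ((1 * R : ℝ) + y * Complex.I)) +
        Complex.I • ∫ y in (0 : ℝ)..Real.pi, f ((-1 * R : ℝ) + y * Complex.I) := by
    intro R
    have h := Complex.integral_boundary_rect_eq_zero_of_continuousOn_of_differentiableOn f
      (-R : ℝ) (R + Real.pi * Complex.I)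
      (hc.mono fun z hz => by
        have := (Complex.mem_reProdIm.1 hz).2
        simpa [closedStrip, Set.uIcc_of_le Real.pi_pos.le] using this)
      (hd.mono fun z hz => by
        have := (Complex.mem_reProdIm.1 hz).2
        simpa [openStrip, Real.pi_pos.le] using this)
    simp only [Complex.ofReal_re, Complex.add_re, Complex.mul_re, Complex.I_re, mul_zero,
      Complex.ofReal_im, Complex.I_im, mul_one, sub_self, add_zero, Complex.add_im, Complex.mul_im,
      zero_add, Complex.ofReal_zero, zero_mul] at h
    simp only [one_mul, neg_one_mul]
    linear_combination h
  have hlim := (t0.sub t1).congr hrect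
  have hlim2 := ((hside 1 (by norm_num)).const_smul Complex.I).neg.add
    ((hside (-1) (by norm_num)).const_smul Complex.I)
  have h := tendsto_nhds_unique hlim hlim2
  simp only [smul_zero, neg_zero, add_zero] at h
  exact sub_eq_zero.1 h

/-- The Gaussian kernel `exp (-c (s - τ)²)`. -/
def gaussKernel (c s : ℝ) (τ : ℂ) : ℂ := Complex.exp (-c * (s - τ) ^ 2)

theorem norm_gaussKernel (c s : ℝ) (τ : ℂ) :
    ‖gaussKernel c s τ‖ = Real.exp (-c * (s - τ.re) ^ 2 + c * τ.im ^ 2) := by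
  rw [gaussKernel, norm_exp_neg_mul_sq]
  simp

/-- Since (A+1)s² ≤ 2(A+1)((s-x)² + x²), a kernel with c ≥ 2(A+1) absorbs the growth exp(A s²) and
still leaves exp(-s²). This is the origin of the threshold on c below. -/
theorem exp_mul_norm_gaussKernel_le {A c : ℝ} (hA : 0 ≤ A) (hc : 2 * (A + 1) ≤ c) (s : ℝ) (τ : ℂ) :
    Real.exp (A * s ^ 2) * ‖gaussKernel c s τ‖ ≤
      Real.exp (c * τ.im ^ 2 + 2 * (A + 1) * τ.re ^ 2) * Real.exp (-s ^ 2) := by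
  rw [norm_gaussKernel, ← Real.exp_add, ← Real.exp_add, Real.exp_le_exp]
  nlinarith [mul_le_mul_of_nonneg_right hc (sq_nonneg (s - τ.re)),
    mul_nonneg (by linarith : 0 ≤ A + 1) (sq_nonneg (s - 2 * τ.re))]

theorem continuous_gaussKernel {c : ℝ} :
    Continuous fun p : ℝ × ℂ => gaussKernel c p.1 p.2 := by
  unfold gaussKernel; fun_prop

/-- Shifting the contour to ℝ + iπ turns the kernel centred at t + iπ into the one centred at t, so
continuation becomes an identity between Gaussian averages of the two boundary values. C is kept
apart from A because it will carry the growth in the other variable. -/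
theorem StripPair.integral_gaussKernel {g h : ℝ → ℂ} {A C c : ℝ} (hp : StripPair g h)
    (hA : 0 ≤ A) (hc : 2 * (A + 1) ≤ c)
    (hg : ∀ t, ‖g t‖ ≤ C * Real.exp (A * t ^ 2)) (hh : ∀ t, ‖h t‖ ≤ C * Real.exp (A * t ^ 2))
    (t : ℝ) :
    ∫ s : ℝ, g s * gaussKernel c s (t + Real.pi * Complex.I) = ∫ s : ℝ, h s * gaussKernel c s t := by
  obtain ⟨G, hGc, hGd, ⟨B, hB⟩, hG0, hG1⟩ := hp
  have hC : 0 ≤ C := by simpa using (norm_nonneg _).trans (hg 0)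
  have hB0 : 0 ≤ B := by
    have h := (norm_nonneg _).trans (hB _ (ofReal_mem_closedStrip 0))
    simpa using h
  -- The given constant B of G may be too large for the kernel. Phragmén–Lindelöf, applied to G
  -- times exp(-A z²), replaces it by the constant A of the boundary values.
  have hGb : ∀ z ∈ closedStrip, ‖G z‖ ≤
      C * Real.exp (A * Real.pi ^ 2) * Real.exp (A * z.re ^ 2) := by
    intro z hz
    have hw : ∀ z ∈ closedStrip, ‖Complex.exp (-A * z ^ 2)‖ ≤
        Real.exp (A * Real.pi ^ 2) * Real.exp (-A * z.re ^ 2) := by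
      intro z hz
      rw [norm_exp_neg_mul_sq, ← Real.exp_add, Real.exp_le_exp]
      have h1 : z.im ^ 2 ≤ Real.pi ^ 2 := pow_le_pow_left₀ hz.1 hz.2 2
      nlinarith
    have key : ‖G z * Complex.exp (-A * z ^ 2)‖ ≤ C * Real.exp (A * Real.pi ^ 2) := by
      refine norm_le_of_strip (A := B * Real.exp (A * Real.pi ^ 2))
        (f := fun z => G z * Complex.exp (-A * z ^ 2)) (hGc.mul (by fun_prop))
        (hGd.mul (by fun_prop)) ?_ ?_ ?_ hz
      · intro z hz
        rw [norm_mul]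
        have h3 : Real.exp (-A * z.re ^ 2) ≤ 1 :=
          Real.exp_le_one_iff.2 (by nlinarith [sq_nonneg z.re])
        have h4 : B * 1 ≤ B * Real.exp (A * Real.pi ^ 2) :=
          mul_le_mul_of_nonneg_left (Real.one_le_exp (by positivity)) hB0
        calc _ ≤ (B * Real.exp (B * z.re ^ 2)) * (Real.exp (A * Real.pi ^ 2) * 1) :=
              mul_le_mul (hB z hz) ((hw z hz).trans (by gcongr)) (norm_nonneg _) (by positivity)
          _ = B * Real.exp (A * Real.pi ^ 2) * Real.exp (B * z.re ^ 2) := by ring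
          _ ≤ _ := by
            gcongr
            linarith
      · intro t
        rw [norm_mul, hG0]
        have h2 := hw _ (ofReal_mem_closedStrip t)
        rw [Complex.ofReal_re] at h2
        calc _ ≤ (C * Real.exp (A * t ^ 2)) * (Real.exp (A * Real.pi ^ 2) * Real.exp (-A * t ^ 2)) :=
              mul_le_mul (hg t) h2 (norm_nonneg _) (by positivity)
          _ = C * Real.exp (A * Real.pi ^ 2) * (Real.exp (A * t ^ 2) * Real.exp (-A * t ^ 2)) := by ring
          _ = _ := by rw [← Real.exp_add]; simp
      · intro t
        rw [norm_mul, hG1]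
        have h2 := hw _ (add_pi_mem_closedStrip t)
        have h3 : (t + Real.pi * Complex.I : ℂ).re = t := by simp
        rw [h3] at h2
        calc _ ≤ (C * Real.exp (A * t ^ 2)) * (Real.exp (A * Real.pi ^ 2) * Real.exp (-A * t ^ 2)) :=
              mul_le_mul (hh t) h2 (norm_nonneg _) (by positivity)
          _ = C * Real.exp (A * Real.pi ^ 2) * (Real.exp (A * t ^ 2) * Real.exp (-A * t ^ 2)) := by ring
          _ = _ := by rw [← Real.exp_add]; simp
    have h5 : G z = G z * Complex.exp (-A * z ^ 2) * Complex.exp (A * z ^ 2) := by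
      rw [mul_assoc, ← Complex.exp_add]; simp
    rw [h5, norm_mul]
    refine mul_le_mul key ?_ (norm_nonneg _) (by positivity)
    rw [Complex.norm_exp, Real.exp_le_exp]
    simp [pow_two]
    nlinarith [mul_self_nonneg z.im]
  set σ : ℂ := t + Real.pi * Complex.I with hσ
  have hσre : σ.re = t := by simp [hσ]
  have hσim : σ.im = Real.pi := by simp [hσ]
  have hmain := integral_eq_integral_add_pi
    (f := fun z => G z * Complex.exp (-c * (z - σ) ^ 2))
    (C := C * Real.exp (A * Real.pi ^ 2) * Real.exp (c * Real.pi ^ 2 + 2 * (A + 1) * t ^ 2))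
    (hGc.mul (by fun_prop)) (hGd.mul (by fun_prop)) (fun z hz => by
      have h1 : ‖Complex.exp (-c * (z - σ) ^ 2)‖ ≤
          Real.exp (-c * (z.re - t) ^ 2 + c * Real.pi ^ 2) := by
        rw [norm_exp_neg_mul_sq, Real.exp_le_exp, Complex.sub_re, Complex.sub_im, hσre, hσim]
        have h2 : (z.im - Real.pi) ^ 2 ≤ Real.pi ^ 2 := by
          have := hz.1; have := hz.2
          nlinarith
        nlinarith
      rw [norm_mul]
      have h3 := exp_mul_norm_gaussKernel_le hA hc z.re (t + Real.pi * Complex.I)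
      rw [norm_gaussKernel, ← hσ, hσre, hσim] at h3
      calc _ ≤ C * Real.exp (A * Real.pi ^ 2) * Real.exp (A * z.re ^ 2) *
            Real.exp (-c * (z.re - t) ^ 2 + c * Real.pi ^ 2) :=
            mul_le_mul (hGb z hz) h1 (norm_nonneg _) (by positivity)
        _ = C * Real.exp (A * Real.pi ^ 2) * (Real.exp (A * z.re ^ 2) *
            Real.exp (-c * (z.re - t) ^ 2 + c * Real.pi ^ 2)) := by ring
        _ ≤ C * Real.exp (A * Real.pi ^ 2) * (Real.exp (c * Real.pi ^ 2 + 2 * (A + 1) * t ^ 2) *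
            Real.exp (-z.re ^ 2)) := by gcongr
        _ = _ := by ring)
  simp only [hG0, hG1] at hmain
  simp only [gaussKernel]
  rw [hmain]
  refine integral_congr_ae (Eventually.of_forall fun s => ?_)
  simp only [hσ]
  congr 3
  ring

/-! ## Continuation along a broken line in two variables -/

/-- Continuous functions of Gaussian growth on the plane. -/
structure GaussGrowth (M : ℝ × ℝ → ℂ) (A : ℝ) : Prop where
  cont : Continuous M
  bound : ∀ p, ‖M p‖ ≤ A * Real.exp (A * (p.1 ^ 2 + p.2 ^ 2))

theorem GaussGrowth.nonneg {M : ℝ × ℝ → ℂ} {A : ℝ} (hM : GaussGrowth M A) : 0 ≤ A := by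
  simpa using (norm_nonneg _).trans (hM.bound (0, 0))

theorem GaussGrowth.mono {M : ℝ × ℝ → ℂ} {A B : ℝ} (hM : GaussGrowth M A) (hAB : A ≤ B) :
    GaussGrowth M B := by
  refine ⟨hM.cont, fun p => (hM.bound p).trans ?_⟩
  have h0 := hM.nonneg
  have h1 := h0.trans hAB
  gcongr

theorem GaussGrowth.norm_mul_gaussKernel_le {M : ℝ × ℝ → ℂ} {A c : ℝ} (hM : GaussGrowth M A)
    (hc : 2 * (A + 1) ≤ c) (σ τ : ℂ) (p : ℝ × ℝ) :
    ‖M p * (gaussKernel c p.1 σ * gaussKernel c p.2 τ)‖ ≤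
      A * Real.exp (c * (σ.im ^ 2 + τ.im ^ 2) + 2 * (A + 1) * (σ.re ^ 2 + τ.re ^ 2)) *
        (Real.exp (-p.1 ^ 2) * Real.exp (-p.2 ^ 2)) := by
  have hA := hM.nonneg
  have h1 := exp_mul_norm_gaussKernel_le hA hc p.1 σ
  have h2 := exp_mul_norm_gaussKernel_le hA hc p.2 τ
  rw [norm_mul, norm_mul]
  calc _ ≤ A * Real.exp (A * (p.1 ^ 2 + p.2 ^ 2)) *
        (‖gaussKernel c p.1 σ‖ * ‖gaussKernel c p.2 τ‖) := by
        gcongr; exact hM.bound p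
    _ = A * ((Real.exp (A * p.1 ^ 2) * ‖gaussKernel c p.1 σ‖) *
        (Real.exp (A * p.2 ^ 2) * ‖gaussKernel c p.2 τ‖)) := by
        rw [mul_add, Real.exp_add]; ring
    _ ≤ A * ((Real.exp (c * σ.im ^ 2 + 2 * (A + 1) * σ.re ^ 2) * Real.exp (-p.1 ^ 2)) *
        (Real.exp (c * τ.im ^ 2 + 2 * (A + 1) * τ.re ^ 2) * Real.exp (-p.2 ^ 2))) := by gcongr
    _ = A * (Real.exp (c * σ.im ^ 2 + 2 * (A + 1) * σ.re ^ 2) *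
        Real.exp (c * τ.im ^ 2 + 2 * (A + 1) * τ.re ^ 2)) *
        (Real.exp (-p.1 ^ 2) * Real.exp (-p.2 ^ 2)) := by ring
    _ = _ := by
        rw [← Real.exp_add]
        congr 3
        ring

theorem GaussGrowth.integrable {M : ℝ × ℝ → ℂ} {A c : ℝ} (hM : GaussGrowth M A)
    (hc : 2 * (A + 1) ≤ c) (σ τ : ℂ) :
    Integrable fun p : ℝ × ℝ => M p * (gaussKernel c p.1 σ * gaussKernel c p.2 τ) := by
  refine ((integrable_exp_neg_sq.mul_prod integrable_exp_neg_sq).const_mul _).mono' ?_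
    (Eventually.of_forall fun p => hM.norm_mul_gaussKernel_le hc σ τ p)
  refine (hM.cont.mul ((continuous_gaussKernel.comp (f := fun p : ℝ × ℝ => (p.1, σ)) (by fun_prop)).mul
    (continuous_gaussKernel.comp (f := fun p : ℝ × ℝ => (p.2, τ)) (by fun_prop)))).aestronglyMeasurable

/-- The Gaussian regularization of the diagonal of `M`, at a complex point. -/
def diagSmooth (M : ℝ × ℝ → ℂ) (c : ℝ) (τ : ℂ) : ℂ :=
  ∫ p : ℝ × ℝ, M p * (gaussKernel c p.1 τ * gaussKernel c p.2 τ)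

theorem GaussGrowth.norm_diagSmooth_le {M : ℝ × ℝ → ℂ} {A c : ℝ} (hM : GaussGrowth M A)
    (hc : 2 * (A + 1) ≤ c) (τ : ℂ) :
    ‖diagSmooth M c τ‖ ≤ A * Real.exp (2 * c * τ.im ^ 2 + 4 * (A + 1) * τ.re ^ 2) *
      ∫ p : ℝ × ℝ, Real.exp (-p.1 ^ 2) * Real.exp (-p.2 ^ 2) := by
  rw [← integral_const_mul]
  refine norm_integral_le_of_norm_le
    ((integrable_exp_neg_sq.mul_prod integrable_exp_neg_sq).const_mul _)
    (Eventually.of_forall fun p => (hM.norm_mul_gaussKernel_le hc τ τ p).trans (le_of_eq ?_))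
  congr 3
  ring

theorem GaussGrowth.differentiable_diagSmooth {M : ℝ × ℝ → ℂ} {A c : ℝ} (hM : GaussGrowth M A)
    (hc : 2 * (A + 1) ≤ c) : Differentiable ℂ (diagSmooth M c) := by
  have hA := hM.nonneg
  rw [← differentiableOn_univ]
  refine differentiableOn_integral_of_dominated isOpen_univ
    (fun z _ => (hM.integrable hc z z).aestronglyMeasurable)
    (fun p => by unfold gaussKernel; fun_prop) fun z₀ _ => ⟨1, one_pos, _,
      ((integrable_exp_neg_sq.mul_prod integrable_exp_neg_sq).const_mul
        (A * Real.exp ((2 * c + 4 * (A + 1)) * (‖z₀‖ + 1) ^ 2))), fun z hz p => ?_⟩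
  refine (hM.norm_mul_gaussKernel_le hc z z p).trans ?_
  have hz1 : ‖z‖ ≤ ‖z₀‖ + 1 := by
    have h1 := norm_sub_norm_le z z₀
    rw [Metric.mem_ball, dist_eq_norm] at hz
    linarith
  have h2 : z.re ^ 2 ≤ (‖z₀‖ + 1) ^ 2 := by
    rw [← sq_abs]
    exact pow_le_pow_left₀ (abs_nonneg _) ((Complex.abs_re_le_norm z).trans hz1) 2
  have h3 : z.im ^ 2 ≤ (‖z₀‖ + 1) ^ 2 := by
    rw [← sq_abs]
    exact pow_le_pow_left₀ (abs_nonneg _) ((Complex.abs_im_le_norm z).trans hz1) 2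
  gcongr
  nlinarith [mul_le_mul_of_nonneg_left h3 (by linarith : 0 ≤ c),
    mul_le_mul_of_nonneg_left h2 (by linarith : 0 ≤ A + 1)]

/-- The substitution p = (t,t) + q/N makes the Gaussian fixed. The factor N²/π normalizes it to
total mass one, which exhibits an approximate identity at the diagonal point. -/
theorem diagSmooth_eq {M : ℝ × ℝ → ℂ} {N : ℝ} (hN : 0 < N) (t : ℝ) :
    ((N ^ 2 / Real.pi : ℝ) : ℂ) * diagSmooth M (N ^ 2) t =
      ((1 / Real.pi : ℝ) : ℂ) * ∫ q : ℝ × ℝ, M (t + N⁻¹ * q.1, t + N⁻¹ * q.2) *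
        Real.exp (-(q.1 ^ 2 + q.2 ^ 2)) := by
  set f : ℝ × ℝ → ℂ := fun p => M p * (gaussKernel (N ^ 2) p.1 t * gaussKernel (N ^ 2) p.2 t)
  have h1 : ∫ q : ℝ × ℝ, f ((t, t) + N⁻¹ • q) = ((N ^ 2 : ℝ) : ℂ) * diagSmooth M (N ^ 2) t := by
    rw [Measure.integral_comp_smul (μ := volume) (f := fun q => f ((t, t) + q)),
      integral_add_left_eq_self f (t, t)]
    simp [diagSmooth, f, Module.finrank_prod, abs_of_pos hN]
  have h2 : ∀ q : ℝ × ℝ, f ((t, t) + N⁻¹ • q) =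
      M (t + N⁻¹ * q.1, t + N⁻¹ * q.2) * Real.exp (-(q.1 ^ 2 + q.2 ^ 2)) := by
    intro q
    have hNc : (N : ℂ) ≠ 0 := by exact_mod_cast hN.ne'
    simp only [f, gaussKernel, Prod.fst_add, Prod.snd_add, Prod.smul_fst, Prod.smul_snd, smul_eq_mul]
    rw [← Complex.exp_add]
    push_cast
    congr 2
    field_simp
    ring
  simp only [h2] at h1
  rw [h1]
  push_cast
  ring

theorem integrable_exp_neg_half : Integrable fun q : ℝ × ℝ =>
    Real.exp (-(1 / 2) * (q.1 ^ 2 + q.2 ^ 2)) := by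
  have h := (integrable_exp_neg_mul_sq (b := 1 / 2) (by norm_num)).mul_prod
    (integrable_exp_neg_mul_sq (b := 1 / 2) (by norm_num))
  refine h.congr (Eventually.of_forall fun q => ?_)
  simp only [← Real.exp_add]
  congr 1
  ring

theorem integral_exp_neg_sq_prod :
    ∫ q : ℝ × ℝ, (Real.exp (-(q.1 ^ 2 + q.2 ^ 2)) : ℂ) = Real.pi := by
  have h := integral_prod_mul (μ := (volume : Measure ℝ)) (ν := (volume : Measure ℝ))
    (fun x : ℝ => Real.exp (-1 * x ^ 2)) (fun x : ℝ => Real.exp (-1 * x ^ 2))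
  rw [integral_gaussian, div_one, Real.mul_self_sqrt Real.pi_pos.le] at h
  rw [← h, integral_complex_ofReal, Measure.volume_eq_prod]
  congr 1
  refine integral_congr_ae (Eventually.of_forall fun q => ?_)
  simp only [← Real.exp_add]
  congr 1
  ring

/-- For N ≥ 4A + 4 one has A(t + x/N)² ≤ 2At² + x²/2, so half of the Gaussian exponent survives as a
majorant independent of N. -/
theorem GaussGrowth.norm_scaled_le {M : ℝ × ℝ → ℂ} {A N : ℝ} (hM : GaussGrowth M A)
    (hN : 4 * A + 4 ≤ N) (t : ℝ) (q : ℝ × ℝ) :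
    ‖M (t + N⁻¹ * q.1, t + N⁻¹ * q.2) * Real.exp (-(q.1 ^ 2 + q.2 ^ 2))‖ ≤
      A * Real.exp (4 * A * t ^ 2) * Real.exp (-(1 / 2) * (q.1 ^ 2 + q.2 ^ 2)) := by
  have hA := hM.nonneg
  have hN0 : 0 < N := by linarith
  rw [norm_mul, Complex.norm_real, Real.norm_eq_abs, abs_of_pos (Real.exp_pos _)]
  refine (mul_le_mul_of_nonneg_right (hM.bound _) (Real.exp_pos _).le).trans ?_
  rw [mul_assoc, mul_assoc, ← Real.exp_add, ← Real.exp_add]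
  refine mul_le_mul_of_nonneg_left (Real.exp_le_exp.2 ?_) hA
  have hi : A * N⁻¹ ^ 2 ≤ 1 / 4 := by
    rw [inv_pow, ← div_eq_mul_inv, div_le_iff₀ (by positivity)]
    nlinarith
  have key : ∀ x : ℝ, A * (t + N⁻¹ * x) ^ 2 ≤ 2 * A * t ^ 2 + 1 / 2 * x ^ 2 := by
    intro x
    have h1 : (t + N⁻¹ * x) ^ 2 ≤ 2 * t ^ 2 + 2 * (N⁻¹ ^ 2 * x ^ 2) := by
      nlinarith [sq_nonneg (t - N⁻¹ * x)]
    nlinarith [mul_le_mul_of_nonneg_left h1 hA, mul_le_mul_of_nonneg_right hi (sq_nonneg x)]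
  have k1 := key q.1
  have k2 := key q.2
  simp only
  nlinarith

theorem GaussGrowth.norm_diagSmooth_ofReal_le {M : ℝ × ℝ → ℂ} {A N : ℝ} (hM : GaussGrowth M A)
    (hN : 4 * A + 4 ≤ N) (t : ℝ) :
    ‖((N ^ 2 / Real.pi : ℝ) : ℂ) * diagSmooth M (N ^ 2) t‖ ≤
      1 / Real.pi * (A * ∫ q : ℝ × ℝ, Real.exp (-(1 / 2) * (q.1 ^ 2 + q.2 ^ 2))) *
        Real.exp (4 * A * t ^ 2) := by
  have hA := hM.nonneg
  have hN0 : 0 < N := by linarith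
  rw [diagSmooth_eq hN0, norm_mul, Complex.norm_real, Real.norm_eq_abs,
    abs_of_pos (by positivity), mul_assoc]
  refine mul_le_mul_of_nonneg_left ?_ (by positivity)
  refine (norm_integral_le_of_norm_le (integrable_exp_neg_half.const_mul _)
    (Eventually.of_forall fun q => hM.norm_scaled_le hN t q)).trans (le_of_eq ?_)
  rw [integral_const_mul]
  ring

theorem tendstoLocallyUniformly_of_tendsto_prod {g : ℝ → ℂ} {gn : ℕ → ℝ → ℂ} (hg : Continuous g)
    (h : ∀ x, Tendsto (fun y : ℕ × ℝ => gn y.1 y.2) (atTop ×ˢ 𝓝 x) (𝓝 (g x))) :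
    TendstoLocallyUniformly gn g atTop := by
  rw [tendstoLocallyUniformly_iff_forall_tendsto]
  intro x
  exact (((hg.tendsto x).comp tendsto_snd).prodMk_nhds (h x)).mono_right (nhds_le_uniformity (g x))

/-- Dominated convergence along n → ∞ and t → x jointly. The offset B makes the width admissible
from n = 0 on. -/
theorem GaussGrowth.tendstoLocallyUniformly {M : ℝ × ℝ → ℂ} {A B : ℝ} (hM : GaussGrowth M A)
    (hB : 4 * A + 4 ≤ B) :
    TendstoLocallyUniformly (fun (n : ℕ) (t : ℝ) =>
      (((n + B : ℝ) ^ 2 / Real.pi : ℝ) : ℂ) * diagSmooth M ((n + B : ℝ) ^ 2) t)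
      (fun t => M (t, t)) atTop := by
  have hA := hM.nonneg
  have hpi : (Real.pi : ℂ) ≠ 0 := by exact_mod_cast Real.pi_pos.ne'
  refine tendstoLocallyUniformly_of_tendsto_prod (hM.cont.comp (by fun_prop)) fun x => ?_
  have hlim : M (x, x) = ((1 / Real.pi : ℝ) : ℂ) * ∫ q : ℝ × ℝ, M (x, x) *
      Real.exp (-(q.1 ^ 2 + q.2 ^ 2)) := by
    rw [integral_const_mul, integral_exp_neg_sq_prod]
    push_cast
    field_simp
  rw [hlim]
  have hpos : ∀ n : ℕ, 0 < (n + B : ℝ) := fun n => by linarith [n.cast_nonneg (α := ℝ)]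
  simp only [fun n : ℕ => diagSmooth_eq (M := M) (hpos n)]
  refine Tendsto.const_mul _ ?_
  refine tendsto_integral_filter_of_dominated_convergence
    (fun q : ℝ × ℝ => A * Real.exp (4 * A * (|x| + 1) ^ 2) *
      Real.exp (-(1 / 2) * (q.1 ^ 2 + q.2 ^ 2))) ?_ ?_ (integrable_exp_neg_half.const_mul _) ?_
  · refine Eventually.of_forall fun y => ?_
    exact ((hM.cont.comp (by fun_prop)).mul (by fun_prop)).aestronglyMeasurable
  · have hnear : ∀ᶠ t in 𝓝 x, |t| ≤ |x| + 1 := by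
      filter_upwards [Metric.ball_mem_nhds x one_pos] with t ht
      rw [Metric.mem_ball, Real.dist_eq] at ht
      have := abs_sub_abs_le_abs_sub t x
      linarith
    filter_upwards [tendsto_snd.eventually hnear] with y hy
    refine Eventually.of_forall fun q => ?_
    refine (hM.norm_scaled_le (by linarith [y.1.cast_nonneg (α := ℝ)]) y.2 q).trans ?_
    have h2 : y.2 ^ 2 ≤ (|x| + 1) ^ 2 := by
      rw [← sq_abs y.2]
      exact pow_le_pow_left₀ (abs_nonneg _) hy 2
    gcongr
  · refine Eventually.of_forall fun q => Tendsto.mul_const _ ?_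
    have hinv : Tendsto (fun y : ℕ × ℝ => (y.1 + B : ℝ)⁻¹) (atTop ×ˢ 𝓝 x) (𝓝 0) :=
      (tendsto_inv_atTop_zero.comp (tendsto_atTop_add_const_right _ _
        tendsto_natCast_atTop_atTop)).comp tendsto_fst
    have hsnd : Tendsto (fun y : ℕ × ℝ => y.2) (atTop ×ˢ 𝓝 x) (𝓝 x) := tendsto_snd
    have h1 : ∀ r : ℝ, Tendsto (fun y : ℕ × ℝ => y.2 + (y.1 + B : ℝ)⁻¹ * r) (atTop ×ˢ 𝓝 x) (𝓝 x) :=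
      fun r => by simpa using hsnd.add (hinv.mul_const r)
    exact (hM.cont.tendsto (x, x)).comp ((h1 q.1).prodMk_nhds (h1 q.2))

/-- Fubini reduces the two-variable continuation to two one-variable contour shifts: the first moves
the centre of the kernel in r and replaces M₀ by M₁, the second moves it in s and replaces M₁ by M₂.
No joint holomorphy in two variables is needed. -/
theorem diagSmooth_add_pi {M₀ M₁ M₂ : ℝ × ℝ → ℂ} {A c : ℝ} (h₀ : GaussGrowth M₀ A)
    (h₁ : GaussGrowth M₁ A) (h₂ : GaussGrowth M₂ A) (hc : 2 * (A + 1) ≤ c)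
    (h₀₁ : ∀ s, StripPair (fun t => M₀ (s, t)) fun t => M₁ (s, t))
    (h₁₂ : ∀ t, StripPair (fun s => M₁ (s, t)) fun s => M₂ (s, t)) (t : ℝ) :
    diagSmooth M₀ c (t + Real.pi * Complex.I) = diagSmooth M₂ c t := by
  have hA := h₀.nonneg
  set σ : ℂ := t + Real.pi * Complex.I with hσ
  have b1 : ∀ {M : ℝ × ℝ → ℂ}, GaussGrowth M A → ∀ s r : ℝ,
      ‖M (s, r)‖ ≤ A * Real.exp (A * s ^ 2) * Real.exp (A * r ^ 2) := fun hM s r => by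
    have h := hM.bound (s, r)
    rwa [mul_add, Real.exp_add, ← mul_assoc] at h
  have b2 : ∀ {M : ℝ × ℝ → ℂ}, GaussGrowth M A → ∀ s r : ℝ,
      ‖M (s, r)‖ ≤ A * Real.exp (A * r ^ 2) * Real.exp (A * s ^ 2) := fun hM s r => by
    rw [mul_right_comm]; exact b1 hM s r
  calc diagSmooth M₀ c σ
      = ∫ s : ℝ, ∫ r : ℝ, M₀ (s, r) * (gaussKernel c s σ * gaussKernel c r σ) :=
        integral_prod _ (h₀.integrable hc σ σ)
    _ = ∫ s : ℝ, ∫ r : ℝ, M₁ (s, r) * (gaussKernel c s σ * gaussKernel c r t) := by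
        refine integral_congr_ae (Eventually.of_forall fun s => ?_)
        have h := (h₀₁ s).integral_gaussKernel hA hc (b1 h₀ s) (b1 h₁ s) t
        rw [← hσ] at h
        calc _ = gaussKernel c s σ * ∫ r : ℝ, M₀ (s, r) * gaussKernel c r σ := by
              rw [← integral_const_mul]; exact congrArg _ (funext fun r => by ring)
          _ = _ := by
              rw [h, ← integral_const_mul]; congr 1; funext r; ring
    _ = ∫ r : ℝ, ∫ s : ℝ, M₁ (s, r) * (gaussKernel c s σ * gaussKernel c r t) :=
        integral_integral_swap (h₁.integrable hc σ t)
    _ = ∫ r : ℝ, ∫ s : ℝ, M₂ (s, r) * (gaussKernel c s t * gaussKernel c r t) := by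
        refine integral_congr_ae (Eventually.of_forall fun r => ?_)
        have h := (h₁₂ r).integral_gaussKernel hA hc (fun s => b2 h₁ s r) (fun s => b2 h₂ s r) t
        rw [← hσ] at h
        calc _ = gaussKernel c r t * ∫ s : ℝ, M₁ (s, r) * gaussKernel c s σ := by
              rw [← integral_const_mul]; exact congrArg _ (funext fun s => by ring)
          _ = _ := by
              rw [h, ← integral_const_mul]; congr 1; funext s; ring
    _ = ∫ s : ℝ, ∫ r : ℝ, M₂ (s, r) * (gaussKernel c s t * gaussKernel c r t) :=
        (integral_integral_swap (h₂.integrable hc t t)).symm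
    _ = diagSmooth M₂ c t := (integral_prod _ (h₂.integrable hc t t)).symm

/-- Continuation first in the second and then in the first variable yields continuation along the
diagonal. -/
theorem StripPair.diag {M₀ M₁ M₂ : ℝ × ℝ → ℂ} {A₀ A₁ A₂ : ℝ} (h₀ : GaussGrowth M₀ A₀)
    (h₁ : GaussGrowth M₁ A₁) (h₂ : GaussGrowth M₂ A₂)
    (h₀₁ : ∀ s, StripPair (fun t => M₀ (s, t)) fun t => M₁ (s, t))
    (h₁₂ : ∀ t, StripPair (fun s => M₁ (s, t)) fun s => M₂ (s, t)) :
    StripPair (fun t => M₀ (t, t)) fun t => M₂ (t, t) := by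
  set A := max A₀ (max A₁ A₂)
  replace h₀ : GaussGrowth M₀ A := h₀.mono (le_max_left _ _)
  replace h₁ : GaussGrowth M₁ A := h₁.mono ((le_max_left _ _).trans (le_max_right _ _))
  replace h₂ : GaussGrowth M₂ A := h₂.mono ((le_max_right _ _).trans (le_max_right _ _))
  have hA := h₀.nonneg
  set B := 4 * A + 4 with hB
  have hN : ∀ n : ℕ, 4 * A + 4 ≤ (n + B : ℝ) := fun n => by linarith [n.cast_nonneg (α := ℝ)]
  have hc : ∀ n : ℕ, 2 * (A + 1) ≤ (n + B : ℝ) ^ 2 := fun n => by nlinarith [hN n]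
  set J := 1 / Real.pi * (A * ∫ q : ℝ × ℝ, Real.exp (-(1 / 2) * (q.1 ^ 2 + q.2 ^ 2))) with hJ
  have hJ0 : 0 ≤ J := by
    have : 0 ≤ ∫ q : ℝ × ℝ, Real.exp (-(1 / 2) * (q.1 ^ 2 + q.2 ^ 2)) :=
      integral_nonneg fun q => (Real.exp_pos _).le
    positivity
  have hbd : ∀ {M : ℝ × ℝ → ℂ}, GaussGrowth M A → ∀ (n : ℕ) (t : ℝ),
      ‖(((n + B : ℝ) ^ 2 / Real.pi : ℝ) : ℂ) * diagSmooth M ((n + B : ℝ) ^ 2) t‖ ≤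
        (J + 4 * A) * Real.exp ((J + 4 * A) * t ^ 2) := fun hM n t => by
    refine (hM.norm_diagSmooth_ofReal_le (hN n) t).trans ?_
    refine mul_le_mul (by linarith) (Real.exp_le_exp.2 ?_) (Real.exp_pos _).le (by positivity)
    nlinarith [sq_nonneg t, mul_nonneg hJ0 (sq_nonneg t)]
  -- The approximants are the normalized regularizations of M₀: entire functions whose values on ℝ +
  -- iπ are the regularizations of M₂. J + 4A bounds both boundary values uniformly in n.
  refine StripPair.of_tendsto (A := J + 4 * A)
    (gn := fun n t => (((n + B : ℝ) ^ 2 / Real.pi : ℝ) : ℂ) * diagSmooth M₀ ((n + B : ℝ) ^ 2) t)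
    (hn := fun n t => (((n + B : ℝ) ^ 2 / Real.pi : ℝ) : ℂ) * diagSmooth M₂ ((n + B : ℝ) ^ 2) t)
    (fun n => ?_) (hbd h₀) (hbd h₂) (h₀.tendstoLocallyUniformly le_rfl)
    (h₂.tendstoLocallyUniformly le_rfl)
  have hd := h₀.differentiable_diagSmooth (hc n)
  set c := (n + B : ℝ) ^ 2
  have hc0 : 0 ≤ c := sq_nonneg _
  set L := ∫ p : ℝ × ℝ, Real.exp (-p.1 ^ 2) * Real.exp (-p.2 ^ 2)
  have hL : 0 ≤ L := integral_nonneg fun p => by positivity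
  refine ⟨fun z => ((c / Real.pi : ℝ) : ℂ) * diagSmooth M₀ c z,
    (hd.const_mul _).continuous.continuousOn, (hd.const_mul _).differentiableOn, ?_, fun t => rfl,
    fun t => by
      exact congrArg _ (diagSmooth_add_pi h₀ h₁ h₂ (hc n) h₀₁ h₁₂ t)⟩
  set Q := c / Real.pi * (A * Real.exp (2 * c * Real.pi ^ 2) * L)
  have hQ : 0 ≤ Q := by positivity
  refine ⟨Q + 4 * (A + 1), fun z hz => ?_⟩
  rw [norm_mul, Complex.norm_real, Real.norm_eq_abs, abs_of_nonneg (by positivity)]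
  have him : z.im ^ 2 ≤ Real.pi ^ 2 := pow_le_pow_left₀ hz.1 hz.2 2
  calc _ ≤ c / Real.pi * (A * Real.exp (2 * c * z.im ^ 2 + 4 * (A + 1) * z.re ^ 2) * L) := by
        gcongr; exact h₀.norm_diagSmooth_le (hc n) z
    _ ≤ c / Real.pi * (A * Real.exp (2 * c * Real.pi ^ 2 + 4 * (A + 1) * z.re ^ 2) * L) := by gcongr
    _ = Q * Real.exp (4 * (A + 1) * z.re ^ 2) := by rw [Real.exp_add]; ring
    _ ≤ _ := by
        refine mul_le_mul (by linarith) (Real.exp_le_exp.2 ?_) (Real.exp_pos _).le (by positivity)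
        nlinarith [mul_nonneg hQ (sq_nonneg z.re)]

end MobiusCFT
end

noncomputable section
namespace MobiusCFT
open MeasureTheory Filter Topology

/-! ## Seminorms and multilinear functionals on `C^∞(S¹)` -/

theorem withSeminorms_cNorm : WithSeminorms cNorm := ⟨rfl⟩

theorem norm_iteratedDeriv_le (f : CInf) (j : ℕ) (θ : ℝ) :
    ‖iteratedDeriv j f.angular θ‖ ≤ derivSeminorm j f := le_ciSup (f.bddAbove_deriv j) θ

theorem derivSeminorm_le {f : CInf} {j : ℕ} {C : ℝ}
    (h : ∀ θ, ‖iteratedDeriv j f.angular θ‖ ≤ C) : derivSeminorm j f ≤ C := ciSup_le h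

theorem cNorm_apply (N : ℕ) (f : CInf) :
    cNorm N f = ∑ j ∈ Finset.range (N + 1), derivSeminorm j f := by
  change (∑ j ∈ Finset.range (N + 1), derivSeminorm j : Seminorm ℂ CInf) f = _
  induction Finset.range (N + 1) using Finset.induction_on with
  | empty => rfl
  | insert a s ha ih => rw [Finset.sum_insert ha, Finset.sum_insert ha, _root_.add_apply, ih]

theorem cNorm_mono {M N : ℕ} (h : M ≤ N) (f : CInf) : cNorm M f ≤ cNorm N f := by
  rw [cNorm_apply, cNorm_apply]
  exact Finset.sum_le_sum_of_subset_of_nonneg (Finset.range_mono (by omega))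
    fun j _ _ => apply_nonneg _ _

theorem exists_cNorm_ball_subset {U : Set CInf} (hU : U ∈ 𝓝 (0 : CInf)) :
    ∃ N : ℕ, ∃ r > 0, ∀ f : CInf, cNorm N f < r → f ∈ U := by
  obtain ⟨s, r, hr, h⟩ := (withSeminorms_cNorm.mem_nhds_iff 0 U).1 hU
  refine ⟨s.sup id, r, hr, fun f hf => h ?_⟩
  rw [Seminorm.mem_ball_zero]
  refine lt_of_le_of_lt ?_ hf
  refine Seminorm.finset_sup_apply_le (apply_nonneg _ _) fun i hi => ?_
  exact cNorm_mono (Finset.le_sup (f := id) hi) f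

/-- Each argument is scaled into a neighbourhood of 0 on which W is bounded, and the scalars are
pulled out. Positive majorants q i replace the norms so that they may be divided by. The threshold
‖W 0‖ + 1 covers k = 0, where W 0 need not vanish. -/
theorem MultilinearMap.exists_cNorm_bound {k : ℕ}
    (W : MultilinearMap ℂ (fun _ : Fin k => CInf) ℂ) (hW : Continuous W) :
    ∃ (N : ℕ) (C : ℝ), 0 ≤ C ∧ ∀ (f : Fin k → CInf) (q : Fin k → ℝ),
      (∀ i, cNorm N (f i) ≤ q i) → (∀ i, 0 < q i) → ‖W f‖ ≤ C * ∏ i, q i := by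
  have h0 : {f : Fin k → CInf | ‖W f‖ < ‖W 0‖ + 1} ∈ 𝓝 (0 : Fin k → CInf) :=
    (hW.norm.tendsto 0).eventually (gt_mem_nhds (lt_add_one _))
  rw [nhds_pi, Filter.mem_pi] at h0
  obtain ⟨I, -, U, hU, hsub⟩ := h0
  choose N r hr hball using fun i => exists_cNorm_ball_subset (hU i)
  refine ⟨∑ i, N i, (‖W 0‖ + 1) * ∏ i, (2 / r i), by
    have : 0 ≤ ∏ i, (2 / r i) := Finset.prod_nonneg fun i _ => by have := hr i; positivity
    positivity, fun f q hf hq => ?_⟩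
  set c : Fin k → ℝ := fun i => r i / (2 * q i) with hc
  have hc0 : ∀ i, 0 < c i := fun i => by have := hr i; have := hq i; positivity
  have h1 : ‖W fun i => (c i : ℂ) • f i‖ < ‖W 0‖ + 1 := by
    refine hsub fun i _ => hball i _ ?_
    rw [map_smul_eq_mul, Complex.norm_real, Real.norm_eq_abs, abs_of_pos (hc0 i)]
    have h2 : cNorm (N i) (f i) ≤ q i :=
      (cNorm_mono (Finset.single_le_sum (f := N) (fun _ _ => Nat.zero_le _) (Finset.mem_univ i)) _).trans
        (hf i)
    calc c i * cNorm (N i) (f i) ≤ c i * q i := mul_le_mul_of_nonneg_left h2 (hc0 i).le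
      _ = r i / 2 := by rw [hc]; have := (hq i).ne'; field_simp
      _ < r i := half_lt_self (hr i)
  rw [MultilinearMap.map_smul_univ, norm_smul, norm_prod] at h1
  simp only [Complex.norm_real, Real.norm_eq_abs, fun i => abs_of_pos (hc0 i)] at h1
  have h3 : (∏ i, c i) * ((∏ i, (2 / r i)) * ∏ i, q i) = 1 := by
    rw [← Finset.prod_mul_distrib, ← Finset.prod_mul_distrib]
    refine Finset.prod_eq_one fun i _ => ?_
    have := (hq i).ne'
    have := (hr i).ne'
    simp only [hc]
    field_simp
  have h4 : 0 ≤ (∏ i, (2 / r i)) * ∏ i, q i :=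
    mul_nonneg (Finset.prod_nonneg fun i _ => by have := hr i; positivity)
      (Finset.prod_nonneg fun i _ => (hq i).le)
  calc ‖W f‖ = ((∏ i, c i) * ‖W f‖) * ((∏ i, (2 / r i)) * ∏ i, q i) := by
        linear_combination (-‖W f‖) * h3
    _ ≤ (‖W 0‖ + 1) * ((∏ i, (2 / r i)) * ∏ i, q i) := mul_le_mul_of_nonneg_right h1.le h4
    _ = _ := by ring

/-- A continuous family of smooth functions whose `C^N` norms have Gaussian growth. -/
structure TemperedFamily (w : ℝ × ℝ → CInf) : Prop where
  cont : Continuous w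
  bound : ∀ N, ∃ A : ℝ, ∀ p, cNorm N (w p) ≤ A * Real.exp (A * (p.1 ^ 2 + p.2 ^ 2))

theorem MultilinearMap.gaussGrowth {k : ℕ}
    (W : MultilinearMap ℂ (fun _ : Fin k => CInf) ℂ) (hW : Continuous W)
    {w : Fin k → ℝ × ℝ → CInf} (hw : ∀ i, TemperedFamily (w i)) :
    ∃ A, GaussGrowth (fun p => W fun i => w i p) A := by
  obtain ⟨N, C, hC, hb⟩ := MultilinearMap.exists_cNorm_bound W hW
  choose A hA using fun i => (hw i).bound N
  have hA0 : ∀ i, 0 ≤ A i := fun i => by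
    simpa using (apply_nonneg (cNorm N) (w i (0, 0))).trans (hA i (0, 0))
  set P := ∏ i, (A i + 1)
  set S := ∑ i, A i
  have hP : 0 ≤ P := Finset.prod_nonneg fun i _ => by have := hA0 i; positivity
  have hS : 0 ≤ S := Finset.sum_nonneg fun i _ => hA0 i
  refine ⟨C * P + S, hW.comp (continuous_pi fun i => (hw i).cont), fun p => ?_⟩
  -- A i + 1 instead of A i only keeps the majorants strictly positive.
  refine (hb (fun i => w i p) (fun i => (A i + 1) * Real.exp (A i * (p.1 ^ 2 + p.2 ^ 2)))
    (fun i => (hA i p).trans ?_) fun i => ?_).trans ?_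
  · gcongr
    linarith
  · have := hA0 i
    positivity
  · rw [Finset.prod_mul_distrib, ← Real.exp_sum, ← Finset.sum_mul, ← mul_assoc]
    have h1 : 0 ≤ C * P := mul_nonneg hC hP
    gcongr
    · linarith
    · linarith

/-! ## Families of functions with Gaussian growth of all derivatives -/

/-- The action of `v_{-t}` on angles. -/
def angleLift (t θ : ℝ) : ℝ :=
  θ - 2 * Real.arctan (Real.sinh (t / 2) * Real.sin θ / (Real.cosh (t / 2) + Real.sinh (t / 2) * Real.cos θ))

theorem cosh_add_sinh_mul_pos (t x : ℝ) (hx : |x| ≤ 1) : 0 < Real.cosh t + Real.sinh t * x := by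
  have h1 : |Real.sinh t * x| ≤ |Real.sinh t| := by
    rw [abs_mul]; exact mul_le_of_le_one_right (abs_nonneg _) hx
  have h2 : |Real.sinh t| < Real.cosh t := by
    rw [← abs_of_pos (Real.cosh_pos t), ← sq_lt_sq, Real.cosh_sq]
    linarith
  have h3 := neg_abs_le (Real.sinh t * x)
  linarith

theorem cosh_eq_half (t : ℝ) : Real.cosh t = Real.cosh (t / 2) ^ 2 + Real.sinh (t / 2) ^ 2 := by
  rw [← Real.cosh_two_mul]; congr 1; ring

theorem sinh_eq_half (t : ℝ) : Real.sinh t = 2 * Real.sinh (t / 2) * Real.cosh (t / 2) := by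
  rw [← Real.sinh_two_mul]; congr 1; ring

/-- The derivative is the reciprocal of the conformal factor of v_t. Differentiating F ∘ `angleLift`
in the angle therefore produces only functions that are already generators of `AngularFamily`. -/
theorem hasDerivAt_angleLift (t θ : ℝ) :
    HasDerivAt (angleLift t) (Real.cosh t + Real.sinh t * Real.cos θ)⁻¹ θ := by
  have hp := cosh_add_sinh_mul_pos (t / 2) (Real.cos θ) (Real.abs_cos_le_one θ)
  have hq := cosh_add_sinh_mul_pos t (Real.cos θ) (Real.abs_cos_le_one θ)
  have h1 := (((Real.hasDerivAt_sin θ).const_mul (Real.sinh (t / 2))).div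
    (((Real.hasDerivAt_cos θ).const_mul (Real.sinh (t / 2))).const_add (Real.cosh (t / 2)))
      hp.ne').arctan.const_mul 2
  have h2 := (hasDerivAt_id θ).sub h1
  refine h2.congr_deriv ?_
  rw [cosh_eq_half t, sinh_eq_half t] at hq ⊢
  have hcs : Real.cosh (t / 2) ^ 2 = Real.sinh (t / 2) ^ 2 + 1 := Real.cosh_sq _
  have hsc : Real.sin θ ^ 2 + Real.cos θ ^ 2 = 1 := Real.sin_sq_add_cos_sq θ
  simp only [Pi.div_apply]
  generalize Real.cosh (t / 2) = c at *
  generalize Real.sinh (t / 2) = s at *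
  generalize Real.cos θ = x at *
  generalize Real.sin θ = y at *
  have hpp : (c + s * x) ^ 2 + (s * y) ^ 2 = c ^ 2 + s ^ 2 + 2 * s * c * x := by
    linear_combination s ^ 2 * hsc
  have hd : 1 + (s * y / (c + s * x)) ^ 2 = (c ^ 2 + s ^ 2 + 2 * s * c * x) / (c + s * x) ^ 2 := by
    rw [← hpp]; field_simp [hp.ne']
  rw [hd, eq_comm, inv_eq_one_div, div_eq_iff hq.ne']
  have hp' := hp.ne'
  have hq' := hq.ne'
  have hk : ∀ Q N P : ℝ, Q ≠ 0 → P ≠ 0 → (1 - 2 * (1 / (Q / P ^ 2) * (N / P ^ 2))) * Q = Q - 2 * N := by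
    intro Q N P hQ hP
    field_simp
  rw [hk _ _ _ hq' hp']
  linear_combination (-1 : ℝ) * hcs + 2 * s ^ 2 * hsc

theorem continuous_angleLift : Continuous fun p : ℝ × ℝ => angleLift p.1 p.2 := by
  unfold angleLift
  refine continuous_snd.sub (continuous_const.mul (Real.continuous_arctan.comp
    (Continuous.div (by fun_prop) (by fun_prop) fun p => ?_)))
  exact (cosh_add_sinh_mul_pos (p.1 / 2) (Real.cos p.2) (Real.abs_cos_le_one _)).ne'

/-- Families `w t θ` of functions of an angle, generated by the functions that occur in the action of
the one-parameter group `v`. -/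
inductive AngularFamily : (ℝ → ℝ → ℂ) → Prop
  | coeff {a : ℝ → ℂ} {A : ℝ} (hc : Continuous a) (ha : ∀ t, ‖a t‖ ≤ A * Real.exp (A * t ^ 2)) :
      AngularFamily fun t _ => a t
  | cos : AngularFamily fun _ θ => (Real.cos θ : ℂ)
  | sin : AngularFamily fun _ θ => (Real.sin θ : ℂ)
  | jac : AngularFamily fun t θ => ((Real.cosh t + Real.sinh t * Real.cos θ : ℝ) : ℂ)⁻¹
  | comp {F : ℝ → ℂ} (hF : ContDiff ℝ ∞ F) (hb : ∀ j, ∃ C, ∀ x, ‖iteratedDeriv j F x‖ ≤ C) :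
      AngularFamily fun t θ => F (angleLift t θ)
  | add {w₁ w₂ : ℝ → ℝ → ℂ} (h₁ : AngularFamily w₁) (h₂ : AngularFamily w₂) :
      AngularFamily fun t θ => w₁ t θ + w₂ t θ
  | mul {w₁ w₂ : ℝ → ℝ → ℂ} (h₁ : AngularFamily w₁) (h₂ : AngularFamily w₂) :
      AngularFamily fun t θ => w₁ t θ * w₂ t θ

namespace AngularFamily

theorem const (c : ℂ) : AngularFamily fun _ _ => c :=
  coeff (A := ‖c‖) continuous_const fun t =>
    le_mul_of_one_le_right (norm_nonneg _) (Real.one_le_exp (by positivity))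

theorem continuous {w : ℝ → ℝ → ℂ} (h : AngularFamily w) : Continuous fun p : ℝ × ℝ => w p.1 p.2 := by
  induction h with
  | coeff hc ha => exact hc.comp continuous_fst
  | cos => fun_prop
  | sin => fun_prop
  | jac =>
    refine Continuous.inv₀ (by fun_prop) fun p => ?_
    exact_mod_cast (cosh_add_sinh_mul_pos p.1 (Real.cos p.2) (Real.abs_cos_le_one _)).ne'
  | comp hF hb => exact hF.continuous.comp continuous_angleLift
  | add _ _ h₁ h₂ => exact h₁.add h₂
  | mul _ _ h₁ h₂ => exact h₁.mul h₂

theorem exp_abs_le (t : ℝ) : Real.exp |t| ≤ Real.exp 1 * Real.exp (Real.exp 1 * t ^ 2) := by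
  rw [← Real.exp_add, Real.exp_le_exp]
  have h1 : 1 ≤ Real.exp 1 := Real.one_le_exp zero_le_one
  nlinarith [sq_nonneg (|t| - 1), sq_abs t, sq_nonneg t]

theorem bound {w : ℝ → ℝ → ℂ} (h : AngularFamily w) :
    ∃ A : ℝ, ∀ t θ, ‖w t θ‖ ≤ A * Real.exp (A * t ^ 2) := by
  induction h with
  | coeff hc ha => exact ⟨_, fun t _ => ha t⟩
  | cos =>
    refine ⟨1, fun t θ => ?_⟩
    rw [Complex.norm_real, one_mul, one_mul]
    exact (Real.abs_cos_le_one θ).trans (Real.one_le_exp (sq_nonneg t))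
  | sin =>
    refine ⟨1, fun t θ => ?_⟩
    rw [Complex.norm_real, one_mul, one_mul]
    exact (Real.abs_sin_le_one θ).trans (Real.one_le_exp (sq_nonneg t))
  | jac =>
    refine ⟨Real.exp 1, fun t θ => ?_⟩
    have hq := cosh_add_sinh_mul_pos t (Real.cos θ) (Real.abs_cos_le_one θ)
    rw [norm_inv, Complex.norm_real, Real.norm_eq_abs, abs_of_pos hq]
    refine le_trans ?_ (exp_abs_le t)
    -- The conformal factor is at least cosh t - |sinh t| = exp(-|t|).
    rw [inv_le_comm₀ hq (Real.exp_pos _), ← Real.exp_neg]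
    have h1 : |Real.sinh t * Real.cos θ| ≤ |Real.sinh t| := by
      rw [abs_mul]; exact mul_le_of_le_one_right (abs_nonneg _) (Real.abs_cos_le_one θ)
    have h2 := neg_abs_le (Real.sinh t * Real.cos θ)
    have h3 : Real.exp (-|t|) = Real.cosh |t| - Real.sinh |t| := (Real.cosh_sub_sinh _).symm
    rw [Real.cosh_abs, ← Real.abs_sinh] at h3
    linarith
  | comp hF hb =>
    obtain ⟨C, hC⟩ := hb 0
    refine ⟨C, fun t θ => ?_⟩
    have h1 := hC (angleLift t θ)
    rw [iteratedDeriv_zero] at h1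
    have hC0 : 0 ≤ C := (norm_nonneg _).trans h1
    exact h1.trans (le_mul_of_one_le_right hC0 (Real.one_le_exp (by positivity)))
  | add _ _ h₁ h₂ =>
    obtain ⟨A, hA⟩ := h₁
    obtain ⟨B, hB⟩ := h₂
    have hA0 : 0 ≤ A := by simpa using (norm_nonneg _).trans (hA 0 0)
    have hB0 : 0 ≤ B := by simpa using (norm_nonneg _).trans (hB 0 0)
    refine ⟨A + B, fun t θ => (norm_add_le _ _).trans ((add_le_add (hA t θ) (hB t θ)).trans ?_)⟩
    rw [add_mul]
    gcongr <;> linarith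
  | mul _ _ h₁ h₂ =>
    obtain ⟨A, hA⟩ := h₁
    obtain ⟨B, hB⟩ := h₂
    have hA0 : 0 ≤ A := by simpa using (norm_nonneg _).trans (hA 0 0)
    have hB0 : 0 ≤ B := by simpa using (norm_nonneg _).trans (hB 0 0)
    refine ⟨A * B + (A + B), fun t θ => ?_⟩
    rw [norm_mul]
    calc _ ≤ (A * Real.exp (A * t ^ 2)) * (B * Real.exp (B * t ^ 2)) :=
          mul_le_mul (hA t θ) (hB t θ) (norm_nonneg _) (by positivity)
      _ = (A * B) * Real.exp ((A + B) * t ^ 2) := by rw [add_mul, Real.exp_add]; ring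
      _ ≤ _ := by
          have := mul_nonneg hA0 hB0
          refine mul_le_mul (by linarith) (Real.exp_le_exp.2 ?_) (Real.exp_pos _).le (by positivity)
          nlinarith [mul_nonneg this (sq_nonneg t)]

/-- The class is closed under differentiation in the angle. Hence continuity and Gaussian growth,
proved once for the class, hold for all derivatives and so for all C^N norms. -/
theorem exists_hasDerivAt {w : ℝ → ℝ → ℂ} (h : AngularFamily w) :
    ∃ w', AngularFamily w' ∧ ∀ t θ, HasDerivAt (w t) (w' t θ) θ := by
  induction h with
  | coeff hc ha => exact ⟨_, const 0, fun t θ => hasDerivAt_const _ _⟩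
  | cos =>
    refine ⟨_, (const (-1)).mul sin, fun t θ => ?_⟩
    have h := (Real.hasDerivAt_cos θ).ofReal_comp
    simpa using h
  | sin => exact ⟨_, cos, fun t θ => (Real.hasDerivAt_sin θ).ofReal_comp⟩
  | jac =>
    have hs : AngularFamily fun t _ => (Real.sinh t : ℂ) :=
      coeff (A := Real.exp 1) (by fun_prop) fun t => by
        rw [Complex.norm_real, Real.norm_eq_abs, Real.abs_sinh]
        refine le_trans ?_ (exp_abs_le t)
        rw [← Real.cosh_add_sinh]
        linarith [Real.cosh_pos |t|]
    refine ⟨_, (jac.mul jac).mul (hs.mul sin), fun t θ => ?_⟩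
    have hq := cosh_add_sinh_mul_pos t (Real.cos θ) (Real.abs_cos_le_one θ)
    have h1 := (((Real.hasDerivAt_cos θ).const_mul (Real.sinh t)).const_add (Real.cosh t)).ofReal_comp.inv
      (by exact_mod_cast hq.ne')
    refine h1.congr_deriv ?_
    push_cast
    rw [div_eq_mul_inv, pow_two, mul_inv]
    ring
  | @comp F hF hb =>
    have hF' : ContDiff ℝ ∞ (deriv F) := (contDiff_infty_iff_deriv.1 hF).2
    have hb' : ∀ j, ∃ C, ∀ x, ‖iteratedDeriv j (deriv F) x‖ ≤ C := fun j => by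
      simpa only [iteratedDeriv_succ'] using hb (j + 1)
    refine ⟨_, jac.mul (comp hF' hb'), fun t θ => ?_⟩
    have h1 : HasDerivAt F (deriv F (angleLift t θ)) (angleLift t θ) :=
      (hF.differentiable (by simp) _).hasDerivAt
    have h2 := h1.scomp θ (hasDerivAt_angleLift t θ)
    refine h2.congr_deriv ?_
    rw [Complex.real_smul]
    push_cast
    rfl
  | add _ _ h₁ h₂ =>
    obtain ⟨w₁', k₁, d₁⟩ := h₁
    obtain ⟨w₂', k₂, d₂⟩ := h₂
    exact ⟨_, k₁.add k₂, fun t θ => (d₁ t θ).add (d₂ t θ)⟩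
  | mul e₁ e₂ h₁ h₂ =>
    obtain ⟨w₁', k₁, d₁⟩ := h₁
    obtain ⟨w₂', k₂, d₂⟩ := h₂
    exact ⟨_, (k₁.mul e₂).add (e₁.mul k₂), fun t θ => (d₁ t θ).mul (d₂ t θ)⟩

theorem iteratedDeriv {w : ℝ → ℝ → ℂ} (h : AngularFamily w) (j : ℕ) :
    AngularFamily fun t θ => _root_.iteratedDeriv j (w t) θ := by
  induction j generalizing w with
  | zero => simpa only [iteratedDeriv_zero] using h
  | succ j ih =>
    obtain ⟨w', k, d⟩ := h.exists_hasDerivAt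
    have h1 : ∀ t, deriv (w t) = w' t := fun t => funext fun θ => (d t θ).deriv
    simp only [iteratedDeriv_succ', h1]
    exact ih k

theorem pow {w : ℝ → ℝ → ℂ} (h : AngularFamily w) (k : ℕ) : AngularFamily fun t θ => w t θ ^ k := by
  induction k with
  | zero => simpa using const 1
  | succ k ih => simpa only [pow_succ] using ih.mul h

theorem cosh_add_sinh_mul_cos :
    AngularFamily fun t θ => ((Real.cosh t + Real.sinh t * Real.cos θ : ℝ) : ℂ) := by
  have hs : AngularFamily fun t _ => (Real.sinh t : ℂ) :=
    coeff (A := Real.exp 1) (by fun_prop) fun t => by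
      rw [Complex.norm_real, Real.norm_eq_abs, Real.abs_sinh]
      refine le_trans ?_ (exp_abs_le t)
      rw [← Real.cosh_add_sinh]
      linarith [Real.cosh_pos |t|]
  have hc : AngularFamily fun t _ => (Real.cosh t : ℂ) :=
    coeff (A := Real.exp 1) (by fun_prop) fun t => by
      rw [Complex.norm_real, Real.norm_eq_abs, abs_of_pos (Real.cosh_pos t), ← Real.cosh_abs]
      refine le_trans ?_ (exp_abs_le t)
      rw [← Real.cosh_add_sinh]
      linarith [Real.sinh_nonneg_iff.2 (abs_nonneg t)]
  simpa using hc.add (hs.mul cos)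

end AngularFamily

/-! ### Angular families as curves in the Fréchet space. -/

theorem CInf.periodic_iteratedDeriv (f : CInf) (j : ℕ) :
    Function.Periodic (iteratedDeriv j f.angular) (2 * Real.pi) := by
  have h : (fun θ : ℝ => f.angular (θ + 2 * Real.pi)) = f.angular := by
    funext θ
    simp [CInf.angular, Circle.periodic_exp θ]
  intro θ
  have h2 := congrFun (iteratedDeriv_comp_add_const j f.angular (2 * Real.pi)) θ
  rw [h] at h2
  exact h2.symm

theorem iteratedDeriv_angular_sub (f g : CInf) (j : ℕ) (θ : ℝ) :
    iteratedDeriv j (f - g).angular θ = iteratedDeriv j f.angular θ - iteratedDeriv j g.angular θ :=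
  iteratedDeriv_fun_sub (f.contDiff_angular.contDiffAt.of_le (by exact_mod_cast le_top))
    (g.contDiff_angular.contDiffAt.of_le (by exact_mod_cast le_top))

/-- By periodicity the suprema are over [0, 2π]. There joint continuity of each derivative gives
uniformity in the angle by compactness. -/
theorem AngularFamily.continuous_cInf {w : ℝ → CInf} (h : AngularFamily fun t => (w t).angular) :
    Continuous w := by
  refine continuous_iff_continuousAt.2 fun t₀ => ?_
  rw [ContinuousAt, withSeminorms_cNorm.tendsto_nhds]
  intro N ε hε
  have key : ∀ j, ∀ᶠ t in 𝓝 t₀, derivSeminorm j (w t - w t₀) ≤ ε / (2 * (N + 1)) := by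
    intro j
    have hc := (h.iteratedDeriv j).continuous
    have hK := (isCompact_Icc (a := (0 : ℝ)) (b := 2 * Real.pi)).eventually_forall_of_forall_eventually
      (x₀ := t₀) (P := fun t θ => ‖_root_.iteratedDeriv j (w t).angular θ -
        _root_.iteratedDeriv j (w t₀).angular θ‖ < ε / (2 * (N + 1))) fun θ _ => by
          have hc2 : Continuous fun p : ℝ × ℝ => ‖_root_.iteratedDeriv j (w p.1).angular p.2 -
              _root_.iteratedDeriv j (w t₀).angular p.2‖ :=
            (hc.sub (hc.comp (by fun_prop : Continuous fun p : ℝ × ℝ => (t₀, p.2)))).norm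
          refine (hc2.tendsto (t₀, θ)).eventually (gt_mem_nhds ?_)
          simp only [sub_self, norm_zero]
          positivity
    filter_upwards [hK] with t ht
    refine derivSeminorm_le fun θ => ?_
    rw [iteratedDeriv_angular_sub]
    obtain ⟨y, hy, hyθ⟩ := ((w t).periodic_iteratedDeriv j).sub
      ((w t₀).periodic_iteratedDeriv j) |>.exists_mem_Ico₀ (by positivity) θ
    simp only [Pi.sub_apply] at hyθ
    rw [hyθ]
    exact (ht y ⟨hy.1, hy.2.le⟩).le
  have hall : ∀ᶠ t in 𝓝 t₀, ∀ j ∈ Finset.range (N + 1),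
      derivSeminorm j (w t - w t₀) ≤ ε / (2 * (N + 1)) :=
    (Finset.eventually_all _).2 fun j _ => key j
  filter_upwards [hall] with t ht
  rw [cNorm_apply]
  refine (Finset.sum_le_sum ht).trans_lt ?_
  rw [Finset.sum_const, Finset.card_range, nsmul_eq_mul]
  push_cast
  have : (N + 1 : ℝ) * (ε / (2 * (N + 1))) = ε / 2 := by
    have : (N + 1 : ℝ) ≠ 0 := by positivity
    field_simp
  rw [this]
  linarith

theorem AngularFamily.cNorm_bound {w : ℝ → CInf} (h : AngularFamily fun t => (w t).angular) (N : ℕ) :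
    ∃ A : ℝ, ∀ t, cNorm N (w t) ≤ A * Real.exp (A * t ^ 2) := by
  choose A hA using fun j => (h.iteratedDeriv j).bound
  have hA0 : ∀ j, 0 ≤ A j := fun j => by simpa using (norm_nonneg _).trans (hA j 0 0)
  refine ⟨∑ j ∈ Finset.range (N + 1), A j, fun t => ?_⟩
  rw [cNorm_apply, Finset.sum_mul]
  refine Finset.sum_le_sum fun j hj => derivSeminorm_le fun θ => (hA j t θ).trans ?_
  have h1 : A j ≤ ∑ j ∈ Finset.range (N + 1), A j := Finset.single_le_sum (fun i _ => hA0 i) hj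
  have := hA0 j
  gcongr

theorem AngularFamily.temperedFamily_fst {w : ℝ → CInf} (h : AngularFamily fun t => (w t).angular) :
    TemperedFamily fun p => w p.1 := by
  refine ⟨h.continuous_cInf.comp continuous_fst, fun N => ?_⟩
  obtain ⟨A, hA⟩ := h.cNorm_bound N
  have hA0 : 0 ≤ A := by simpa using (apply_nonneg (cNorm N) (w 0)).trans (hA 0)
  refine ⟨A, fun p => (hA p.1).trans ?_⟩
  gcongr
  exact le_add_of_nonneg_right (sq_nonneg _)

theorem AngularFamily.temperedFamily_snd {w : ℝ → CInf} (h : AngularFamily fun t => (w t).angular) :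
    TemperedFamily fun p => w p.2 := by
  refine ⟨h.continuous_cInf.comp continuous_snd, fun N => ?_⟩
  obtain ⟨A, hA⟩ := h.cNorm_bound N
  have hA0 : 0 ≤ A := by simpa using (apply_nonneg (cNorm N) (w 0)).trans (hA 0)
  refine ⟨A, fun p => (hA p.2).trans ?_⟩
  gcongr
  exact le_add_of_nonneg_left (sq_nonneg _)

/-! ## The action of `v_t` on functions -/

theorem v_inv (t : ℝ) : (v t)⁻¹ = v (-t) := by
  refine Subtype.ext (Equiv.ext fun z => Circle.ext ?_)
  rw [coe_v_apply]
  change (mobFun _ _ (isSU_v t).inv z : ℂ) = _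
  rw [coe_mobFun]
  simp [-Complex.ofReal_sinh, -Complex.ofReal_cosh, Complex.conj_ofReal, neg_div]

theorem coe_v_neg_apply (t : ℝ) (z : Circle) :
    (((v (-t) : Mob) : Equiv.Perm Circle) z : ℂ) =
      (Real.cosh (t / 2) * z + Real.sinh (t / 2)) / (Real.sinh (t / 2) * z + Real.cosh (t / 2)) := by
  rw [coe_v_apply]
  simp [neg_div]

theorem sinh_mul_add_cosh_ne_zero (t : ℝ) (z : Circle) :
    (Real.sinh (t / 2) * z + Real.cosh (t / 2) : ℂ) ≠ 0 := by
  have h := (isSU_v t).inv.denom_ne z.norm_coe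
  simpa [-Complex.ofReal_sinh, -Complex.ofReal_cosh, Complex.conj_ofReal] using h

theorem X_v_apply_v_neg (t : ℝ) (z : Circle) :
    X (v t) (((v (-t) : Mob) : Equiv.Perm Circle) z) =
      ((Real.cosh t + Real.sinh t * (z : ℂ).re : ℝ) : ℂ) := by
  have hz : (z : ℂ) * conj (z : ℂ) = 1 := by
    rw [Complex.mul_conj, Circle.normSq_coe]; simp
  have hne := sinh_mul_add_cosh_ne_zero t z
  have hcs : (Real.cosh (t / 2) : ℂ) ^ 2 = (Real.sinh (t / 2) : ℂ) ^ 2 + 1 := by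
    exact_mod_cast Real.cosh_sq (t / 2)
  have h1 : conj ((-Real.sinh (t / 2) : ℝ) : ℂ) * (((v (-t) : Mob) : Equiv.Perm Circle) z : ℂ) +
      conj (Real.cosh (t / 2) : ℂ) = (Real.sinh (t / 2) * z + Real.cosh (t / 2) : ℂ)⁻¹ := by
    rw [coe_v_neg_apply, Complex.conj_ofReal, Complex.conj_ofReal, Complex.ofReal_neg]
    field_simp
    linear_combination hcs
  rw [v, X_mob, h1, map_inv₀, ← mul_inv, one_div, inv_inv]
  have h2 : ((z : ℂ).re : ℂ) = ((z : ℂ) + conj (z : ℂ)) / 2 := Complex.re_eq_add_conj _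
  rw [cosh_eq_half t, sinh_eq_half t]
  simp only [Complex.ofReal_add, Complex.ofReal_mul, Complex.ofReal_pow, Complex.ofReal_ofNat, h2,
    map_add, map_mul, Complex.conj_ofReal]
  linear_combination (Real.sinh (t / 2) : ℂ) ^ 2 * hz

theorem beta_v_apply (d : ℕ) (t : ℝ) (f : CInf) (z : Circle) :
    beta d (v t) f z = ((Real.cosh t + Real.sinh t * (z : ℂ).re : ℝ) : ℂ) ^ ((d : ℤ) - 1) *
      f (((v (-t) : Mob) : Equiv.Perm Circle) z) := by
  rw [beta, CInf.mk_apply, v_inv, X_v_apply_v_neg]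

theorem exp_arctan_sq_mul (y : ℝ) :
    Complex.exp (Real.arctan y * Complex.I) ^ 2 * (1 - y * Complex.I) = 1 + y * Complex.I := by
  have hsq : Real.sqrt (1 + y ^ 2) ≠ 0 := (Real.sqrt_pos.2 (by positivity)).ne'
  have he : Complex.exp (Real.arctan y * Complex.I) * (Real.sqrt (1 + y ^ 2) : ℂ) = 1 + y * Complex.I := by
    rw [Complex.exp_mul_I, ← Complex.ofReal_cos, ← Complex.ofReal_sin, Real.cos_arctan, Real.sin_arctan]
    have : (Real.sqrt (1 + y ^ 2) : ℂ) ≠ 0 := by exact_mod_cast hsq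
    push_cast
    field_simp
  have hs2 : (Real.sqrt (1 + y ^ 2) : ℂ) ^ 2 = 1 + (y : ℂ) ^ 2 := by
    exact_mod_cast Real.sq_sqrt (by positivity : 0 ≤ 1 + y ^ 2)
  have h3 : Complex.exp (Real.arctan y * Complex.I) ^ 2 * (1 + (y : ℂ) ^ 2) =
      (1 + y * Complex.I) ^ 2 := by
    rw [← he, mul_pow, hs2]
  have hI := Complex.I_mul_I
  have hyI' : (1 + y * Complex.I : ℂ) ≠ 0 := by
    intro h
    have := congrArg Complex.re h
    simp at this
  apply mul_left_cancel₀ hyI'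
  linear_combination h3 + (-(Complex.exp (Real.arctan y * Complex.I) ^ 2) * (y : ℂ) ^ 2) * hI

/-- With p = cosh + sinh cos θ (at t/2) and y = sinh sin θ / p, the denominator of v_{-t} at e^{iθ}
is p(1 + iy) and the numerator is e^{iθ} p(1 - iy). Their quotient is e^{iθ} exp(-2i arctan y). -/
theorem exp_angleLift (t θ : ℝ) :
    Circle.exp (angleLift t θ) = ((v (-t) : Mob) : Equiv.Perm Circle) (Circle.exp θ) := by
  apply Circle.ext
  have hne := sinh_mul_add_cosh_ne_zero t (Circle.exp θ)
  have hp := cosh_add_sinh_mul_pos (t / 2) (Real.cos θ) (Real.abs_cos_le_one θ)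
  rw [coe_v_neg_apply, eq_div_iff hne, Circle.coe_exp, Circle.coe_exp] at *
  set y := Real.sinh (t / 2) * Real.sin θ / (Real.cosh (t / 2) + Real.sinh (t / 2) * Real.cos θ) with hy
  have h1 : Complex.exp ((angleLift t θ : ℝ) * Complex.I) * Complex.exp (Real.arctan y * Complex.I) ^ 2 =
      Complex.exp (θ * Complex.I) := by
    rw [← Complex.exp_nat_mul, ← Complex.exp_add]
    congr 1
    simp only [angleLift, ← hy]
    push_cast
    ring
  have h2 := exp_arctan_sq_mul y
  have hE : Complex.exp (θ * Complex.I) = Real.cos θ + Real.sin θ * Complex.I := by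
    rw [Complex.exp_mul_I]; push_cast; rfl
  have hsc : (Real.sin θ : ℂ) ^ 2 + (Real.cos θ : ℂ) ^ 2 = 1 := by
    exact_mod_cast Real.sin_sq_add_cos_sq θ
  have hyc : (y : ℂ) * (Real.cosh (t / 2) + Real.sinh (t / 2) * Real.cos θ) =
      Real.sinh (t / 2) * Real.sin θ := by
    exact_mod_cast div_mul_cancel₀ _ hp.ne'
  have hp' : (Real.cosh (t / 2) + Real.sinh (t / 2) * Real.cos θ : ℂ) ≠ 0 := by exact_mod_cast hp.ne'
  have hA : (Real.sinh (t / 2) * Complex.exp (θ * Complex.I) + Real.cosh (t / 2) : ℂ) =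
      (Real.cosh (t / 2) + Real.sinh (t / 2) * Real.cos θ) * (1 + y * Complex.I) := by
    rw [hE]; linear_combination (-Complex.I) * hyc
  have hB : (Real.cosh (t / 2) * Complex.exp (θ * Complex.I) + Real.sinh (t / 2) : ℂ) =
      Complex.exp (θ * Complex.I) *
        ((Real.cosh (t / 2) + Real.sinh (t / 2) * Real.cos θ) * (1 - y * Complex.I)) := by
    have hI := Complex.I_mul_I
    rw [hE]
    linear_combination (Complex.I * (Real.cos θ + Real.sin θ * Complex.I)) * hyc -
      (Real.sinh (t / 2) : ℂ) * hsc + (Real.sinh (t / 2) * (Real.sin θ : ℂ) ^ 2) * hI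
  rw [hA, hB, ← h1]
  linear_combination (-(Complex.exp ((angleLift t θ : ℝ) * Complex.I)) *
    (Real.cosh (t / 2) + Real.sinh (t / 2) * Real.cos θ)) * h2

theorem beta_v_angular (d : ℕ) (t : ℝ) (f : CInf) (θ : ℝ) :
    (beta d (v t) f).angular θ =
      ((Real.cosh t + Real.sinh t * Real.cos θ : ℝ) : ℂ) ^ ((d : ℤ) - 1) * f.angular (angleLift t θ) := by
  rw [CInf.angular, beta_v_apply, CInf.angular, exp_angleLift, Circle.coe_exp, Complex.exp_ofReal_mul_I_re]

theorem angularFamily_beta (d : ℕ) (f : CInf) : AngularFamily fun t => (beta d (v t) f).angular := by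
  have hf : AngularFamily fun t θ => f.angular (angleLift t θ) :=
    .comp f.contDiff_angular fun j => ⟨_, norm_iteratedDeriv_le f j⟩
  have he : (fun t => (beta d (v t) f).angular) = fun t θ =>
      ((Real.cosh t + Real.sinh t * Real.cos θ : ℝ) : ℂ) ^ ((d : ℤ) - 1) * f.angular (angleLift t θ) :=
    funext fun t => funext fun θ => beta_v_angular d t f θ
  rw [he]
  refine AngularFamily.mul ?_ hf
  -- The exponent d - 1 is negative only for d = 0, where the factor is the generator `jac`.
  -- Otherwise it is a power of the conformal factor.
  cases d with
  | zero => simpa using AngularFamily.jac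
  | succ d =>
    simp only [Nat.cast_succ, add_sub_cancel_right, zpow_natCast]
    exact AngularFamily.cosh_add_sinh_mul_cos.pow d

end MobiusCFT
end

noncomputable section
namespace MobiusCFT
open MeasureTheory Filter Topology

/-! ## Fourier series -/

/-- The Fourier coefficients of a `2π`-periodic function. -/
def fourierCoef (F : ℝ → ℂ) (n : ℤ) : ℂ :=
  (2 * Real.pi : ℂ)⁻¹ * ∫ θ in (0 : ℝ)..(2 * Real.pi), F θ * Complex.exp (-(n * θ * Complex.I))

theorem exp_neg_int_mul_two_pi (n : ℤ) (θ : ℝ) :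
    Complex.exp (-(n * ((θ + 2 * Real.pi : ℝ) : ℂ) * Complex.I)) = Complex.exp (-(n * θ * Complex.I)) := by
  have h := Complex.exp_int_mul_two_pi_mul_I (-n)
  have e : -(n * ((θ + 2 * Real.pi : ℝ) : ℂ) * Complex.I) =
      -(n * θ * Complex.I) + ((-n : ℤ) : ℂ) * (2 * Real.pi * Complex.I) := by
    push_cast; ring
  rw [e, Complex.exp_add, h, mul_one]

theorem norm_exp_neg_int_mul (n : ℤ) (θ : ℝ) : ‖Complex.exp (-(n * θ * Complex.I))‖ = 1 := by
  have e : (-(n * θ * Complex.I) : ℂ) = ((-n * θ : ℝ) : ℂ) * Complex.I := by push_cast; ring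
  rw [e, Complex.norm_exp_ofReal_mul_I]

theorem norm_fourierCoef_le {F : ℝ → ℂ} {C : ℝ} (h : ∀ θ, ‖F θ‖ ≤ C) (n : ℤ) :
    ‖fourierCoef F n‖ ≤ C := by
  have h1 := intervalIntegral.norm_integral_le_of_norm_le_const (a := 0) (b := 2 * Real.pi) (C := C)
    (f := fun θ : ℝ => F θ * Complex.exp (-(n * θ * Complex.I))) fun θ _ => by
      rw [norm_mul, norm_exp_neg_int_mul, mul_one]; exact h θ
  have hpi := Real.pi_pos
  rw [sub_zero, abs_of_pos (by positivity)] at h1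
  have h2 : ‖(2 * Real.pi : ℂ)⁻¹‖ = (2 * Real.pi)⁻¹ := by
    rw [norm_inv, norm_mul, Complex.norm_real, Real.norm_eq_abs, abs_of_pos hpi]
    simp
  rw [fourierCoef, norm_mul, h2, inv_mul_le_iff₀ (by positivity)]
  linarith

theorem fourierCoef_deriv {F : ℝ → ℂ} (hF : ContDiff ℝ ∞ F) (hp : Function.Periodic F (2 * Real.pi))
    (n : ℤ) : fourierCoef (deriv F) n = Complex.I * n * fourierCoef F n := by
  have hd : ∀ θ, HasDerivAt (fun θ : ℝ => F θ * Complex.exp (-(n * θ * Complex.I)))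
      (deriv F θ * Complex.exp (-(n * θ * Complex.I)) +
        F θ * (Complex.exp (-(n * θ * Complex.I)) * (-(n * Complex.I)))) θ := by
    intro θ
    have h1 : HasDerivAt (fun θ : ℂ => -(n * θ * Complex.I)) (-(n * 1 * Complex.I)) (θ : ℂ) :=
      ((((hasDerivAt_id _).const_mul _).mul_const _).neg)
    rw [mul_one] at h1
    exact (hF.differentiable (by simp) θ).hasDerivAt.mul h1.cexp.comp_ofReal
  have hcF := hF.continuous
  have hcD : Continuous (deriv F) := hF.continuous_deriv (by simp)
  have h1 := intervalIntegral.integral_eq_sub_of_hasDerivAt (a := 0) (b := 2 * Real.pi)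
    (fun θ _ => hd θ) (by apply Continuous.intervalIntegrable; fun_prop)
  rw [intervalIntegral.integral_add (by apply Continuous.intervalIntegrable; fun_prop)
    (by apply Continuous.intervalIntegrable; fun_prop)] at h1
  have h2 := exp_neg_int_mul_two_pi n 0
  have h3 := hp 0
  rw [zero_add] at h2 h3
  rw [h2, h3, sub_self] at h1
  have h4 : ∫ θ in (0 : ℝ)..(2 * Real.pi),
      F θ * (Complex.exp (-(n * θ * Complex.I)) * (-(n * Complex.I))) =
      (-(n * Complex.I)) * ∫ θ in (0 : ℝ)..(2 * Real.pi), F θ * Complex.exp (-(n * θ * Complex.I)) := by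
    rw [← intervalIntegral.integral_const_mul]
    congr 1
    funext θ
    ring
  rw [h4] at h1
  rw [fourierCoef, fourierCoef]
  linear_combination (2 * Real.pi : ℂ)⁻¹ * h1

theorem contDiff_iteratedDeriv {F : ℝ → ℂ} (hF : ContDiff ℝ ∞ F) (j : ℕ) :
    ContDiff ℝ ∞ (iteratedDeriv j F) := by
  induction j with
  | zero => simpa using hF
  | succ j ih =>
    rw [iteratedDeriv_succ]
    exact (contDiff_infty_iff_deriv.1 ih).2

theorem fourierCoef_iteratedDeriv (f : CInf) (j : ℕ) (n : ℤ) :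
    fourierCoef (iteratedDeriv j f.angular) n = (Complex.I * n) ^ j * fourierCoef f.angular n := by
  induction j with
  | zero => simp
  | succ j ih =>
    rw [iteratedDeriv_succ, fourierCoef_deriv (contDiff_iteratedDeriv f.contDiff_angular j)
      (f.periodic_iteratedDeriv j), ih, pow_succ]
    ring

/-- Two further derivatives buy the summable factor 1/n². -/
theorem norm_fourierCoef_iteratedDeriv_le (f : CInf) (j : ℕ) {n : ℤ} (hn : n ≠ 0) :
    ‖fourierCoef (iteratedDeriv j f.angular) n‖ ≤ 1 / (n : ℝ) ^ 2 * derivSeminorm (j + 2) f := by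
  have h1 := norm_fourierCoef_le (norm_iteratedDeriv_le f (j + 2)) n
  rw [fourierCoef_iteratedDeriv, pow_add, mul_right_comm, ← fourierCoef_iteratedDeriv, norm_mul,
    norm_pow, norm_mul, Complex.norm_I, one_mul, Complex.norm_intCast, sq_abs] at h1
  have h2 : (0 : ℝ) < (n : ℝ) ^ 2 := by positivity
  rw [one_div, ← div_eq_inv_mul, le_div_iff₀ h2]
  exact h1

theorem hasSum_fourierCoef {F : ℝ → ℂ} (hF : Continuous F) (hp : Function.Periodic F (2 * Real.pi))
    (hs : Summable (fourierCoef F)) (θ : ℝ) :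
    HasSum (fun n : ℤ => fourierCoef F n * Complex.exp (n * θ * Complex.I)) (F θ) := by
  have hpi : (0 : ℝ) < 2 * Real.pi := by positivity
  have hpc : (Real.pi : ℂ) ≠ 0 := by exact_mod_cast Real.pi_pos.ne'
  have : Fact (0 < 2 * Real.pi) := ⟨hpi⟩
  have hcont : Continuous (hp.lift : AddCircle (2 * Real.pi) → ℂ) := continuous_quot_lift _ hF
  let G : C(AddCircle (2 * Real.pi), ℂ) := ⟨hp.lift, hcont⟩
  have he : ∀ (n : ℤ) (x : ℝ), fourier n (x : AddCircle (2 * Real.pi)) = Complex.exp (n * x * Complex.I) := by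
    intro n x
    rw [fourier_coe_apply]
    congr 1
    push_cast
    field_simp
  have hc : ∀ n, fourierCoeff G n = fourierCoef F n := by
    intro n
    rw [fourierCoeff_eq_intervalIntegral G n 0, fourierCoef, zero_add, Complex.real_smul]
    congr 1
    · push_cast; rw [one_div]
    · congr 1
      funext x
      rw [he, smul_eq_mul, mul_comm]
      congr 2
      push_cast
      ring
  have h := has_pointwise_sum_fourier_series_of_summable (f := G)
    (by simpa only [funext hc] using hs) (θ : AddCircle (2 * Real.pi))
  simp only [hc, he, smul_eq_mul] at h
  exact h

/-- The character `z ↦ z ^ n`. -/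
def CInf.char (n : ℤ) : CInf :=
  CInf.mk (fun z => (z : ℂ) ^ n) <| contMDiff_of_contDiffAt (F := fun z => z ^ n) fun z hz => by
    have hz0 : z ≠ 0 := norm_ne_zero_iff.1 (by rw [hz]; exact one_ne_zero)
    rcases n with m | m
    · simp only [Int.ofNat_eq_natCast, zpow_natCast]
      exact contDiffAt_id.pow m
    · simp only [zpow_negSucc]
      exact (contDiffAt_id.pow (m + 1)).inv (pow_ne_zero _ hz0)

@[simp] theorem CInf.char_apply (n : ℤ) (z : Circle) : CInf.char n z = (z : ℂ) ^ n := rfl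

theorem CInf.char_angular (n : ℤ) : (CInf.char n).angular = fun θ : ℝ => Complex.exp (n * θ * Complex.I) := by
  funext θ
  rw [CInf.angular, CInf.char_apply, Circle.coe_exp, ← Complex.exp_int_mul, mul_assoc]

theorem iteratedDeriv_char (n : ℤ) (j : ℕ) (θ : ℝ) :
    iteratedDeriv j (CInf.char n).angular θ = (Complex.I * n) ^ j * Complex.exp (n * θ * Complex.I) := by
  rw [CInf.char_angular]
  induction j generalizing θ with
  | zero => simp
  | succ j ih =>
    rw [iteratedDeriv_succ, funext ih]
    have h1 : HasDerivAt (fun θ : ℂ => (n : ℂ) * θ * Complex.I) (n * 1 * Complex.I) (θ : ℂ) :=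
      ((hasDerivAt_id _).const_mul _).mul_const _
    rw [(h1.cexp.comp_ofReal.const_mul ((Complex.I * n) ^ j)).deriv]
    ring

/-- The symmetric partial sums of the Fourier series. -/
def fourierSum (f : CInf) (N : ℕ) : CInf :=
  ∑ n ∈ Finset.Icc (-(N : ℤ)) N, fourierCoef f.angular n • CInf.char n

theorem iteratedDeriv_angular_sum {ι : Type*} (s : Finset ι) (c : ι → ℂ) (g : ι → CInf) (j : ℕ) (θ : ℝ) :
    iteratedDeriv j (∑ i ∈ s, c i • g i).angular θ = ∑ i ∈ s, c i * iteratedDeriv j (g i).angular θ := by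
  classical
  induction s using Finset.induction_on with
  | empty =>
    rw [Finset.sum_empty, Finset.sum_empty]
    have h0 : (0 : CInf).angular = fun _ => 0 := rfl
    rw [h0]
    simp
  | insert a s ha ih =>
    rw [Finset.sum_insert ha, Finset.sum_insert ha, ← ih]
    have h1 : iteratedDeriv j (c a • g a).angular θ = c a * iteratedDeriv j (g a).angular θ :=
      iteratedDeriv_const_mul_field (c a) (g a).angular
    rw [← h1]
    exact iteratedDeriv_fun_add ((c a • g a).contDiff_angular.contDiffAt.of_le (by exact_mod_cast le_top))
      ((∑ i ∈ s, c i • g i).contDiff_angular.contDiffAt.of_le (by exact_mod_cast le_top))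

/-- The tail `∑_{|n| > N} 1 / n²`. -/
def fourierTail (N : ℕ) : ℝ :=
  ∑' n : {n : ℤ // n ∉ Finset.Icc (-(N : ℤ)) N}, 1 / (n.1 : ℝ) ^ 2

theorem fourierTail_nonneg (N : ℕ) : 0 ≤ fourierTail N := tsum_nonneg fun n => by positivity

theorem tendsto_fourierTail : Tendsto fourierTail atTop (𝓝 0) :=
  (tendsto_tsum_compl_atTop_zero fun n : ℤ => 1 / (n : ℝ) ^ 2).comp
    (Finset.tendsto_Icc_neg (R := ℤ))

/-- The rate of convergence depends on f only through one seminorm with two more derivatives. This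
makes the Fourier series converge uniformly along tempered families. -/
theorem derivSeminorm_sub_fourierSum_le (f : CInf) (N j : ℕ) :
    derivSeminorm j (f - fourierSum f N) ≤ fourierTail N * derivSeminorm (j + 2) f := by
  refine derivSeminorm_le fun θ => ?_
  set s := Finset.Icc (-(N : ℤ)) N with hs
  set F := iteratedDeriv j f.angular with hF
  set P := derivSeminorm (j + 2) f
  have hsq : Summable fun n : ℤ => 1 / (n : ℝ) ^ 2 := Real.summable_one_div_int_pow.2 one_lt_two
  have hsum : Summable (fourierCoef F) := by
    refine Summable.of_norm_bounded_eventually (hsq.mul_right P) ?_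
    filter_upwards [(Set.finite_singleton (0 : ℤ)).compl_mem_cofinite] with n hn
    exact norm_fourierCoef_iteratedDeriv_le f j hn
  have hmain := hasSum_fourierCoef (contDiff_iteratedDeriv f.contDiff_angular j).continuous
    (f.periodic_iteratedDeriv j) hsum θ
  have hS : iteratedDeriv j (fourierSum f N).angular θ =
      ∑ n ∈ s, fourierCoef F n * Complex.exp (n * θ * Complex.I) := by
    rw [fourierSum, iteratedDeriv_angular_sum]
    refine Finset.sum_congr rfl fun n _ => ?_
    rw [iteratedDeriv_char, hF, fourierCoef_iteratedDeriv]
    ring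
  have htail := hmain.summable.sum_add_tsum_compl (s := s)
  rw [hmain.tsum_eq] at htail
  rw [iteratedDeriv_angular_sub, hS, ← htail, add_sub_cancel_left]
  have hT : HasSum (fun n : {n : ℤ // n ∉ s} => 1 / (n.1 : ℝ) ^ 2 * P) (fourierTail N * P) :=
    (hsq.subtype _).hasSum.mul_right P
  refine tsum_of_norm_bounded (f := fun n : {n : ℤ // n ∉ s} =>
    fourierCoef F n * Complex.exp ((n : ℤ) * θ * Complex.I)) hT fun n => ?_
  have hn : n.1 ≠ 0 := by
    rintro h
    exact n.2 (by rw [h, hs]; simp)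
  have h1 : ‖Complex.exp ((n : ℤ) * θ * Complex.I)‖ = 1 := by
    have := norm_exp_neg_int_mul (-n.1) θ
    simpa using this
  rw [norm_mul, h1, mul_one]
  exact norm_fourierCoef_iteratedDeriv_le f j hn

theorem exists_cNorm_bound (l : CInf →ₗ[ℂ] ℂ) (hl : Continuous l) :
    ∃ (N : ℕ) (C : ℝ), 0 ≤ C ∧ ∀ f, ‖l f‖ ≤ C * cNorm N f := by
  obtain ⟨s, C, -, h⟩ := Seminorm.bound_of_continuous withSeminorms_cNorm
    ((normSeminorm ℂ ℂ).comp l) hl.norm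
  refine ⟨s.sup id, C, C.2, fun f => (h f).trans ?_⟩
  refine mul_le_mul_of_nonneg_left ?_ C.2
  refine Seminorm.finset_sup_apply_le (apply_nonneg _ _) fun i hi => ?_
  exact cNorm_mono (Finset.le_sup (f := id) hi) f

theorem norm_sub_fourierSum_le (l : CInf →ₗ[ℂ] ℂ) (hl : Continuous l) :
    ∃ (M : ℕ) (C : ℝ), 0 ≤ C ∧ ∀ (f : CInf) (N : ℕ), ‖l f - ∑ n ∈ Finset.Icc (-(N : ℤ)) N,
      fourierCoef f.angular n * l (CInf.char n)‖ ≤ C * fourierTail N * cNorm M f := by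
  obtain ⟨K, C, hC, h⟩ := exists_cNorm_bound l hl
  refine ⟨K + 2, C, hC, fun f N => ?_⟩
  have h1 : l f - ∑ n ∈ Finset.Icc (-(N : ℤ)) N, fourierCoef f.angular n * l (CInf.char n) =
      l (f - fourierSum f N) := by
    simp [fourierSum]
  rw [h1, mul_assoc]
  refine (h _).trans (mul_le_mul_of_nonneg_left ?_ hC)
  rw [cNorm_apply]
  calc _ ≤ ∑ j ∈ Finset.range (K + 1), fourierTail N * derivSeminorm (j + 2) f :=
        Finset.sum_le_sum fun j _ => derivSeminorm_sub_fourierSum_le f N j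
    _ = fourierTail N * ∑ j ∈ Finset.range (K + 1), derivSeminorm (j + 2) f := by
        rw [Finset.mul_sum]
    _ ≤ fourierTail N * cNorm (K + 2) f := by
        refine mul_le_mul_of_nonneg_left ?_ (fourierTail_nonneg N)
        have e1 := Finset.sum_range_succ' (fun j => derivSeminorm j f) (K + 2)
        have e2 := Finset.sum_range_succ' (fun j => derivSeminorm (j + 1) f) (K + 1)
        rw [cNorm_apply, e1, e2, add_assoc]
        exact le_add_of_nonneg_right (add_nonneg (apply_nonneg _ _) (apply_nonneg _ _))

theorem hasLimit_fourier (l : CInf →ₗ[ℂ] ℂ) (hl : Continuous l) (f : CInf) :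
    Tendsto (fun N : ℕ => ∑ n ∈ Finset.Icc (-(N : ℤ)) N,
      fourierCoef f.angular n * l (CInf.char n)) atTop (𝓝 (l f)) := by
  obtain ⟨M, C, hC, h⟩ := norm_sub_fourierSum_le l hl
  rw [tendsto_iff_norm_sub_tendsto_zero]
  have h1 : Tendsto (fun N => C * fourierTail N * cNorm M f) atTop (𝓝 (C * 0 * cNorm M f)) :=
    (tendsto_fourierTail.const_mul C).mul_const _
  rw [mul_zero, zero_mul] at h1
  refine squeeze_zero (fun _ => norm_nonneg _) (fun N => ?_) h1
  rw [norm_sub_rev]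
  exact h f N

/-- These are exactly the two analytic inputs of `StripPair.of_tendsto`, a growth bound uniform in N
and locally uniform convergence, for the Fourier expansion of l along the family. -/
theorem AngularFamily.fourier_approx {w : ℝ → CInf} (hw : AngularFamily fun t => (w t).angular)
    (l : CInf →ₗ[ℂ] ℂ) (hl : Continuous l) :
    (∃ A : ℝ, ∀ (N : ℕ) (t : ℝ), ‖∑ n ∈ Finset.Icc (-(N : ℤ)) N,
      fourierCoef (w t).angular n * l (CInf.char n)‖ ≤ A * Real.exp (A * t ^ 2)) ∧
    TendstoLocallyUniformly (fun (N : ℕ) (t : ℝ) => ∑ n ∈ Finset.Icc (-(N : ℤ)) N,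
      fourierCoef (w t).angular n * l (CInf.char n)) (fun t => l (w t)) atTop := by
  obtain ⟨M, C, hC, h⟩ := norm_sub_fourierSum_le l hl
  obtain ⟨K, C', hC', h'⟩ := exists_cNorm_bound l hl
  obtain ⟨A, hA⟩ := hw.cNorm_bound M
  obtain ⟨B, hB⟩ := hw.cNorm_bound K
  have hA0 : 0 ≤ A := by simpa using (apply_nonneg (cNorm M) (w 0)).trans (hA 0)
  have hB0 : 0 ≤ B := by simpa using (apply_nonneg (cNorm K) (w 0)).trans (hB 0)
  constructor
  · obtain ⟨T, hT⟩ := tendsto_fourierTail.bddAbove_range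
    have hT' : ∀ N, fourierTail N ≤ T := fun N => hT ⟨N, rfl⟩
    have hT0 : 0 ≤ T := (fourierTail_nonneg 0).trans (hT' 0)
    refine ⟨C * T * A + C' * B + (A + B), fun N t => ?_⟩
    have h1 := norm_sub_norm_le (∑ n ∈ Finset.Icc (-(N : ℤ)) N,
      fourierCoef (w t).angular n * l (CInf.char n)) (l (w t))
    rw [norm_sub_rev] at h1
    have h2 := h (w t) N
    have h3 : C * fourierTail N * cNorm M (w t) ≤ C * T * (A * Real.exp (A * t ^ 2)) := by
      have := hT' N
      have := hA t
      have := apply_nonneg (cNorm M) (w t)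
      gcongr
    have h4 : ‖l (w t)‖ ≤ C' * (B * Real.exp (B * t ^ 2)) :=
      (h' _).trans (mul_le_mul_of_nonneg_left (hB t) hC')
    set Q := C * T * A + C' * B + (A + B)
    have hQA : A ≤ Q := by
      have : 0 ≤ C * T * A + C' * B := by positivity
      simp only [Q]; linarith
    have hQB : B ≤ Q := by
      have : 0 ≤ C * T * A + C' * B := by positivity
      simp only [Q]; linarith
    have e1 : Real.exp (A * t ^ 2) ≤ Real.exp (Q * t ^ 2) := by gcongr
    have e2 : Real.exp (B * t ^ 2) ≤ Real.exp (Q * t ^ 2) := by gcongr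
    have h5 : C * T * (A * Real.exp (A * t ^ 2)) ≤ C * T * (A * Real.exp (Q * t ^ 2)) := by gcongr
    have h6 : C' * (B * Real.exp (B * t ^ 2)) ≤ C' * (B * Real.exp (Q * t ^ 2)) := by gcongr
    calc _ ≤ C * T * (A * Real.exp (Q * t ^ 2)) + C' * (B * Real.exp (Q * t ^ 2)) := by linarith
      _ = (C * T * A + C' * B) * Real.exp (Q * t ^ 2) := by ring
      _ ≤ Q * Real.exp (Q * t ^ 2) := by
        refine mul_le_mul_of_nonneg_right ?_ (Real.exp_pos _).le
        simp only [Q]; linarith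
  · have hlw : Continuous fun t => l (w t) := hl.comp hw.continuous_cInf
    refine tendstoLocallyUniformly_of_tendsto_prod hlw fun x => ?_
    have h1 : Tendsto (fun y : ℕ × ℝ => l (w y.2)) (atTop ×ˢ 𝓝 x) (𝓝 (l (w x))) :=
      (hlw.tendsto x).comp tendsto_snd
    have h2 : Tendsto (fun y : ℕ × ℝ => l (w y.2) - ∑ n ∈ Finset.Icc (-(y.1 : ℤ)) y.1,
        fourierCoef (w y.2).angular n * l (CInf.char n)) (atTop ×ˢ 𝓝 x) (𝓝 0) := by
      have h3 : Tendsto (fun y : ℕ × ℝ => C * fourierTail y.1 * (A * Real.exp (A * y.2 ^ 2)))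
          (atTop ×ˢ 𝓝 x) (𝓝 (C * 0 * (A * Real.exp (A * x ^ 2)))) := by
        refine ((tendsto_fourierTail.comp tendsto_fst).const_mul C).mul ?_
        have hc : Continuous fun t : ℝ => A * Real.exp (A * t ^ 2) := by fun_prop
        exact (hc.tendsto x).comp tendsto_snd
      rw [mul_zero, zero_mul] at h3
      refine squeeze_zero_norm (fun y => (h _ _).trans ?_) h3
      exact mul_le_mul_of_nonneg_left (hA y.2) (mul_nonneg hC (fourierTail_nonneg _))
    simpa using h1.sub h2

end MobiusCFT
end

noncomputable section
namespace MobiusCFT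
open MeasureTheory Filter Topology

/-! ## Parametrization of the upper semicircle by the flow `v` -/

/-- The angle `2 arctan (e^u)` of the point of the upper semicircle with parameter `u`. -/
def arcAngle (u : ℝ) : ℝ := 2 * Real.arctan (Real.exp u)

/-- The point of the upper semicircle with parameter `u`. -/
def arcPoint (u : ℝ) : Circle := Circle.exp (arcAngle u)

theorem one_sub_ofReal_mul_I_ne_zero (y : ℝ) : (1 - y * Complex.I : ℂ) ≠ 0 := fun h => by
  simpa using congrArg Complex.re h

theorem one_add_ofReal_mul_I_ne_zero (y : ℝ) : (1 + y * Complex.I : ℂ) ≠ 0 := fun h => by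
  simpa using congrArg Complex.re h

theorem coe_arcPoint (u : ℝ) :
    (arcPoint u : ℂ) = (1 + Real.exp u * Complex.I) / (1 - Real.exp u * Complex.I) := by
  rw [eq_div_iff (one_sub_ofReal_mul_I_ne_zero _), arcPoint, Circle.coe_exp, arcAngle]
  rw [← exp_arctan_sq_mul, ← Complex.exp_nat_mul]
  congr 2
  push_cast
  ring

theorem hasDerivAt_arcAngle (u : ℝ) : HasDerivAt arcAngle (Real.cosh u)⁻¹ u := by
  refine ((Real.hasDerivAt_exp u).arctan.const_mul 2).congr_deriv ?_
  rw [Real.cosh_eq, Real.exp_neg]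
  have := Real.exp_pos u
  field_simp
  ring

theorem injective_arcAngle : Function.Injective arcAngle := fun a b h => by
  simpa [arcAngle, Real.arctan_inj] using h

theorem range_arcAngle : Set.range arcAngle = Set.Ioo 0 Real.pi := by
  ext θ
  constructor
  · rintro ⟨u, rfl⟩
    have h1 := Real.arctan_pos.2 (Real.exp_pos u)
    have h2 := Real.arctan_lt_pi_div_two (Real.exp u)
    simp only [arcAngle, Set.mem_Ioo]
    constructor <;> linarith
  · rintro ⟨h0, h1⟩
    have ht : 0 < Real.tan (θ / 2) := Real.tan_pos_of_pos_of_lt_pi_div_two (by linarith) (by linarith)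
    refine ⟨Real.log (Real.tan (θ / 2)), ?_⟩
    rw [arcAngle, Real.exp_log ht, Real.arctan_tan (by linarith) (by linarith)]
    ring

theorem cosh_mul_cexp (u : ℝ) : (Real.cosh u : ℂ) * (2 * Real.exp u) =
    (1 + Real.exp u * Complex.I) * (1 - Real.exp u * Complex.I) := by
  have h : Real.cosh u * (2 * Real.exp u) = 1 + Real.exp u ^ 2 := by
    rw [Real.cosh_eq, Real.exp_neg]
    have := (Real.exp_pos u).ne'
    field_simp
    ring
  have h' : (Real.cosh u : ℂ) * (2 * Real.exp u) = 1 + (Real.exp u : ℂ) ^ 2 := by exact_mod_cast h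
  rw [h']
  linear_combination (Real.exp u : ℂ) ^ 2 * Complex.I_mul_I

theorem sin_arcAngle (u : ℝ) : Real.sin (arcAngle u) = (Real.cosh u)⁻¹ := by
  rw [arcAngle, Real.sin_two_mul, Real.sin_arctan, Real.cos_arctan, Real.cosh_eq, Real.exp_neg]
  have h := Real.exp_pos u
  have h3 : Real.sqrt (1 + Real.exp u ^ 2) ≠ 0 := (Real.sqrt_pos.2 (by positivity)).ne'
  field_simp
  rw [Real.sq_sqrt (by positivity)]
  ring

theorem cos_arcAngle (u : ℝ) : Real.cos (arcAngle u) = -(Real.sinh u / Real.cosh u) := by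
  rw [arcAngle, Real.cos_two_mul, Real.cos_sq_arctan, Real.cosh_eq, Real.sinh_eq, Real.exp_neg]
  have h := Real.exp_pos u
  field_simp
  ring

theorem arcPoint_im (u : ℝ) : (arcPoint u : ℂ).im = (Real.cosh u)⁻¹ := by
  rw [arcPoint, Circle.coe_exp, Complex.exp_ofReal_mul_I_im, sin_arcAngle]

theorem arcPoint_re (u : ℝ) : (arcPoint u : ℂ).re = -(Real.sinh u / Real.cosh u) := by
  rw [arcPoint, Circle.coe_exp, Complex.exp_ofReal_mul_I_re, cos_arcAngle]

theorem continuous_arcPoint : Continuous arcPoint :=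
  Circle.exp.continuous.comp (continuous_iff_continuousAt.2 fun u => (hasDerivAt_arcAngle u).continuousAt)

/-- In the Cayley coordinate e^u = tan(angle/2) the map v_{-t} is multiplication by e^{-t}, hence
translation in u. -/
theorem v_neg_arcPoint (t u : ℝ) :
    ((v (-t) : Mob) : Equiv.Perm Circle) (arcPoint u) = arcPoint (u - t) := by
  apply Circle.ext
  have hne := sinh_mul_add_cosh_ne_zero t (arcPoint u)
  have hd := one_sub_ofReal_mul_I_ne_zero (Real.exp u)
  have hd2 := one_sub_ofReal_mul_I_ne_zero (Real.exp (u - t))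
  rw [coe_v_neg_apply]
  rw [coe_arcPoint] at hne ⊢
  rw [coe_arcPoint, div_eq_div_iff hne hd2]
  have e1 : (Real.exp (u - t) : ℂ) * (Real.cosh (t / 2) + Real.sinh (t / 2)) =
      Real.exp u * (Real.cosh (t / 2) - Real.sinh (t / 2)) := by
    have : Real.exp (u - t) * (Real.cosh (t / 2) + Real.sinh (t / 2)) =
        Real.exp u * (Real.cosh (t / 2) - Real.sinh (t / 2)) := by
      rw [Real.cosh_add_sinh, Real.cosh_sub_sinh, ← Real.exp_add, ← Real.exp_add]
      congr 1; ring
    exact_mod_cast this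
  have hI := Complex.I_mul_I
  field_simp
  linear_combination (-2 * Complex.I) * e1

theorem beta_v_arcPoint (d : ℕ) (t u : ℝ) (f : CInf) :
    beta d (v t) f (arcPoint u) =
      ((Real.cosh (u - t) / Real.cosh u : ℝ) : ℂ) ^ ((d : ℤ) - 1) * f (arcPoint (u - t)) := by
  rw [beta_v_apply, v_neg_arcPoint, arcPoint_re, Real.cosh_sub]
  congr 4
  have := (Real.cosh_pos u).ne'
  field_simp
  ring

/-! ### Fourier coefficients as integrals over the flow parameter. -/

theorem fourierCoef_eq_integral_arc (h : CInf) (h0 : ∀ z : Circle, (z : ℂ).im ≤ 0 → h z = 0) (n : ℤ) :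
    fourierCoef h.angular n = (2 * Real.pi : ℂ)⁻¹ *
      ∫ u : ℝ, ((Real.cosh u)⁻¹ : ℝ) * (h (arcPoint u) * (arcPoint u : ℂ) ^ (-n)) := by
  have hpi := Real.pi_pos
  rw [fourierCoef]
  congr 1
  rw [intervalIntegral.integral_of_le (by positivity)]
  have hset : Set.Ioo 0 Real.pi ⊆ Set.Ioc 0 (2 * Real.pi) := fun θ hθ => ⟨hθ.1, by linarith [hθ.2]⟩
  rw [setIntegral_eq_of_subset_of_forall_sdiff_eq_zero measurableSet_Ioc hset]
  · rw [← range_arcAngle, ← Set.image_univ, integral_image_eq_integral_abs_deriv_smul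
      MeasurableSet.univ (fun u _ => (hasDerivAt_arcAngle u).hasDerivWithinAt)
      injective_arcAngle.injOn, setIntegral_univ]
    refine integral_congr_ae (Eventually.of_forall fun u => ?_)
    simp only
    rw [abs_of_pos (inv_pos.2 (Real.cosh_pos u)), Complex.real_smul]
    congr 2
    rw [arcPoint, Circle.coe_exp, ← Complex.exp_int_mul]
    congr 1
    push_cast
    ring
  · rintro θ ⟨⟨hθ0, hθ1⟩, hθ2⟩
    have hθ3 : Real.pi ≤ θ := by
      by_contra! hlt
      exact hθ2 ⟨hθ0, hlt⟩
    have hs : Real.sin θ ≤ 0 := by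
      have h1 := Real.sin_nonneg_of_nonneg_of_le_pi (x := θ - Real.pi) (by linarith) (by linarith)
      rw [Real.sin_sub_pi] at h1
      linarith
    rw [CInf.angular, h0 _ (by rw [Circle.coe_exp, Complex.exp_ofReal_mul_I_im]; exact hs), zero_mul]

theorem v_neg_im (t : ℝ) (z : Circle) :
    ((((v (-t) : Mob) : Equiv.Perm Circle) z : ℂ)).im * (Real.cosh t + Real.sinh t * (z : ℂ).re) =
      (z : ℂ).im := by
  have hne := sinh_mul_add_cosh_ne_zero t z
  have hsq : (z : ℂ).re * (z : ℂ).re + (z : ℂ).im * (z : ℂ).im = 1 := by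
    rw [← Complex.normSq_apply, Circle.normSq_coe]
  have hn : Complex.normSq (Real.sinh (t / 2) * z + Real.cosh (t / 2) : ℂ) =
      Real.cosh t + Real.sinh t * (z : ℂ).re := by
    rw [cosh_eq_half t, sinh_eq_half t, Complex.normSq_apply]
    simp only [Complex.add_re, Complex.add_im, Complex.re_ofReal_mul, Complex.im_ofReal_mul,
      Complex.ofReal_re, Complex.ofReal_im]
    linear_combination Real.sinh (t / 2) ^ 2 * hsq
  have hn0 : Complex.normSq (Real.sinh (t / 2) * z + Real.cosh (t / 2) : ℂ) ≠ 0 :=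
    (map_ne_zero Complex.normSq).2 hne
  rw [← hn, coe_v_neg_apply, Complex.div_im]
  have hcs : Real.cosh (t / 2) ^ 2 = Real.sinh (t / 2) ^ 2 + 1 := Real.cosh_sq _
  rw [sub_mul, div_mul_cancel₀ _ hn0, div_mul_cancel₀ _ hn0]
  simp only [Complex.add_re, Complex.add_im, Complex.re_ofReal_mul, Complex.im_ofReal_mul,
      Complex.ofReal_re, Complex.ofReal_im]
  linear_combination (z : ℂ).im * hcs

theorem v_neg_im_pos (t : ℝ) (z : Circle) :
    0 < ((((v (-t) : Mob) : Equiv.Perm Circle) z : ℂ)).im ↔ 0 < (z : ℂ).im := by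
  have hq := cosh_add_sinh_mul_pos t (z : ℂ).re
    ((Complex.abs_re_le_norm (z : ℂ)).trans_eq z.norm_coe)
  rw [← v_neg_im t z, mul_pos_iff_of_pos_right hq]

/-- The function `F(u)` of compact support which represents `f` in the parameter `u`. -/
def arcFun (d : ℕ) (f : CInf) (u : ℝ) : ℂ := f (arcPoint u) * (Real.cosh u : ℂ) ^ ((d : ℤ) - 1)

theorem CInf.continuous (f : CInf) : Continuous f := f.contMDiff.continuous

theorem continuous_arcFun (d : ℕ) (f : CInf) : Continuous (arcFun d f) := by
  refine (f.continuous.comp continuous_arcPoint).mul (Continuous.zpow₀ (by fun_prop) _ fun u => Or.inl ?_)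
  exact_mod_cast (Real.cosh_pos u).ne'

theorem hasCompactSupport_arcFun (d : ℕ) {f : CInf} (hf : tsupport f ⊆ upperArc) :
    HasCompactSupport (arcFun d f) := by
  -- The compact support keeps a distance δ from the real axis. As the imaginary part at parameter u
  -- is 1/cosh u, this bounds cosh u and therefore |u|.
  obtain ⟨δ, hδ, hle⟩ : ∃ δ > 0, ∀ z ∈ tsupport f, δ ≤ (z : ℂ).im := by
    rcases (tsupport f).eq_empty_or_nonempty with he | hne
    · exact ⟨1, one_pos, fun z hz => by simp [he] at hz⟩
    · obtain ⟨z₀, hz₀, hmin⟩ := (isClosed_tsupport f).isCompact.exists_isMinOn hne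
        (f := fun z : Circle => (z : ℂ).im) (by fun_prop)
      exact ⟨_, hf hz₀, fun z hz => hmin hz⟩
  refine HasCompactSupport.intro (isCompact_Icc (a := -δ⁻¹) (b := δ⁻¹)) fun u hu => ?_
  have hz : arcPoint u ∉ tsupport f := fun hz => hu <| by
    have h1 := hle _ hz
    rw [arcPoint_im, le_inv_comm₀ hδ (Real.cosh_pos u)] at h1
    rw [Set.mem_Icc, ← abs_le]
    rw [← Real.cosh_abs] at h1
    have h2 := Real.add_one_le_exp |u|
    have h3 : |u| ≤ Real.cosh |u| :=
      (Real.self_le_sinh_iff.2 (abs_nonneg u)).trans (Real.sinh_lt_cosh _).le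
    linarith
  rw [arcFun, image_eq_zero_of_notMem_tsupport hz, zero_mul]

/-- After the translation u ↦ u + t all dependence on t sits in the kernel. The conformal factor
contributes cosh(u+t)^{1-d} and the measure one more inverse cosh, in total cosh(u+t)^{-d}. -/
theorem fourierCoef_beta (d : ℕ) (t : ℝ) {f : CInf} (hf : tsupport f ⊆ upperArc) (n : ℤ) :
    fourierCoef (beta d (v t) f).angular n = (2 * Real.pi : ℂ)⁻¹ *
      ∫ u : ℝ, arcFun d f u * ((Real.cosh (u + t) : ℂ)⁻¹ ^ d * (arcPoint (u + t) : ℂ) ^ (-n)) := by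
  rw [fourierCoef_eq_integral_arc]
  · congr 1
    rw [← integral_add_right_eq_self (μ := volume) _ t]
    refine integral_congr_ae (Eventually.of_forall fun u => ?_)
    simp only [beta_v_arcPoint, add_sub_cancel_right, arcFun]
    have h1 : (Real.cosh (u + t) : ℂ) ≠ 0 := by exact_mod_cast (Real.cosh_pos _).ne'
    rw [Complex.ofReal_div, div_zpow, Complex.ofReal_inv, zpow_sub_one₀ h1, zpow_natCast, inv_pow]
    field_simp
  · intro z hz
    rw [beta_v_apply]
    have h1 : ((v (-t) : Mob) : Equiv.Perm Circle) z ∉ tsupport f := fun h => by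
      have h2 := (v_neg_im_pos t z).1 (hf h)
      linarith
    rw [image_eq_zero_of_notMem_tsupport h1, mul_zero]

/-- The analytic continuation of `u ↦ z(u)^m cosh(u)^{-d}`, where `m = k + d`. -/
def arcKernel (k d : ℕ) (ζ : ℂ) : ℂ :=
  (1 + Complex.exp ζ * Complex.I) ^ k * (2 * Complex.exp ζ) ^ d /
    (1 - Complex.exp ζ * Complex.I) ^ (k + 2 * d)

theorem arcKernel_ofReal (k d : ℕ) (u : ℝ) :
    arcKernel k d u = (Real.cosh u : ℂ)⁻¹ ^ d * (arcPoint u : ℂ) ^ (k + d) := by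
  have h1 := one_sub_ofReal_mul_I_ne_zero (Real.exp u)
  have h2 := one_add_ofReal_mul_I_ne_zero (Real.exp u)
  have hE : (Real.exp u : ℂ) ≠ 0 := by exact_mod_cast (Real.exp_pos u).ne'
  have hc : (Real.cosh u : ℂ)⁻¹ = 2 * Real.exp u /
      ((1 + Real.exp u * Complex.I) * (1 - Real.exp u * Complex.I)) := by
    rw [← cosh_mul_cexp]
    have : (Real.cosh u : ℂ) ≠ 0 := by exact_mod_cast (Real.cosh_pos u).ne'
    field_simp
  rw [hc, coe_arcPoint, arcKernel, ← Complex.ofReal_exp]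
  generalize (1 + Real.exp u * Complex.I : ℂ) = a at *
  generalize (1 - Real.exp u * Complex.I : ℂ) = b at *
  rw [div_pow, div_pow, div_mul_div_comm, div_eq_div_iff (by positivity) (by positivity)]
  ring

/-- Since exp(u + iπ) = -e^u, the factors 1 ± i e^u are interchanged, which inverts the point of the
circle. The factor (2e^ζ)^d yields the sign (-1)^d of the PCT relation. -/
theorem arcKernel_add_pi (k d : ℕ) (u : ℝ) :
    arcKernel k d (u + Real.pi * Complex.I) =
      (-1) ^ d * ((Real.cosh u : ℂ)⁻¹ ^ d * (arcPoint u : ℂ)⁻¹ ^ (k + d)) := by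
  have h1 := one_sub_ofReal_mul_I_ne_zero (Real.exp u)
  have h2 := one_add_ofReal_mul_I_ne_zero (Real.exp u)
  have hE : (Real.exp u : ℂ) ≠ 0 := by exact_mod_cast (Real.exp_pos u).ne'
  have hc : (Real.cosh u : ℂ)⁻¹ = 2 * Real.exp u /
      ((1 + Real.exp u * Complex.I) * (1 - Real.exp u * Complex.I)) := by
    rw [← cosh_mul_cexp]
    have : (Real.cosh u : ℂ) ≠ 0 := by exact_mod_cast (Real.cosh_pos u).ne'
    field_simp
  have hx : Complex.exp (u + Real.pi * Complex.I) = -(Real.exp u : ℂ) := by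
    rw [Complex.exp_add, Complex.exp_pi_mul_I, Complex.ofReal_exp]; ring
  rw [hc, coe_arcPoint, arcKernel, hx, inv_div, neg_mul, sub_neg_eq_add, ← sub_eq_add_neg, mul_neg,
    neg_pow (2 * _) d]
  generalize (1 + Real.exp u * Complex.I : ℂ) = a at *
  generalize (1 - Real.exp u * Complex.I : ℂ) = b at *
  rw [div_pow, div_pow, div_mul_div_comm, ← mul_div_assoc,
    div_eq_div_iff (by positivity) (by positivity)]
  ring

/-- On the strip w = e^ζ has Im w ≥ 0, and |1 ∓ iw|² = 1 + |w|² ± 2 Im w. Thus the pole is avoided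
and the Cayley transform maps into the closed unit disc. -/
theorem arcKernel_bounds {ζ : ℂ} (hζ : ζ ∈ closedStrip) :
    1 + ‖Complex.exp ζ‖ ^ 2 ≤ ‖1 - Complex.exp ζ * Complex.I‖ ^ 2 ∧
      ‖1 + Complex.exp ζ * Complex.I‖ ≤ ‖1 - Complex.exp ζ * Complex.I‖ := by
  have him : 0 ≤ (Complex.exp ζ).im := by
    rw [Complex.exp_im]
    exact mul_nonneg (Real.exp_pos _).le (Real.sin_nonneg_of_nonneg_of_le_pi hζ.1 hζ.2)
  have e0 := Complex.sq_norm (Complex.exp ζ)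
  have e1 := Complex.sq_norm (1 - Complex.exp ζ * Complex.I)
  have e2 := Complex.sq_norm (1 + Complex.exp ζ * Complex.I)
  rw [Complex.normSq_apply] at e0 e1 e2
  simp only [Complex.sub_re, Complex.one_re, Complex.mul_re, Complex.I_re, mul_zero, Complex.I_im,
    mul_one, zero_sub, sub_neg_eq_add, Complex.sub_im, Complex.one_im, Complex.mul_im, add_zero,
    Complex.add_re, Complex.add_im, zero_add] at e1 e2
  constructor
  · nlinarith
  · refine (sq_le_sq₀ (norm_nonneg _) (norm_nonneg _)).1 ?_
    nlinarith

theorem one_sub_exp_mul_I_ne_zero {ζ : ℂ} (hζ : ζ ∈ closedStrip) :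
    (1 - Complex.exp ζ * Complex.I : ℂ) ≠ 0 := by
  intro h
  have h1 := (arcKernel_bounds hζ).1
  rw [h, norm_zero] at h1
  nlinarith [sq_nonneg ‖Complex.exp ζ‖]

theorem norm_arcKernel_le (k d : ℕ) {ζ : ℂ} (hζ : ζ ∈ closedStrip) : ‖arcKernel k d ζ‖ ≤ 1 := by
  obtain ⟨h1, h2⟩ := arcKernel_bounds hζ
  have h3 : 0 < ‖1 - Complex.exp ζ * Complex.I‖ := norm_pos_iff.2 (one_sub_exp_mul_I_ne_zero hζ)
  rw [arcKernel, norm_div, norm_mul, norm_pow, norm_pow, norm_pow, norm_mul, Complex.norm_ofNat,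
    div_le_one (by positivity), pow_add, pow_mul]
  have h4 : 2 * ‖Complex.exp ζ‖ ≤ ‖1 - Complex.exp ζ * Complex.I‖ ^ 2 := by
    nlinarith [sq_nonneg (‖Complex.exp ζ‖ - 1)]
  gcongr

theorem differentiableAt_arcKernel (k d : ℕ) {ζ : ℂ} (hζ : ζ ∈ closedStrip) :
    DifferentiableAt ℂ (arcKernel k d) ζ := by
  unfold arcKernel
  exact DifferentiableAt.div (by fun_prop) (by fun_prop) (pow_ne_zero _ (one_sub_exp_mul_I_ne_zero hζ))

theorem ofReal_add_mem_closedStrip {z : ℂ} (hz : z ∈ closedStrip) (u : ℝ) : (u + z : ℂ) ∈ closedStrip := by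
  simpa [closedStrip] using hz

theorem stripPair_integral_arcKernel (k d : ℕ) {F : ℝ → ℂ} (hF : Continuous F) (hs : HasCompactSupport F) :
    StripPair (fun t => ∫ u : ℝ, F u * arcKernel k d ((u + t : ℝ) : ℂ))
      fun t => ∫ u : ℝ, F u * arcKernel k d ((u + t : ℝ) + Real.pi * Complex.I) := by
  have hFi : Integrable fun u => ‖F u‖ := (hF.integrable_of_hasCompactSupport hs).norm
  have hbd : ∀ z ∈ closedStrip, ∀ u : ℝ, ‖F u * arcKernel k d (u + z)‖ ≤ ‖F u‖ := fun z hz u => by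
    rw [norm_mul]
    exact mul_le_of_le_one_right (norm_nonneg _) (norm_arcKernel_le k d (ofReal_add_mem_closedStrip hz u))
  have hmeas : ∀ z ∈ closedStrip, AEStronglyMeasurable (fun u : ℝ => F u * arcKernel k d (u + z)) := by
    intro z hz
    refine (hF.mul (continuous_iff_continuousAt.2 fun u => ?_)).aestronglyMeasurable
    exact ContinuousAt.comp (f := fun u : ℝ => (u + z : ℂ))
      (differentiableAt_arcKernel k d (ofReal_add_mem_closedStrip hz u)).continuousAt (by fun_prop)
  have hdiff : ∀ u : ℝ, ∀ z ∈ closedStrip,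
      DifferentiableAt ℂ (fun z => F u * arcKernel k d (u + z)) z := fun u z hz =>
    (DifferentiableAt.comp z (f := fun z : ℂ => (u + z : ℂ))
      (differentiableAt_arcKernel k d (ofReal_add_mem_closedStrip hz u)) (by fun_prop)).const_mul _
  refine ⟨fun z => ∫ u : ℝ, F u * arcKernel k d (u + z), ?_, ?_, ⟨∫ u, ‖F u‖, fun z hz => ?_⟩,
    fun t => by push_cast; rfl, fun t => by push_cast; simp only [add_assoc]⟩
  · exact continuousOn_of_dominated hmeas (fun z hz => Eventually.of_forall (hbd z hz)) hFi
      (Eventually.of_forall fun u z hz => (hdiff u z hz).continuousAt.continuousWithinAt)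
  · refine differentiableOn_integral_of_dominated isOpen_openStrip
      (fun z hz => hmeas z (openStrip_subset_closedStrip hz))
      (fun u z hz => (hdiff u z (openStrip_subset_closedStrip hz)).differentiableWithinAt)
      fun z₀ hz₀ => ?_
    obtain ⟨r, hr, hsub⟩ := Metric.isOpen_iff.1 isOpen_openStrip z₀ hz₀
    exact ⟨r, hr, _, hFi, fun z hz u => hbd z (openStrip_subset_closedStrip (hsub hz)) u⟩
  · have h0 : 0 ≤ ∫ u, ‖F u‖ := integral_nonneg fun u => norm_nonneg _
    refine (norm_integral_le_of_norm_le hFi (Eventually.of_forall (hbd z hz))).trans ?_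
    exact le_mul_of_one_le_right h0 (Real.one_le_exp (by positivity))

/-- The coefficients of v_t are real, so it commutes with complex conjugation, which is inversion on
the circle. -/
theorem beta_v_reflect (d : ℕ) (t : ℝ) (f : CInf) :
    beta d (v t) f.reflect = (beta d (v t) f).reflect := by
  ext z
  have h1 : ((v (-t) : Mob) : Equiv.Perm Circle) z⁻¹ = (((v (-t) : Mob) : Equiv.Perm Circle) z)⁻¹ := by
    apply Circle.ext
    have h2 := sinh_mul_add_cosh_ne_zero t z
    have h3 := sinh_mul_add_cosh_ne_zero t z⁻¹
    have hz := z.coe_ne_zero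
    rw [Circle.coe_inv, coe_v_neg_apply, coe_v_neg_apply, inv_div, Circle.coe_inv]
    rw [Circle.coe_inv] at h3
    have h4 : (Real.cosh (t / 2) * z + Real.sinh (t / 2) : ℂ) ≠ 0 := by
      have : (Real.cosh (t / 2) * z + Real.sinh (t / 2) : ℂ) =
          z * (Real.sinh (t / 2) * (z : ℂ)⁻¹ + Real.cosh (t / 2)) := by field_simp; ring
      rw [this]
      exact mul_ne_zero hz h3
    rw [div_eq_div_iff h3 h4]
    field_simp
    ring
  have h2 : ((z⁻¹ : Circle) : ℂ).re = (z : ℂ).re := by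
    rw [Circle.coe_inv_eq_conj, Complex.conj_re]
  rw [beta_v_apply, CInf.reflect_apply, CInf.reflect_apply, beta_v_apply, h1, h2]

theorem fourierCoef_reflect (f : CInf) (n : ℤ) :
    fourierCoef f.reflect.angular n = fourierCoef f.angular (-n) := by
  have h1 : ∀ θ, f.reflect.angular θ = f.angular (-θ) := fun θ => by
    rw [CInf.angular, CInf.reflect_apply, CInf.angular, Circle.exp_neg]
  have hper : Function.Periodic (fun θ : ℝ => f.angular θ * Complex.exp (-(((-n : ℤ) : ℂ) * θ * Complex.I)))
      (2 * Real.pi) := fun θ => by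
    have h2 := f.periodic_iteratedDeriv 0 θ
    simp only [iteratedDeriv_zero] at h2
    simp only [h2, exp_neg_int_mul_two_pi]
  have h3 := hper.intervalIntegral_add_eq (-(2 * Real.pi)) 0
  rw [neg_add_cancel, zero_add] at h3
  have h4 := intervalIntegral.integral_comp_neg (a := 0) (b := 2 * Real.pi)
    fun θ : ℝ => f.angular θ * Complex.exp (-(((-n : ℤ) : ℂ) * θ * Complex.I))
  rw [neg_zero, h3] at h4
  rw [fourierCoef, fourierCoef, ← h4]
  congr 2
  funext θ
  rw [h1]
  congr 2
  push_cast
  ring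

/-! ## Algebra of boundary values -/

theorem StripPair.zero : StripPair (fun _ => 0) fun _ => 0 :=
  ⟨fun _ => 0, continuousOn_const, differentiableOn_const _, ⟨0, fun z _ => by simp⟩,
    fun _ => rfl, fun _ => rfl⟩

theorem StripPair.const (c : ℂ) : StripPair (fun _ => c) fun _ => c :=
  ⟨fun _ => c, continuousOn_const, differentiableOn_const _, ⟨‖c‖, fun z _ =>
    le_mul_of_one_le_right (norm_nonneg _) (Real.one_le_exp (by positivity))⟩,
    fun _ => rfl, fun _ => rfl⟩

theorem StripPair.add {g₁ h₁ g₂ h₂ : ℝ → ℂ} (H₁ : StripPair g₁ h₁) (H₂ : StripPair g₂ h₂) :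
    StripPair (fun t => g₁ t + g₂ t) fun t => h₁ t + h₂ t := by
  obtain ⟨G, c, d, ⟨A, hA⟩, e, e'⟩ := H₁
  obtain ⟨K, c', d', ⟨B, hB⟩, k, k'⟩ := H₂
  have hA0 : 0 ≤ A := by
    have h := (norm_nonneg _).trans (hA _ (ofReal_mem_closedStrip 0)); simpa using h
  have hB0 : 0 ≤ B := by
    have h := (norm_nonneg _).trans (hB _ (ofReal_mem_closedStrip 0)); simpa using h
  refine ⟨fun z => G z + K z, c.add c', d.add d', ⟨A + B, fun z hz => ?_⟩, fun t => by simp [e, k],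
    fun t => by simp [e', k']⟩
  refine (norm_add_le _ _).trans ((add_le_add (hA z hz) (hB z hz)).trans ?_)
  rw [add_mul A B (Real.exp _)]
  gcongr <;> linarith

theorem StripPair.const_mul {g h : ℝ → ℂ} (H : StripPair g h) (c : ℂ) :
    StripPair (fun t => c * g t) fun t => c * h t := by
  obtain ⟨G, hc, d, ⟨A, hA⟩, e, e'⟩ := H
  have hA0 : 0 ≤ A := by
    have h := (norm_nonneg _).trans (hA _ (ofReal_mem_closedStrip 0)); simpa using h
  refine ⟨fun z => c * G z, continuousOn_const.mul hc, d.const_mul c, ⟨‖c‖ * A + A, fun z hz => ?_⟩,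
    fun t => by simp [e], fun t => by simp [e']⟩
  have h0 := mul_nonneg (norm_nonneg c) hA0
  rw [norm_mul]
  calc _ ≤ ‖c‖ * (A * Real.exp (A * z.re ^ 2)) := by gcongr; exact hA z hz
    _ = ‖c‖ * A * Real.exp (A * z.re ^ 2) := by ring
    _ ≤ _ := by
      refine mul_le_mul (by linarith) (Real.exp_le_exp.2 ?_) (Real.exp_pos _).le (by positivity)
      nlinarith [mul_nonneg h0 (sq_nonneg z.re)]

theorem StripPair.sum {ι : Type*} (s : Finset ι) {g h : ι → ℝ → ℂ}
    (H : ∀ i ∈ s, StripPair (g i) (h i)) :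
    StripPair (fun t => ∑ i ∈ s, g i t) fun t => ∑ i ∈ s, h i t := by
  classical
  induction s using Finset.induction_on with
  | empty => simpa using StripPair.zero
  | insert a s ha ih =>
    simp only [Finset.sum_insert ha]
    exact (H a (Finset.mem_insert_self _ _)).add (ih fun i hi => H i (Finset.mem_insert_of_mem hi))

theorem stripPair_fourierCoef (d k : ℕ) {f : CInf} (hf : tsupport f ⊆ upperArc) :
    StripPair (fun t => fourierCoef (beta d (v t) f).angular (-(k + d : ℕ)))
      fun t => (-1) ^ d * fourierCoef (beta d (v t) f.reflect).angular (-(k + d : ℕ)) := by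
  have h := (stripPair_integral_arcKernel k d (continuous_arcFun d f)
    (hasCompactSupport_arcFun d hf)).const_mul (2 * Real.pi : ℂ)⁻¹
  convert h using 2 with t t
  · rw [fourierCoef_beta d t hf]
    simp only [arcKernel_ofReal, neg_neg, zpow_natCast]
  · rw [beta_v_reflect, fourierCoef_reflect, fourierCoef_beta d t hf, mul_left_comm, ← integral_const_mul]
    simp only [arcKernel_add_pi, neg_neg, zpow_neg, zpow_natCast, inv_pow]
    congr 2
    funext u
    ring

/-- The continuation of `l ∘ β_d(v_t)` for functionals which annihilate the functions holomorphic
in the disc. -/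
theorem stripPair_of_annihilates (d : ℕ) (l : CInf →ₗ[ℂ] ℂ) (hl : Continuous l)
    (h0 : ∀ n : ℤ, 1 - (d : ℤ) ≤ n → l (CInf.char n) = 0) {f : CInf} (hf : tsupport f ⊆ upperArc) :
    StripPair (fun t => l (beta d (v t) f)) fun t => (-1) ^ d * l (beta d (v t) f.reflect) := by
  obtain ⟨⟨A, hA⟩, hT⟩ := (angularFamily_beta d f).fourier_approx l hl
  obtain ⟨⟨B, hB⟩, hT'⟩ := (angularFamily_beta d f.reflect).fourier_approx l hl
  have hA0 : 0 ≤ A := by simpa using (norm_nonneg _).trans (hA 0 0)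
  have hB0 : 0 ≤ B := by simpa using (norm_nonneg _).trans (hB 0 0)
  refine StripPair.of_tendsto (A := A + B)
    (gn := fun N t => ∑ n ∈ Finset.Icc (-(N : ℤ)) N,
      fourierCoef (beta d (v t) f).angular n * l (CInf.char n))
    (hn := fun N t => (-1) ^ d * ∑ n ∈ Finset.Icc (-(N : ℤ)) N,
      fourierCoef (beta d (v t) f.reflect).angular n * l (CInf.char n)) (fun N => ?_) (fun N t => ?_)
      (fun N t => ?_) hT ?_
  · simp only [Finset.mul_sum]
    refine StripPair.sum _ fun n _ => ?_
    -- Modes with n ≥ 1 - d are killed by l. The remaining ones are n = -(k+d) with k ≥ 0, for which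
    -- the kernel has a bounded continuation.
    by_cases hn : 1 - (d : ℤ) ≤ n
    · simpa only [h0 n hn, mul_zero] using StripPair.zero
    · obtain ⟨k, rfl⟩ : ∃ k : ℕ, n = -(k + d : ℕ) := ⟨(-n - d).toNat, by omega⟩
      convert (stripPair_fourierCoef d k hf).const_mul (l (CInf.char (-(k + d : ℕ)))) using 2 <;> ring
  · refine (hA N t).trans ?_
    gcongr <;> linarith
  · rw [norm_mul, norm_pow, norm_neg, norm_one, one_pow, one_mul]
    refine (hB N t).trans ?_
    gcongr <;> linarith
  · rw [Metric.tendstoLocallyUniformly_iff] at hT' ⊢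
    intro ε hε x
    obtain ⟨s, hs, h⟩ := hT' ε hε x
    refine ⟨s, hs, h.mono fun N hN y hy => ?_⟩
    rw [dist_eq_norm, ← mul_sub, norm_mul, norm_pow, norm_neg, norm_one, one_pow, one_mul,
      ← dist_eq_norm]
    exact hN y hy

end MobiusCFT
end

noncomputable section
namespace MobiusCFT
open MeasureTheory Filter Topology

/-! ## Modes annihilating the vacuum -/

theorem X_rot (θ : ℝ) (z : Circle) : X (rot θ) z = 1 := by
  have h : (Circle.exp (θ / 2) : ℂ) * conj (Circle.exp (θ / 2) : ℂ) = 1 := by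
    rw [Complex.mul_conj, Circle.normSq_coe, Complex.ofReal_one]
  rw [rot, X_mob, map_zero, zero_mul, zero_add, Complex.conj_conj, mul_comm, h, div_one]

theorem beta_rot_char (d : ℕ) (θ : ℝ) (n : ℤ) :
    beta d (rot θ) (CInf.char n) = Complex.exp (Complex.I * (-n : ℤ) * θ) • CInf.char n := by
  ext z
  have h : Circle.exp θ * (((rot θ)⁻¹ : Mob) : Equiv.Perm Circle) z = z := by
    rw [← rot_apply, ← Equiv.Perm.mul_apply, ← Subgroup.coe_mul, mul_inv_cancel]
    rfl
  rw [beta, CInf.mk_apply, X_rot, one_zpow, one_mul, CInf.smul_apply, CInf.char_apply,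
    CInf.char_apply]
  conv_rhs => rw [← h]
  rw [Circle.coe_mul, mul_zpow, Circle.coe_exp, ← Complex.exp_int_mul, ← mul_assoc, ← Complex.exp_add]
  rw [show Complex.I * (-n : ℤ) * θ + n * (θ * Complex.I) = 0 by push_cast; ring, Complex.exp_zero,
    one_mul]

/-- The angle 1 is not a rational multiple of π, so the single rotation by 1 already separates all
integer weights. -/
theorem exp_I_mul_intCast_injective :
    Function.Injective fun n : ℤ => Complex.exp (Complex.I * n * (1 : ℝ)) := by
  intro m n h
  obtain ⟨k, hk⟩ := Complex.exp_eq_exp_iff_exists_int.1 h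
  have h1 : (m : ℂ) - n - k * (2 * Real.pi) = 0 := by
    have : Complex.I * ((m : ℂ) - n - k * (2 * Real.pi)) = 0 := by
      push_cast at hk; linear_combination hk
    simpa [Complex.I_ne_zero] using this
  have h2 : ((m - n : ℤ) : ℝ) = (2 * k : ℤ) * Real.pi := by
    have : (m : ℝ) - n - k * (2 * Real.pi) = 0 := by exact_mod_cast h1
    push_cast
    linarith
  by_contra hne
  have hk0 : (2 * k : ℤ) ≠ 0 := by
    intro h0
    rw [h0, Int.cast_zero, zero_mul, Int.cast_eq_zero] at h2
    exact hne (sub_eq_zero.1 h2)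
  exact (irrational_pi.intCast_mul hk0).ne_int _ h2.symm

section

variable {D : Type*} [AddCommGroup D] [Module ℂ D]

theorem eq_zero_of_sum_hasConformalDim {U : Mob →* Module.End ℂ D} {ι : Type*} {s : Finset ι}
    {e : ι → ℤ} (he : Function.Injective e) {Ψ : ι → D} (h : ∀ i ∈ s, HasConformalDim U (Ψ i) (e i))
    (hsum : ∑ i ∈ s, Ψ i = 0) : ∀ i ∈ s, Ψ i = 0 := by
  have hind := (Module.End.eigenspaces_iSupIndep (U (rot 1))).comp
    (exp_I_mul_intCast_injective.comp he)
  exact (iSupIndep_iff_finsetSum_eq_zero_imp_eq_zero _).1 hind s Ψ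
    (fun i hi => Module.End.mem_eigenspace_iff.2 (h i hi 1)) hsum

theorem IsCompatible.continuous_smear {F : Set (OVD D)} {l : D →ₗ[ℂ] ℂ} (hl : IsCompatible F l)
    {φ : OVD D} (hφ : φ ∈ F) (Φ : D) : Continuous fun f => l (φ f Φ) := by
  have h := (hl 1 (fun _ => φ) (fun _ => hφ) Φ).comp (continuous_pi fun _ => continuous_id)
  simpa [smear, Function.comp_def] using h

end

/-- Evaluation of a field on a vector, followed by a functional. -/
def fieldFunctional {D : Type*} [AddCommGroup D] [Module ℂ D] (φ : OVD D) (Φ : D) (l : D →ₗ[ℂ] ℂ) :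
    CInf →ₗ[ℂ] ℂ := l ∘ₗ (LinearMap.applyₗ Φ) ∘ₗ φ

/-- The transformed function (cz + s)/(sz + c), with c = cosh(t/2) and s = sinh(t/2), is holomorphic
on the closed disc. Its coefficient of index -n is the mean over the circle of zⁿ times it, hence
the value at 0. -/
theorem fourierCoef_beta_one_char_one (t : ℝ) (n : ℕ) :
    fourierCoef (beta 1 (v t) (CInf.char 1)).angular (-n) =
      if n = 0 then (Real.sinh (t / 2) / Real.cosh (t / 2) : ℂ) else 0 := by
  have hne : ∀ z ∈ Metric.closedBall (0 : ℂ) |1|,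
      (Real.sinh (t / 2) * z + Real.cosh (t / 2) : ℂ) ≠ 0 := by
    intro z hz h
    rw [abs_one, mem_closedBall_zero_iff] at hz
    have h1 : ‖(Real.sinh (t / 2) * z : ℂ)‖ = Real.cosh (t / 2) := by
      rw [eq_neg_of_add_eq_zero_left h, norm_neg, Complex.norm_real, Real.norm_eq_abs,
        abs_of_pos (Real.cosh_pos _)]
    rw [norm_mul, Complex.norm_real, Real.norm_eq_abs] at h1
    have h2 := mul_le_of_le_one_right (abs_nonneg (Real.sinh (t / 2))) hz
    have h3 : |Real.sinh (t / 2)| < Real.cosh (t / 2) := by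
      rw [abs_lt]
      exact ⟨by have := Real.cosh_add_sinh (t / 2); have := Real.exp_pos (t / 2); linarith,
        Real.sinh_lt_cosh _⟩
    linarith
  have hd : DiffContOnCl ℂ (fun z : ℂ => z ^ n * ((Real.cosh (t / 2) * z + Real.sinh (t / 2)) /
      (Real.sinh (t / 2) * z + Real.cosh (t / 2)))) (Metric.ball 0 |1|) := by
    refine DifferentiableOn.diffContOnCl ?_
    rw [closure_ball _ (by simp)]
    exact DifferentiableOn.mul (by fun_prop) (DifferentiableOn.div (by fun_prop) (by fun_prop) hne)
  have h := hd.circleAverage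
  rw [Real.circleAverage, Complex.real_smul] at h
  have e : (beta 1 (v t) (CInf.char 1)).angular = fun θ : ℝ =>
      (Real.cosh (t / 2) * circleMap 0 1 θ + Real.sinh (t / 2)) /
        (Real.sinh (t / 2) * circleMap 0 1 θ + Real.cosh (t / 2)) := by
    funext θ
    rw [CInf.angular, beta_v_apply, CInf.char_apply, coe_v_neg_apply, Nat.cast_one, sub_self, zpow_zero,
      one_mul, zpow_one, circleMap, Circle.coe_exp, Complex.ofReal_one, one_mul, zero_add]
  rw [fourierCoef, e]
  convert h using 1
  · push_cast
    congr 2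
    funext θ
    rw [mul_comm (circleMap 0 1 θ ^ n)]
    congr 1
    rw [circleMap, Complex.ofReal_one, one_mul, zero_add, ← Complex.exp_nat_mul]
    congr 1
    ring
  · split_ifs with h0 <;> simp [h0]

/-- On the circle the conformal factor is (sz + c)(cz + s)/z. Its k-th power cancels the denominator
of v_{-t}(z)^k and leaves (cz + s)^{2k}/z^k, a Laurent polynomial in which every degree from -k to k
occurs if t ≠ 0. -/
theorem beta_v_char (t : ℝ) (k : ℕ) :
    beta (k + 1) (v t) (CInf.char k) = ∑ m ∈ Finset.range (2 * k + 1),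
      ((Real.cosh (t / 2) : ℂ) ^ m * (Real.sinh (t / 2) : ℂ) ^ (2 * k - m) * ((2 * k).choose m : ℂ)) •
        CInf.char ((m : ℤ) - k) := by
  ext z
  have hsum : ∀ (s : Finset ℕ) (c : ℕ → ℂ) (g : ℕ → CInf), (∑ i ∈ s, c i • g i) z = ∑ i ∈ s, c i * g i z := by
    intro s c g
    induction s using Finset.induction_on with
    | empty => simp; rfl
    | insert a s ha ih => rw [Finset.sum_insert ha, Finset.sum_insert ha, CInf.add_apply, ih, CInf.smul_apply]
  have hz := z.coe_ne_zero
  have hne := sinh_mul_add_cosh_ne_zero t z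
  have hre : ((z : ℂ).re : ℂ) = ((z : ℂ) + (z : ℂ)⁻¹) / 2 := by
    rw [← Circle.coe_inv, Circle.coe_inv_eq_conj, Complex.re_eq_add_conj]
  have hch : (Real.cosh t : ℂ) = (Real.cosh (t / 2) : ℂ) ^ 2 + (Real.sinh (t / 2) : ℂ) ^ 2 := by
    exact_mod_cast cosh_eq_half t
  have hsh : (Real.sinh t : ℂ) = 2 * (Real.sinh (t / 2) : ℂ) * (Real.cosh (t / 2) : ℂ) := by
    exact_mod_cast sinh_eq_half t
  have hX : ((Real.cosh t + Real.sinh t * (z : ℂ).re : ℝ) : ℂ) =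
      (Real.sinh (t / 2) * z + Real.cosh (t / 2)) * (Real.cosh (t / 2) * z + Real.sinh (t / 2)) / z := by
    rw [Complex.ofReal_add, Complex.ofReal_mul, hch, hsh, hre]
    field_simp
    ring
  rw [hsum, beta_v_apply, CInf.char_apply, coe_v_neg_apply, hX, Nat.cast_succ, add_sub_cancel_right,
    zpow_natCast, zpow_natCast, ← mul_pow, div_mul_div_comm, mul_assoc, mul_comm (z : ℂ),
    mul_div_mul_left _ _ hne, div_pow, ← pow_two, ← pow_mul, add_pow, Finset.sum_div]
  refine Finset.sum_congr rfl fun m _ => ?_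
  rw [CInf.char_apply, zpow_sub₀ hz, zpow_natCast, zpow_natCast]
  ring

namespace WightmanCFT

variable {D : Type*} [AddCommGroup D] [Module ℂ D] (T : WightmanCFT D)

theorem U_apply_field {φ : OVD D} {d : ℕ} (hφ : IsCovariant T.U φ d) (γ : Mob) (f : CInf) (Φ : D) :
    T.U γ (φ f Φ) = φ (beta d γ f) (T.U γ Φ) := by
  rw [← hφ γ f, Module.End.mul_apply, Module.End.mul_apply, ← Module.End.mul_apply (T.U γ⁻¹), ← map_mul,
    inv_mul_cancel, map_one, Module.End.one_apply]

theorem U_apply_field_vacuum {φ : OVD D} {d : ℕ} (hφ : IsCovariant T.U φ d) (γ : Mob) (f : CInf) :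
    T.U γ (φ f T.Ω) = φ (beta d γ f) T.Ω := by
  rw [T.U_apply_field hφ, T.vacuum_invariant]

theorem hasConformalDim_mode {φ : OVD D} {d : ℕ} (hφ : IsCovariant T.U φ d) (n : ℤ) :
    HasConformalDim T.U (φ (CInf.char n) T.Ω) (-n) := fun θ => by
  rw [T.U_apply_field_vacuum hφ, beta_rot_char, map_smul, LinearMap.smul_apply]

theorem mode_vacuum_of_pos {φ : OVD D} {d : ℕ} (hφ : IsCovariant T.U φ d) {n : ℤ} (hn : 0 < n) :
    φ (CInf.char n) T.Ω = 0 :=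
  T.spectrum (-n) _ (by omega) (T.hasConformalDim_mode hφ n)

/-- `φ(z^n) Ω = 0` for all `n > -d`. -/
theorem mode_vacuum_eq_zero {φ : OVD D} (hF : φ ∈ T.F) {d : ℕ} (hφ : IsCovariant T.U φ d) {n : ℤ}
    (hn : 1 - (d : ℤ) ≤ n) : φ (CInf.char n) T.Ω = 0 := by
  rcases lt_or_ge 0 n with h0 | h0
  · exact T.mode_vacuum_of_pos hφ h0
  have hs : (Real.sinh (2 / 2) : ℂ) ≠ 0 := by
    exact_mod_cast (Real.sinh_pos_iff.2 (by norm_num : (0 : ℝ) < 2 / 2)).ne'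
  have hc : (Real.cosh (2 / 2) : ℂ) ≠ 0 := by exact_mod_cast (Real.cosh_pos _).ne'
  -- Here n ≤ 0, so 1 - d ≤ n forces d ≥ 1 and the subtraction is genuine. The parameter t = 2 used
  -- below stands for any t ≠ 0.
  obtain ⟨k, rfl⟩ : ∃ k, d = k + 1 := ⟨d - 1, by omega⟩
  rcases Nat.eq_zero_or_pos k with rfl | hk
  -- In dimension 1 the transform of z is an infinite series, so regularity supplies a functional l
  -- to evaluate it. Negative modes are absent and positive ones kill Ω, so only tanh(1) times the
  -- zero mode is left, and it must vanish.
  · obtain rfl : n = 0 := by push_cast at hn; omega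
    by_contra hcon
    obtain ⟨l, hl, hl0⟩ := T.regular _ hcon
    have h1 := hasLimit_fourier (fieldFunctional φ T.Ω l) (hl.continuous_smear hF T.Ω)
      (beta 1 (v 2) (CInf.char 1))
    have h2 : fieldFunctional φ T.Ω l (beta 1 (v 2) (CInf.char 1)) = 0 := by
      change l (φ _ T.Ω) = 0
      rw [← T.U_apply_field_vacuum hφ, T.mode_vacuum_of_pos hφ one_pos, map_zero, map_zero]
    have h3 : ∀ N : ℕ, ∑ n ∈ Finset.Icc (-(N : ℤ)) N,
        fourierCoef (beta 1 (v 2) (CInf.char 1)).angular n * fieldFunctional φ T.Ω l (CInf.char n) =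
        (Real.sinh (2 / 2) / Real.cosh (2 / 2) : ℂ) * l (φ (CInf.char 0) T.Ω) := by
      intro N
      rw [Finset.sum_eq_single 0]
      · have := fourierCoef_beta_one_char_one 2 0
        rw [if_pos rfl, Nat.cast_zero, neg_zero] at this
        rw [this]
        rfl
      · intro m _ hm
        rcases lt_or_gt_of_ne hm with hm | hm
        · obtain ⟨j, rfl⟩ : ∃ j : ℕ, m = -j := ⟨(-m).toNat, by omega⟩
          rw [fourierCoef_beta_one_char_one, if_neg (by omega), zero_mul]
        · change _ * l (φ _ T.Ω) = 0
          rw [T.mode_vacuum_of_pos hφ hm, map_zero, mul_zero]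
      · intro h
        exact absurd (Finset.mem_Icc.2 ⟨by omega, by omega⟩) h
    simp only [h3, h2] at h1
    exact mul_ne_zero (div_ne_zero hs hc) hl0 (tendsto_nhds_unique tendsto_const_nhds h1)
  -- For d = k + 1 ≥ 2 the mode z^k kills Ω. Applying v_2 gives a vanishing finite combination of
  -- all modes from -k to k with nonzero coefficients. Their weights are distinct, so each term
  -- vanishes.
  · have h1 : T.U (v 2) (φ (CInf.char k) T.Ω) = 0 := by
      rw [T.mode_vacuum_of_pos hφ (by exact_mod_cast hk), map_zero]
    rw [T.U_apply_field_vacuum hφ, beta_v_char, map_sum, LinearMap.sum_apply] at h1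
    simp only [map_smul, LinearMap.smul_apply] at h1
    have h2 := eq_zero_of_sum_hasConformalDim (U := T.U) (e := fun m : ℕ => -((m : ℤ) - k))
      (fun a b h => by simpa using h) (fun m _ θ => by
        rw [map_smul, T.hasConformalDim_mode hφ, smul_comm]) h1 (n + k).toNat
      (Finset.mem_range.2 (by push_cast at hn; omega))
    rw [smul_eq_zero] at h2
    rw [Int.toNat_of_nonneg (by push_cast at hn; omega), add_sub_cancel_right] at h2
    refine h2.resolve_left (mul_ne_zero (mul_ne_zero (pow_ne_zero _ hc) (pow_ne_zero _ hs)) ?_)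
    exact_mod_cast (Nat.choose_pos (by omega)).ne'

end WightmanCFT

end MobiusCFT
end

noncomputable section
namespace MobiusCFT
open MeasureTheory Filter Topology

/-! ## Products of fields smeared with tempered families -/

section

variable {D : Type*} [AddCommGroup D] [Module ℂ D]

/-- Operators `c φ₁(w₁(p)) ⋯ φ_k(w_k(p))` with `φ_j ∈ F`, the `w_j` being tempered families. -/
inductive TemperedOp (F : Set (OVD D)) : (ℝ × ℝ → Module.End ℂ D) → Prop
  | one : TemperedOp F fun _ => 1
  | field_mul {φ : OVD D} (hφ : φ ∈ F) {w : ℝ × ℝ → CInf} (hw : TemperedFamily w)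
      {W : ℝ × ℝ → Module.End ℂ D} (hW : TemperedOp F W) : TemperedOp F fun p => φ (w p) * W p
  | smul (c : ℂ) {W : ℝ × ℝ → Module.End ℂ D} (hW : TemperedOp F W) : TemperedOp F fun p => c • W p

theorem TemperedOp.mul {F : Set (OVD D)} {W W' : ℝ × ℝ → Module.End ℂ D} (h : TemperedOp F W)
    (h' : TemperedOp F W') : TemperedOp F fun p => W p * W' p := by
  induction h with
  | one => simpa using h'
  | field_mul hφ hw _ ih => simpa only [mul_assoc] using TemperedOp.field_mul hφ hw ih
  | smul c _ ih => simpa only [smul_mul_assoc] using TemperedOp.smul c ih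

theorem TemperedOp.exists_smear {F : Set (OVD D)} {W : ℝ × ℝ → Module.End ℂ D} (h : TemperedOp F W) :
    ∃ (c : ℂ) (k : ℕ) (φ : Fin k → OVD D) (w : Fin k → ℝ × ℝ → CInf), (∀ i, φ i ∈ F) ∧
      (∀ i, TemperedFamily (w i)) ∧ ∀ p, W p = c • smear φ fun i => w i p := by
  induction h with
  | one => exact ⟨1, 0, Fin.elim0, Fin.elim0, fun i => i.elim0, fun i => i.elim0, fun p => by simp [smear]⟩
  | @field_mul φ hφ w hw W _ ih =>
    obtain ⟨c, k, ψ, u, h1, h2, h3⟩ := ih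
    refine ⟨c, k + 1, Fin.cons φ ψ, Fin.cons w u, Fin.cases hφ h1, Fin.cases hw h2, fun p => ?_⟩
    simp only [h3, mul_smul_comm, smear, List.ofFn_succ, List.prod_cons, Fin.cons_zero, Fin.cons_succ]
  | smul c _ ih =>
    obtain ⟨c', k, ψ, u, h1, h2, h3⟩ := ih
    exact ⟨c * c', k, ψ, u, h1, h2, fun p => by simp only [h3, mul_smul]⟩

/-- Applied to a product of fields, a compatible functional is a jointly continuous multilinear
functional of the test functions. The scalar in the normal form is absorbed into the vector. -/
theorem IsCompatible.gaussGrowth {F : Set (OVD D)} {l : D →ₗ[ℂ] ℂ} (hl : IsCompatible F l)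
    {W : ℝ × ℝ → Module.End ℂ D} (hW : TemperedOp F W) (Φ : D) :
    ∃ A, GaussGrowth (fun p => l (W p Φ)) A := by
  obtain ⟨c, k, φ, w, hφ, hw, h⟩ := hW.exists_smear
  have hM := MultilinearMap.gaussGrowth
    (((l ∘ₗ LinearMap.applyₗ (c • Φ) : Module.End ℂ D →ₗ[ℂ] ℂ)).compMultilinearMap
      ((MultilinearMap.mkPiAlgebraFin ℂ k (Module.End ℂ D)).compLinearMap φ))
    (hl k φ hφ (c • Φ)) hw
  convert hM using 3
  funext p
  rw [h]
  simp [smear]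

/-! ## Strong continuity -/

/-- The topology pulled back from the strong one along φ(f) is admissible, since prepending φ(f) to
a product of fields gives another such product. The strong topology is finer, being the finest. -/
theorem isStrongCont_field {F : Set (OVD D)} {φ : OVD D} (hφ : φ ∈ F) (f : CInf) :
    IsStrongCont F (φ f) := by
  obtain ⟨⟨h1, h2, h3, h4⟩, hle⟩ := strongTopology_isLeast F
  refine continuous_iff_le_induced.2 (hle ⟨?_, ?_, ?_, fun k ψ hψ Φ => ?_⟩)
  · let := strongTopology F
    exact topologicalAddGroup_induced (φ f)
  · let := strongTopology F
    exact continuousSMul_induced (φ f)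
  · let := strongTopology F
    exact LocallyConvexSpace.induced ((φ f).restrictScalars ℝ)
  · refine continuous_induced_rng.2 ?_
    have h := @Continuous.comp _ _ _ _ _ (strongTopology F) _ _ (h4 (k + 1) (Fin.cons φ ψ)
      (Fin.cases hφ hψ) Φ) (continuous_pi (f := fun g : Fin k → CInf => (Fin.cons f g : Fin (k + 1) → CInf))
        (Fin.cases continuous_const fun i => continuous_apply i))
    convert h using 1
    funext g
    simp [smear, List.ofFn_succ]

theorem WightmanCFT.isStrongCont_of_mem_polyAlg (T : WightmanCFT D) {I : Set Circle} {x : Module.End ℂ D}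
    (hx : x ∈ T.polyAlg I) : IsStrongCont T.F x := by
  obtain ⟨⟨h1, h2, -, -⟩, -⟩ := strongTopology_isLeast T.F
  let := strongTopology T.F
  induction hx using Algebra.adjoin_induction with
  | mem x h =>
    obtain ⟨φ, hφ, f, -, rfl⟩ := h
    exact isStrongCont_field hφ f
  | algebraMap c =>
    change Continuous fun Φ : D => c • Φ
    exact continuous_const_smul c
  | add x y _ _ hx hy => exact Continuous.add hx hy
  | mul x y _ _ hx hy => exact Continuous.comp (g := x) (f := y) hx hy

end

/-! ## Supports -/

theorem tsupport_beta_v_subset (d : ℕ) (t : ℝ) {f : CInf} (hf : tsupport f ⊆ upperArc) :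
    tsupport (beta d (v t) f) ⊆ upperArc := by
  have h : tsupport (beta d (v t) f) ⊆ ((v (-t) : Mob) : Equiv.Perm Circle) ⁻¹' tsupport f := by
    refine closure_minimal (fun z hz => ?_)
      ((isClosed_tsupport f).preimage (contMDiff_mob (v (-t))).continuous)
    refine subset_tsupport f fun h0 => hz ?_
    rw [beta_v_apply, h0, mul_zero]
  exact fun z hz => (v_neg_im_pos t z).1 (hf (h hz))

theorem tsupport_reflect_subset (f : CInf) : tsupport f.reflect ⊆ (fun z => z⁻¹) ⁻¹' tsupport f :=
  closure_minimal (fun _ hz => subset_tsupport f hz) ((isClosed_tsupport f).preimage continuous_inv)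

theorem tsupport_reflect_subset_lowerArc {f : CInf} (hf : tsupport f ⊆ upperArc) :
    tsupport f.reflect ⊆ lowerArc := fun z hz => by
  have h : 0 < ((z⁻¹ : Circle) : ℂ).im := hf (tsupport_reflect_subset f hz)
  rw [Circle.coe_inv_eq_conj, Complex.conj_im] at h
  exact neg_pos.1 h

theorem tsupport_reflect_subset_upperArc {f : CInf} (hf : tsupport f ⊆ lowerArc) :
    tsupport f.reflect ⊆ upperArc := fun z hz => by
  have h : ((z⁻¹ : Circle) : ℂ).im < 0 := hf (tsupport_reflect_subset f hz)
  rw [Circle.coe_inv_eq_conj, Complex.conj_im] at h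
  exact neg_neg_iff_pos.1 h

theorem tsupport_conj_subset (f : CInf) : tsupport f.conj ⊆ tsupport f :=
  closure_mono fun z hz h => hz (by rw [CInf.conj_apply, h, map_zero])

theorem disjoint_upperArc_lowerArc : Disjoint upperArc lowerArc :=
  Set.disjoint_left.2 fun _ h h' => lt_asymm (a := (0 : ℝ)) h h'

theorem WightmanCFT.commute_of_mem_polyAlg {D : Type*} [AddCommGroup D] [Module ℂ D] (T : WightmanCFT D)
    {φ : OVD D} (hφ : φ ∈ T.F) {f : CInf} (hf : tsupport f ⊆ upperArc) {y : Module.End ℂ D}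
    (hy : y ∈ T.polyAlg lowerArc) : Commute (φ f) y := by
  induction hy using Algebra.adjoin_induction with
  | mem y h =>
    obtain ⟨ψ, hψ, g, hg, rfl⟩ := h
    exact T.locality φ hφ ψ hψ f g (disjoint_upperArc_lowerArc.mono hf hg)
  | algebraMap c => exact (Algebra.commutes c (φ f)).symm
  | add x y _ _ hx hy => exact hx.add_right hy
  | mul x y _ _ hx hy => exact hx.mul_right hy

/-! ## Adjoints and the PCT involution -/

namespace InvolutiveWightmanCFT

variable {D : Type*} [AddCommGroup D] [Module ℂ D] (T : InvolutiveWightmanCFT D)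

theorem isCompatible_form (Φ' : D) : IsCompatible T.F (T.form.flip Φ') := fun k φ hφ Φ => by
  have h := (strongTopology_isLeast T.F).1.2.2.2 k φ hφ Φ
  let := strongTopology T.F
  exact T.form_cont.comp (h.prodMk continuous_const)

theorem form_smul_right (c : ℂ) (Φ Ψ : D) : T.form Φ (c • Ψ) = conj c * T.form Φ Ψ := by
  rw [map_smulₛₗ, smul_eq_mul]

variable {T}

theorem IsAdjoint.add {x y x' y' : Module.End ℂ D} (h : T.IsAdjoint x x') (h' : T.IsAdjoint y y') :
    T.IsAdjoint (x + y) (x' + y') := fun Φ Ψ => by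
  simp [h Φ Ψ, h' Φ Ψ]

theorem IsAdjoint.symm {x x' : Module.End ℂ D} (h : T.IsAdjoint x x') : T.IsAdjoint x' x := fun Φ Ψ => by
  rw [T.form_hermitian, ← h, ← T.form_hermitian]

theorem IsAdjoint.mul {x y x' y' : Module.End ℂ D} (h : T.IsAdjoint x x') (h' : T.IsAdjoint y y') :
    T.IsAdjoint (x * y) (y' * x') := fun Φ Ψ => by
  rw [Module.End.mul_apply, h, h', Module.End.mul_apply]

variable (T)

theorem isAdjoint_algebraMap (c : ℂ) :
    T.IsAdjoint (algebraMap ℂ _ c) (algebraMap ℂ _ (conj c)) := fun Φ Ψ => by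
  rw [Module.algebraMap_end_apply, Module.algebraMap_end_apply, form_smul_right, Complex.conj_conj, map_smul,
    LinearMap.smul_apply, smul_eq_mul]

theorem isAdjoint_U (γ : Mob) : T.IsAdjoint (T.U γ) (T.U γ⁻¹) := fun Φ Ψ => by
  rw [← T.form_U γ Φ, ← Module.End.mul_apply, ← map_mul, mul_inv_cancel, map_one, Module.End.one_apply]

theorem exists_adjoint_mem_polyAlg {I : Set Circle} {x : Module.End ℂ D} (hx : x ∈ T.polyAlg I) :
    ∃ y ∈ T.polyAlg I, T.IsAdjoint x y := by
  induction hx using Algebra.adjoin_induction with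
  | mem x h =>
    obtain ⟨φ, hφ, f, hf, rfl⟩ := h
    obtain ⟨d, hd⟩ := T.covariant φ hφ
    -- The field of the theory is (-1)^d φ† and not φ†, so the adjoint φ†(f̄) is reached after
    -- multiplying by the sign once more.
    have hmem : ((-1 : ℂ) ^ d • dagger T.θ d φ) f.conj ∈ T.polyAlg I :=
      Algebra.subset_adjoin ⟨_, T.dagger_mem φ hφ d hd, _, (tsupport_conj_subset f).trans hf, rfl⟩
    refine ⟨_, Subalgebra.smul_mem _ hmem ((-1 : ℂ) ^ d), fun Φ Ψ => ?_⟩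
    change _ = T.form Φ ((-1 : ℂ) ^ d • (-1 : ℂ) ^ d • dagger T.θ d φ f.conj Ψ)
    rw [T.form_field φ hφ d hd, smul_smul, ← mul_pow, neg_one_mul, neg_neg, one_pow,
      one_smul]
  | algebraMap c => exact ⟨_, Subalgebra.algebraMap_mem _ _, T.isAdjoint_algebraMap c⟩
  | add x y _ _ hx hy =>
    obtain ⟨x', hx', h⟩ := hx
    obtain ⟨y', hy', h'⟩ := hy
    exact ⟨_, add_mem hx' hy', h.add h'⟩
  | mul x y _ _ hx hy =>
    obtain ⟨x', hx', h⟩ := hx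
    obtain ⟨y', hy', h'⟩ := hy
    exact ⟨_, mul_mem hy' hx', h.mul h'⟩

theorem θ_field_θ (φ : OVD D) (d : ℕ) (f : CInf) (Φ : D) :
    T.θ (φ f (T.θ Φ)) = (-1 : ℂ) ^ d • dagger T.θ d φ f.reflect.conj Φ := by
  have h : f.reflect.conj.conj.reflect = f := by ext z; simp
  change _ = (-1 : ℂ) ^ d • (-1 : ℂ) ^ d • T.θ (φ f.reflect.conj.conj.reflect (T.θ Φ))
  rw [h, smul_smul, ← mul_pow, neg_one_mul, neg_neg, one_pow, one_smul]

/-- Conjugation by θ turns φ(f) into the field (-1)^d φ† smeared with the reflected and conjugated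
function. It therefore carries polynomials over I to polynomials over the reflected set. -/
theorem exists_θ_conj_mem_polyAlg {I J : Set Circle}
    (hIJ : ∀ f : CInf, tsupport f ⊆ I → tsupport f.reflect ⊆ J) {x : Module.End ℂ D}
    (hx : x ∈ T.polyAlg I) : ∃ y ∈ T.polyAlg J, ∀ Φ, y Φ = T.θ (x (T.θ Φ)) := by
  induction hx using Algebra.adjoin_induction with
  | mem x h =>
    obtain ⟨φ, hφ, f, hf, rfl⟩ := h
    obtain ⟨d, hd⟩ := T.covariant φ hφ
    exact ⟨((-1 : ℂ) ^ d • dagger T.θ d φ) f.reflect.conj, Algebra.subset_adjoin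
      ⟨_, T.dagger_mem φ hφ d hd, _, (tsupport_conj_subset _).trans (hIJ f hf), rfl⟩,
      fun Φ => (T.θ_field_θ φ d f Φ).symm⟩
  | algebraMap c =>
    exact ⟨_, Subalgebra.algebraMap_mem _ (conj c), fun Φ => by simp [T.θ_involutive]⟩
  | add x y _ _ hx hy =>
    obtain ⟨x', hx', h⟩ := hx
    obtain ⟨y', hy', h'⟩ := hy
    exact ⟨_, add_mem hx' hy', fun Φ => by simp [h, h']⟩
  | mul x y _ _ hx hy =>
    obtain ⟨x', hx', h⟩ := hx
    obtain ⟨y', hy', h'⟩ := hy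
    exact ⟨_, mul_mem hx' hy', fun Φ => by simp [h, h', T.θ_involutive]⟩

theorem isAdjoint_θ_conj {x x' y y' : Module.End ℂ D} (h : T.IsAdjoint x x')
    (hy : ∀ Φ, y Φ = T.θ (x (T.θ Φ))) (hy' : ∀ Φ, y' Φ = T.θ (x' (T.θ Φ))) : T.IsAdjoint y y' := fun Φ Ψ => by
  rw [hy, hy', ← T.θ_involutive Ψ, T.θ_antiunitary, h, T.θ_involutive, ← T.θ_antiunitary, T.θ_involutive]

theorem mem_EndStar_of_mem_polyAlg {I : Set Circle} {x : Module.End ℂ D} (hx : x ∈ T.polyAlg I) :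
    x ∈ T.EndStar := by
  obtain ⟨y, hy, h⟩ := T.exists_adjoint_mem_polyAlg hx
  exact ⟨T.isStrongCont_of_mem_polyAlg hx, y, T.isStrongCont_of_mem_polyAlg hy, h⟩

end InvolutiveWightmanCFT

end MobiusCFT
end

noncomputable section
namespace MobiusCFT
open MeasureTheory Filter Topology

namespace InvolutiveWightmanCFT

variable {D : Type*} [AddCommGroup D] [Module ℂ D] (T : InvolutiveWightmanCFT D)

/-! ## Words in fields on the upper semicircle and their reflections -/

/-- Pairs `(x, y)` with `x` a product of fields localized in the upper semicircle and
`y = θ x* θ`. -/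
inductive ReflectedWord : Module.End ℂ D → Module.End ℂ D → Prop
  | one : ReflectedWord 1 1
  | field_mul {φ : OVD D} (hφ : φ ∈ T.F) {d : ℕ} (hd : IsCovariant T.U φ d) {f : CInf}
      (hf : tsupport f ⊆ upperArc) {x y : Module.End ℂ D} (h : ReflectedWord x y) :
      ReflectedWord (φ f * x) (y * ((-1 : ℂ) ^ d • φ f.reflect))

variable {T}

theorem ReflectedWord.mem_polyAlg {x y : Module.End ℂ D} (h : T.ReflectedWord x y) :
    y ∈ T.polyAlg lowerArc := by
  induction h with
  | one => exact one_mem _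
  | field_mul hφ _ hf _ ih =>
    have h : _ ∈ T.polyAlg lowerArc :=
      Algebra.subset_adjoin ⟨_, hφ, _, tsupport_reflect_subset_lowerArc hf, rfl⟩
    exact mul_mem ih (Subalgebra.smul_mem _ h _)

/-- For one field θ φ†(f̄) θ = (-1)^d φ(f ∘ z⁻¹). Taking adjoints reverses the order of the factors
and conjugation by θ keeps it. -/
theorem ReflectedWord.exists_adjoint {x y : Module.End ℂ D} (h : T.ReflectedWord x y) :
    ∃ x', T.IsAdjoint x x' ∧ ∀ Φ, y Φ = T.θ (x' (T.θ Φ)) := by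
  induction h with
  | one => exact ⟨1, fun _ _ => rfl, fun Φ => (T.θ_involutive Φ).symm⟩
  | @field_mul φ hφ d hd f hf x y _ ih =>
    obtain ⟨x', hx', h⟩ := ih
    refine ⟨x' * dagger T.θ d φ f.conj, IsAdjoint.mul (T.form_field φ hφ d hd f) hx', fun Φ => ?_⟩
    have e : f.conj.conj.reflect = f.reflect := by ext z; simp
    rw [Module.End.mul_apply, Module.End.mul_apply, h]
    congr 2
    change _ = (-1 : ℂ) ^ d • T.θ (φ f.conj.conj.reflect (T.θ (T.θ Φ)))
    rw [LinearMap.smul_apply, map_smulₛₗ, T.θ_involutive, e]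
    simp

theorem U_mul_field_mul {φ : OVD D} {d : ℕ} (hd : IsCovariant T.U φ d) (γ : Mob) (f : CInf)
    (x : Module.End ℂ D) : T.U γ * (φ f * x) * T.U γ⁻¹ = φ (beta d γ f) * (T.U γ * x * T.U γ⁻¹) := by
  have h : T.U γ⁻¹ * T.U γ = 1 := by rw [← map_mul, inv_mul_cancel, map_one]
  rw [← hd γ f, mul_assoc _ (T.U γ⁻¹), ← mul_assoc (T.U γ⁻¹), ← mul_assoc (T.U γ⁻¹), h, one_mul]
  simp only [mul_assoc]

theorem U_mul_mul_field {φ : OVD D} {d : ℕ} (hd : IsCovariant T.U φ d) (γ : Mob) (f : CInf)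
    (y : Module.End ℂ D) : T.U γ * (y * φ f) * T.U γ⁻¹ = T.U γ * y * T.U γ⁻¹ * φ (beta d γ f) := by
  have h : T.U γ⁻¹ * T.U γ = 1 := by rw [← map_mul, inv_mul_cancel, map_one]
  rw [← hd γ f, mul_assoc _ (T.U γ⁻¹), ← mul_assoc (T.U γ⁻¹), ← mul_assoc (T.U γ⁻¹), h, one_mul]
  simp only [mul_assoc]

theorem U_mul_mul_vacuum (γ : Mob) (x : Module.End ℂ D) :
    (T.U γ * x * T.U γ⁻¹) T.Ω = T.U γ (x T.Ω) := by
  rw [Module.End.mul_apply, T.vacuum_invariant, Module.End.mul_apply]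

theorem ReflectedWord.temperedOp {x y : Module.End ℂ D} (h : T.ReflectedWord x y) :
    TemperedOp T.F (fun p => T.U (v p.2) * x * T.U (v p.2)⁻¹) ∧
      TemperedOp T.F fun p => T.U (v p.2) * y * T.U (v p.2)⁻¹ := by
  induction h with
  | one =>
    have h : ∀ p : ℝ × ℝ, T.U (v p.2) * 1 * T.U (v p.2)⁻¹ = 1 := fun p => by
      rw [mul_one, ← map_mul, mul_inv_cancel, map_one]
    simp only [h]
    exact ⟨.one, .one⟩
  | @field_mul φ hφ d hd f hf x y _ ih =>
    constructor
    · simp only [U_mul_field_mul hd]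
      exact .field_mul hφ (angularFamily_beta d f).temperedFamily_snd ih.1
    · simp only [mul_smul_comm, smul_mul_assoc, U_mul_mul_field hd]
      refine .smul _ (ih.2.mul ?_)
      simpa using TemperedOp.field_mul hφ (angularFamily_beta d f.reflect).temperedFamily_snd .one

/-- Conjugating back by V_{-t} leaves y in the lower semicircle and a field that is still smeared in
the upper one, because the flow preserves both. Locality then applies for all s and t independently.
-/
theorem ReflectedWord.commute {x y : Module.End ℂ D} (h : T.ReflectedWord x y) {φ : OVD D}
    (hφ : φ ∈ T.F) {d : ℕ} (hd : IsCovariant T.U φ d) {f : CInf} (hf : tsupport f ⊆ upperArc) (s t : ℝ) :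
    φ (beta d (v s) f) * (T.U (v t) * y * T.U (v t)⁻¹) =
      T.U (v t) * y * T.U (v t)⁻¹ * φ (beta d (v s) f) := by
  have h1 := T.commute_of_mem_polyAlg hφ
    (tsupport_beta_v_subset d (-t) (tsupport_beta_v_subset d s hf)) h.mem_polyAlg
  rw [← hd, v_inv, neg_neg] at h1
  have h2 : T.U (v t) * T.U (v (-t)) = 1 := by rw [← map_mul, ← v_inv, mul_inv_cancel, map_one]
  have h3 := congrArg (fun z => T.U (v t) * z * T.U (v (-t))) h1.eq
  rw [v_inv]
  calc _ = T.U (v t) * T.U (v (-t)) * φ (beta d (v s) f) * (T.U (v t) * y * T.U (v (-t))) := by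
        rw [h2, one_mul]
    _ = _ := by simp only [mul_assoc] at h3 ⊢; exact h3
    _ = T.U (v t) * y * T.U (v (-t)) * φ (beta d (v s) f) * (T.U (v t) * T.U (v (-t))) := by
        simp only [mul_assoc]
    _ = _ := by rw [h2, mul_one]

theorem ReflectedWord.stripPair {x y : Module.End ℂ D} (h : T.ReflectedWord x y) (Φ' : D) :
    StripPair (fun t => T.form (T.U (v t) (x T.Ω)) Φ') fun t => T.form (T.U (v t) (y T.Ω)) Φ' := by
  induction h generalizing Φ' with
  | one => simpa only [Module.End.one_apply, T.vacuum_invariant] using StripPair.const _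
  | @field_mul φ hφ d hd f hf x y h ih =>
    have hl := T.isCompatible_form Φ'
    obtain ⟨hx, hy⟩ := h.temperedOp
    have hw := (angularFamily_beta d f).temperedFamily_fst
    have hw' := (angularFamily_beta d f.reflect).temperedFamily_fst
    -- The three functions of (s, t): s drives the new field, t the remaining word. In the first the
    -- word is x; in the second it is y; in the third it is y with the reflected field on its right.
    obtain ⟨A₀, h₀⟩ := hl.gaussGrowth (.field_mul hφ hw hx) T.Ω
    obtain ⟨A₁, h₁⟩ := hl.gaussGrowth (.field_mul hφ hw hy) T.Ω
    obtain ⟨A₂, h₂⟩ := hl.gaussGrowth (.smul ((-1 : ℂ) ^ d) (hy.mul (.field_mul hφ hw' .one))) T.Ω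
    have key := StripPair.diag h₀ h₁ h₂ (fun s => ?_) (fun t => ?_)
    · convert key using 2 with t t
      · rw [← U_mul_field_mul hd, U_mul_mul_vacuum]
        rfl
      · rw [mul_one, ← U_mul_mul_field hd, ← U_mul_mul_vacuum, mul_smul_comm, mul_smul_comm, smul_mul_assoc]
        rfl
    -- For fixed s the field is moved to the second argument of the form. The induction hypothesis
    -- is then used for the changed vector, which is why it is needed for every Φ'.
    · simp only [LinearMap.flip_apply, Module.End.mul_apply (φ _), U_mul_mul_vacuum,
        T.form_field φ hφ d hd]
      exact ih _
    -- For fixed t the word is commuted to the left of the field and moved to the second argument.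
    -- What remains is g ↦ ⟨φ(g)Ω, ·⟩, a functional vanishing on the modes that kill the vacuum.
    · obtain ⟨y', -, hy'⟩ := T.exists_adjoint_mem_polyAlg h.mem_polyAlg
      have hadj := ((T.isAdjoint_U (v t)).mul hy').mul (T.isAdjoint_U (v t)⁻¹)
      have hstrip := stripPair_of_annihilates d (fieldFunctional φ T.Ω (T.form.flip _))
        ((T.isCompatible_form ((T.U (v t)⁻¹⁻¹ * (y' * T.U (v t)⁻¹)) Φ')).continuous_smear hφ T.Ω) (fun n hn => by
          rw [fieldFunctional, LinearMap.comp_apply, LinearMap.comp_apply, LinearMap.applyₗ_apply_apply,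
            T.mode_vacuum_eq_zero hφ hd hn, map_zero]) hf
      convert hstrip using 2 with s s
      · rw [h.commute hφ hd hf]
        exact hadj _ Φ'
      · rw [LinearMap.smul_apply, map_smul, mul_one, smul_eq_mul]
        congr 1
        exact hadj _ Φ'

/-! ### From products of fields to the operators `V`. -/

variable (T)

theorem exists_reflectedWord {x : Module.End ℂ D}
    (hx : x ∈ Submonoid.closure {x | ∃ φ ∈ T.F, ∃ f : CInf, tsupport f ⊆ upperArc ∧ x = φ f}) :
    ∃ y, T.ReflectedWord x y := by
  induction hx using Submonoid.closure_induction_left with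
  | one => exact ⟨1, .one⟩
  | mul_left x hx y _ ih =>
    obtain ⟨φ, hφ, f, hf, rfl⟩ := hx
    obtain ⟨d, hd⟩ := T.covariant φ hφ
    obtain ⟨y', h⟩ := ih
    exact ⟨_, .field_mul hφ hd hf h⟩

variable {T}

theorem ReflectedWord.mem_graphV {x y : Module.End ℂ D} (h : T.ReflectedWord x y) :
    (x T.Ω, y T.Ω) ∈ T.graphV (Real.pi * Complex.I) := fun Φ' => by
  obtain ⟨G, h1, h2, -, h3, h4⟩ := h.stripPair Φ'
  have him : (Real.pi * Complex.I : ℂ).im = Real.pi := by simp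
  refine ⟨G, ?_, ?_, h3, fun t => by rw [add_comm]; exact h4 t⟩
  · rwa [strip, him, Set.uIcc_of_le Real.pi_pos.le]
  · rwa [interior_strip, him, min_eq_left Real.pi_pos.le, max_eq_right Real.pi_pos.le]

variable (T)

theorem exists_adjoint_mem_graphV {x : Module.End ℂ D} (hx : x ∈ T.polyAlg upperArc) :
    ∃ x', T.IsAdjoint x x' ∧ (x T.Ω, T.θ (x' T.Ω)) ∈ T.graphV (Real.pi * Complex.I) := by
  -- The algebra is the linear span of the words in its generators, and x ↦ θ x* Ω is linear, as
  -- both θ and the adjoint are antilinear.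
  rw [WightmanCFT.polyAlg, ← Subalgebra.mem_toSubmodule, Algebra.adjoin_eq_span] at hx
  induction hx using Submodule.span_induction with
  | mem x hx =>
    obtain ⟨y, h⟩ := T.exists_reflectedWord hx
    obtain ⟨x', hx', hy⟩ := h.exists_adjoint
    refine ⟨x', hx', ?_⟩
    have h1 := hy T.Ω
    rw [T.θ_vacuum] at h1
    exact h1 ▸ h.mem_graphV
  | zero => exact ⟨0, fun _ _ => by simp, by
    rw [LinearMap.zero_apply, map_zero]
    exact (T.graphV _).zero_mem⟩
  | add x y _ _ hx hy =>
    obtain ⟨x', hx', h⟩ := hx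
    obtain ⟨y', hy', h'⟩ := hy
    exact ⟨x' + y', hx'.add hy', by simpa using add_mem h h'⟩
  | smul c x _ hx =>
    obtain ⟨x', hx', h⟩ := hx
    refine ⟨conj c • x', fun Φ Ψ => ?_, by simpa using Submodule.smul_mem _ c h⟩
    rw [LinearMap.smul_apply, map_smul, LinearMap.smul_apply, hx', LinearMap.smul_apply, form_smul_right,
      Complex.conj_conj, smul_eq_mul]

/-- Translating the strip by iπ exchanges its two boundary lines, so a continuation upwards is one
downwards with the two vectors exchanged. -/
theorem swap_mem_graphV {Φ Ψ : D} (h : (Φ, Ψ) ∈ T.graphV (Real.pi * Complex.I)) :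
    (Ψ, Φ) ∈ T.graphV (-(Real.pi * Complex.I)) := fun Φ' => by
  obtain ⟨G, h1, h2, h3, h4⟩ := h Φ'
  have him : (Real.pi * Complex.I : ℂ).im = Real.pi := by simp
  have him' : (-(Real.pi * Complex.I) : ℂ).im = -Real.pi := by simp
  rw [interior_strip, him, min_eq_left Real.pi_pos.le, max_eq_right Real.pi_pos.le] at h2
  rw [strip, him, Set.uIcc_of_le Real.pi_pos.le] at h1
  refine ⟨fun z => G (Real.pi * Complex.I + z), ?_, ?_, h4, fun t => by simpa using h3 t⟩
  · rw [strip, him', Set.uIcc_of_ge (by linarith [Real.pi_pos])]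
    refine h1.comp (by fun_prop) fun z hz => ?_
    obtain ⟨hz1, hz2⟩ := hz
    rw [Set.mem_ofPred_eq, Complex.add_im, him]
    exact ⟨by linarith, by linarith⟩
  · rw [interior_strip, him', min_eq_right (by linarith [Real.pi_pos]), max_eq_left (by linarith [Real.pi_pos])]
    refine h2.comp (by fun_prop) fun z hz => ?_
    obtain ⟨hz1, hz2⟩ := hz
    rw [Set.mem_preimage, Complex.add_im, him]
    exact ⟨by linarith, by linarith⟩

theorem V_apply_eq {τ : ℂ} {Φ Ψ : D} (h : (Φ, Ψ) ∈ T.graphV τ) :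
    ∃ hdom : Φ ∈ (T.V τ).domain, T.V τ ⟨Φ, hdom⟩ = Ψ := by
  obtain ⟨y, hy1, hy2⟩ := LinearPMap.mem_graph_iff _ |>.1 ((T.mem_graph_V τ Φ Ψ).2 h)
  simp only at hy1 hy2
  exact ⟨hy1 ▸ y.2, by rw [← hy2]; congr 1; exact Subtype.ext hy1.symm⟩

end InvolutiveWightmanCFT

end MobiusCFT
end

theorem mainTheorem2 {D : Type*} [AddCommGroup D] [Module ℂ D]
    (T : MobiusCFT.InvolutiveWightmanCFT D) :
    (∀ x ∈ T.polyAlg MobiusCFT.upperArc,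
      ∃ (hx : x ∈ T.EndStar) (hdom : x T.Ω ∈ (T.V (Real.pi * Complex.I)).domain),
        T.V (Real.pi * Complex.I) ⟨x T.Ω, hdom⟩ = T.θ (T.adj ⟨x, hx⟩ T.Ω)) ∧
    (∀ x ∈ T.polyAlg MobiusCFT.lowerArc,
      ∃ (hx : x ∈ T.EndStar) (hdom : x T.Ω ∈ (T.V (-(Real.pi * Complex.I))).domain),
        T.V (-(Real.pi * Complex.I)) ⟨x T.Ω, hdom⟩ = T.θ (T.adj ⟨x, hx⟩ T.Ω)) := by
  refine ⟨fun x hx => ⟨T.mem_EndStar_of_mem_polyAlg hx, T.V_apply_eq ?_⟩,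
    fun y hy => ⟨T.mem_EndStar_of_mem_polyAlg hy, T.V_apply_eq ?_⟩⟩
  · obtain ⟨x', hx', h⟩ := T.exists_adjoint_mem_graphV hx
    rwa [(T.isAdjoint_adj _).unique T hx']
  -- For y over the lower semicircle, x = θ y* θ lies over the upper one and x* = θ y θ. The first
  -- part gives V_{iπ} θy*Ω = yΩ, and exchanging the boundary lines gives V_{-iπ} yΩ = θy*Ω.
  · obtain ⟨y', hy', hadj⟩ := T.exists_adjoint_mem_polyAlg hy
    obtain ⟨x, hx, hxy⟩ := T.exists_θ_conj_mem_polyAlg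
      (fun f => MobiusCFT.tsupport_reflect_subset_upperArc) hy'
    obtain ⟨x', hx', h⟩ := T.exists_adjoint_mem_graphV hx
    rw [(T.isAdjoint_adj _).unique T hadj]
    obtain ⟨z, -, hz⟩ := T.exists_θ_conj_mem_polyAlg
      (fun f => MobiusCFT.tsupport_reflect_subset_upperArc) hy
    rw [hx'.unique T (T.isAdjoint_θ_conj hadj.symm hxy hz), hz, hxy, T.θ_vacuum, T.θ_involutive] at h
    exact T.swap_mem_graphV h
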